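/- **Conventions.** Vocabularies are many-sorted, with relation symbols and function symbols (constants are function symbols without arguments); structures have a nonempty domain for each sort, and $|\mathcal A|$ is the total cardinality of the (disjoint union of the) domains. For $\tau\subseteq\tau'$ the reduct $\mathcal B{\upharpoonright}\tau$ keeps only the domains of the sorts of $\tau$ and the interpretations of the symbols of $\tau$. $L_{\omega\omega}$ is many-sorted first-order logic, and $L(\mathrm I)$ is $L_{\omega\omega}$ with the Härtig quantifier $$\mathcal A\models \mathrm I yz\,\varphi(y)\,\psi(z)\iff |\{a:\mathcal A\models\varphi[a]\}|=|\{b:\mathcal A\models\psi[b]\}|,$$ where each of $y,z$ may be of any sort. $\mathrm{Cd}(x)$ is the predicate "$x$ is a cardinal (an initial ordinal)". For a logic $L$, a class $\mathcal K$ of $\tau$-structures is *a bounded projection of $\mathrm{Mod}(\varphi)$*, where $\varphi\in L$ is a sentence in a vocabulary $\tau'\supseteq\tau$, if $\mathcal K=\{\mathcal B{\upharpoonright}\tau:\mathcal B\models\varphi\}$ and for every $\tau$-structure $\mathcal A$ there is a cardinal $\lambda_{\mathcal A}$ with $|\mathcal B|\le\lambda_{\mathcal A}$ for all $\mathcal B\models\varphi$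 with $\mathcal B{\upharpoonright}\tau=\mathcal A$. $\mathcal K$ is $\Sigma^{B}(L)$-axiomatisable if it is a bounded projection of $\mathrm{Mod}(\varphi)$ for some such $\tau'$ and $\varphi$, and $\Delta^B(L)$-axiomatisable if $\mathcal K$ and its complement in the class of $\tau$-structures both are $\Sigma^B(L)$-axiomatisable. A non-decreasing $F:\mathrm{Card}\to\mathrm{Card}$ is *definably bounding* if the class of two-sorted structures $(A,B)$ (without symbols) with $|B|\le F(|A|)$ is $\Sigma^B(L_{\omega\omega})$-axiomatisable. Let $\rho_{\mathbf H}(x)=\max(\aleph_0,|\mathrm{trcl}(x)|)$. For a predicate $R$ of sets, a class $X$ of sets is $\Sigma_1^F(R)$ if there is a (parameter-free) $\Delta_0(R)$-formula $\psi(x,y)$ such that $x\in X\leftrightarrow\exists y\,\psi(x,y)$ for all $x$, and every $x\in X$ has some $y$ with $\psi(x,y)$ and $\rho_{\mathbf H}(y)\le F(\rho_{\mathbf H}(x))$; $X$ is $\Delta_1^F(R)$ if $X$ and its complement are both $\Sigma_1^F(R)$. $L$ and $R$ are *boundedly symbiotic* if (1) the satisfaction relation of $L$, as a class of ordered pairs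 $(\mathcal A,\varphi)$ with $\mathcal A\models\varphi$ (structures in arbitrary vocabularies, sentences and symbols being coded as sets in the usual way), is $\Delta_1^F(R)$ for some definably bounding $F$; and (2) for every definably bounding $F$ and every finite vocabulary $\tau$ (whose symbols are named by natural numbers), every class of $\tau$-structures that is closed under isomorphisms and $\Delta_1^F(R)$ is $\Delta^B(L)$-axiomatisable. **Proposition.** $L(\mathrm I)$ and $\mathrm{Cd}$ are boundedly symbiotic. More precisely, in addition to this: (a) The function $F(\alpha)=2^{2^\alpha}$ is definably bounding, and the satisfaction relation of $L(\mathrm I)$ is $\Delta_1^F(\mathrm{Cd})$ for this $F$. (b) The class of structures $(A,E)$, $E$ a binary relation, with $E$ well-founded is $\Sigma^B(L(\mathrm I))$-axiomatisable. In fact there is an $L(\mathrm I)$-sentence $\Phi$ in the two-sorted vocabulary of structures $(A,B,E,<,f)$, with $E\subseteq A\times A$, ${<}\subseteq B\times B$ and $f:A\to B$, such that this class is a bounded projection of $\mathrm{Mod}(\Phi)$, and in every model $(A,B,E,<,f)$ of $\Phi$, writing $b{\downarrow}=\{x\in B:x<b\}$: - $<$ is a strict linear order of $B$, and it is cardinal-like: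 $|b{\downarrow}|<|B|$ for all $b\in B$; - $a\mathrel E a'$ implies $f(a)<f(a')$; - for all $a\in A$, $f(a){\downarrow}$ is infinite, and $|b{\downarrow}|<|f(a){\downarrow}|$ for all $b<f(a)$; - $|B|\le\aleph_{\mathrm{rk}_E(A)}$, where $\mathrm{rk}_E(A)=\sup\{\mathrm{rk}_E(a)+1:a\in A\}$ is the rank of the well-founded relation $E$. -/

import Mathlib

universe u

open Cardinal

namespace BSymb

/-! ## Many-sorted vocabularies, structures and reducts -/

/-- A many-sorted vocabulary. Relation symbols are grouped by their list of argument sorts, function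
symbols by their list of argument sorts and their value sort; a constant symbol is a function
symbol with no arguments. -/
structure Voc : Type (u + 1) where
  sorts : Type u
  rels : List sorts → Type u
  funs : List sorts → sorts → Type u

/-- The vocabulary has finitely many symbols (sorts, relation symbols and function symbols). -/
def Voc.IsFinite (τ : Voc.{u}) : Prop :=
  Finite τ.sorts ∧ Finite (Σ Δ, τ.rels Δ) ∧ Finite (Σ p : List τ.sorts × τ.sorts, τ.funs p.1 p.2)

/-- `τ ⊆ τ'`: the symbols of `τ` are identified with symbols of `τ'` of the same type. -/
structure Voc.Incl (τ τ' : Voc.{u}) where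
  sort : τ.sorts → τ'.sorts
  rel : ∀ {Δ : List τ.sorts}, τ.rels Δ → τ'.rels (Δ.map sort)
  fn : ∀ {Δ : List τ.sorts} {s : τ.sorts}, τ.funs Δ s → τ'.funs (Δ.map sort) (sort s)
  sort_inj : Function.Injective sort
  rel_inj : ∀ Δ : List τ.sorts, Function.Injective (@rel Δ)
  fn_inj : ∀ (Δ : List τ.sorts) (s : τ.sorts), Function.Injective (@fn Δ s)

/-- Tuples `(a₁, …, aₙ)` with `aᵢ ∈ D sᵢ`, for a list of sorts `[s₁, …, sₙ]`. -/
def Tup {S : Type u} (D : S → Type u) : List S → Type u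
  | [] => PUnit
  | s :: Δ => D s × Tup D Δ

/-- Apply a sort-respecting map to every entry of a tuple. -/
def Tup.map {S : Type u} {D D' : S → Type u} (g : ∀ s, D s → D' s) :
    (Δ : List S) → Tup D Δ → Tup D' Δ
  | [], _ => PUnit.unit
  | s :: Δ, t => (g s t.1, Tup.map g Δ t.2)

/-- The same tuple, with its sorts renamed along `i`. -/
def Tup.push {S S' : Type u} (i : S → S') (D : S' → Type u) :
    (Δ : List S) → Tup (fun s => D (i s)) Δ → Tup D (Δ.map i)
  | [], _ => PUnit.unit
  | _ :: Δ, t => (t.1, Tup.push i D Δ t.2)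

/-- A `τ`-structure: a nonempty domain for each sort, and interpretations of the symbols. -/
structure Struct (τ : Voc.{u}) : Type (u + 1) where
  dom : τ.sorts → Type u
  dom_nonempty : ∀ s, Nonempty (dom s)
  rel : ∀ {Δ : List τ.sorts}, τ.rels Δ → Tup dom Δ → Prop
  fn : ∀ {Δ : List τ.sorts} {s : τ.sorts}, τ.funs Δ s → Tup dom Δ → dom s

/-- The cardinality of a structure: all its domains together. -/
noncomputable def Struct.card {τ : Voc.{u}} (M : Struct τ) : Cardinal.{u} := #(Σ s, M.dom s)

/-- The reduct of a `τ'`-structure to `τ ⊆ τ'`: only the domains of the sorts of `τ` are kept. -/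
def Struct.reduct {τ τ' : Voc.{u}} (i : Voc.Incl τ τ') (M : Struct τ') : Struct τ where
  dom := fun s => M.dom (i.sort s)
  dom_nonempty := fun s => M.dom_nonempty (i.sort s)
  rel := fun {Δ} r t => M.rel (i.rel r) (Tup.push i.sort M.dom Δ t)
  fn := fun {Δ _} f t => M.fn (i.fn f) (Tup.push i.sort M.dom Δ t)

/-- Isomorphisms of `τ`-structures. -/
structure Struct.Iso {τ : Voc.{u}} (M N : Struct τ) where
  equiv : ∀ s, M.dom s ≃ N.dom s
  map_rel : ∀ {Δ : List τ.sorts} (r : τ.rels Δ) (t : Tup M.dom Δ),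
    M.rel r t ↔ N.rel r (Tup.map (fun s => equiv s) Δ t)
  map_fn : ∀ {Δ : List τ.sorts} {s : τ.sorts} (f : τ.funs Δ s) (t : Tup M.dom Δ),
    equiv s (M.fn f t) = N.fn f (Tup.map (fun s => equiv s) Δ t)

/-- A class of `τ`-structures is closed under isomorphisms. -/
def IsoClosed {τ : Voc.{u}} (K : Set (Struct τ)) : Prop :=
  ∀ M N : Struct τ, M ∈ K → Nonempty (Struct.Iso M N) → N ∈ K

/-! ## Many-sorted first-order logic with the Härtig quantifier -/

/-- Variables of a sort in a context `Γ` (the list of the sorts of the free variables): the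
positions in `Γ` at which that sort stands. -/
inductive Var {S : Type u} : List S → S → Type u
  | zero {Γ : List S} {s : S} : Var (s :: Γ) s
  | succ {Γ : List S} {s t : S} : Var Γ s → Var (t :: Γ) s

/-- The position of a variable. -/
def Var.index {S : Type u} : {Γ : List S} → {s : S} → Var Γ s → ℕ
  | _, _, .zero => 0
  | _, _, .succ v => v.index + 1

/-- The value of a variable under an assignment. -/
def Var.eval {S : Type u} {D : S → Type u} : {Γ : List S} → {s : S} → Var Γ s → Tup D Γ → D s
  | _, _, .zero, a => a.1
  | _, _, .succ v, a => v.eval a.2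

mutual
/-- Terms of a given sort, in context `Γ`. -/
inductive Term (τ : Voc.{u}) (Γ : List τ.sorts) : τ.sorts → Type u
  | var {s : τ.sorts} (v : Var Γ s) : Term τ Γ s
  | app {Δ : List τ.sorts} {s : τ.sorts} (f : τ.funs Δ s) (ts : Terms τ Γ Δ) : Term τ Γ s
/-- Lists of terms of given sorts, in context `Γ`. -/
inductive Terms (τ : Voc.{u}) (Γ : List τ.sorts) : List τ.sorts → Type u
  | nil : Terms τ Γ []
  | cons {s : τ.sorts} {Δ : List τ.sorts} (t : Term τ Γ s) (ts : Terms τ Γ Δ) : Terms τ Γ (s :: Δ)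
end

/-- Formulas in context `Γ`. `all s φ` is `∀ x φ(x)` with `x` of sort `s`, and `hartig s t φ ψ` is
`I y z φ(y) ψ(z)` with `y` of sort `s` and `z` of sort `t`; the bound variable is the first one of
the enlarged context. The other connectives and `∃` are the usual abbreviations. -/
inductive Formula (τ : Voc.{u}) : List τ.sorts → Type u
  | falsum {Γ : List τ.sorts} : Formula τ Γ
  | eq {Γ : List τ.sorts} {s : τ.sorts} (t₁ t₂ : Term τ Γ s) : Formula τ Γ
  | rel {Γ Δ : List τ.sorts} (r : τ.rels Δ) (ts : Terms τ Γ Δ) : Formula τ Γ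
  | imp {Γ : List τ.sorts} (φ ψ : Formula τ Γ) : Formula τ Γ
  | all {Γ : List τ.sorts} (s : τ.sorts) (φ : Formula τ (s :: Γ)) : Formula τ Γ
  | hartig {Γ : List τ.sorts} (s t : τ.sorts) (φ : Formula τ (s :: Γ)) (ψ : Formula τ (t :: Γ)) :
      Formula τ Γ

/-- Sentences: formulas without free variables. -/
abbrev Sentence (τ : Voc.{u}) : Type u := Formula τ []

/-- No Härtig quantifier occurs in the formula. -/
def Formula.IsFirstOrder {τ : Voc.{u}} : {Γ : List τ.sorts} → Formula τ Γ → Prop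
  | _, .falsum => True
  | _, .eq _ _ => True
  | _, .rel _ _ => True
  | _, .imp φ ψ => φ.IsFirstOrder ∧ ψ.IsFirstOrder
  | _, .all _ φ => φ.IsFirstOrder
  | _, .hartig _ _ _ _ => False

mutual
/-- The value of a term under an assignment. -/
def Term.eval {τ : Voc.{u}} (M : Struct τ) {Γ : List τ.sorts} (a : Tup M.dom Γ) :
    {s : τ.sorts} → Term τ Γ s → M.dom s
  | _, .var v => v.eval a
  | _, .app f ts => M.fn f (ts.eval M a)
/-- The tuple of the values of a list of terms under an assignment. -/
def Terms.eval {τ : Voc.{u}} (M : Struct τ) {Γ : List τ.sorts} (a : Tup M.dom Γ) :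
    {Δ : List τ.sorts} → Terms τ Γ Δ → Tup M.dom Δ
  | _, .nil => PUnit.unit
  | _, .cons t ts => (t.eval M a, ts.eval M a)
end

/-- Satisfaction of a formula under an assignment. The Härtig quantifier says that the two sets have
the same cardinality. -/
def Formula.Realize {τ : Voc.{u}} (M : Struct τ) :
    {Γ : List τ.sorts} → Formula τ Γ → Tup M.dom Γ → Prop
  | _, .falsum, _ => False
  | _, .eq t₁ t₂, a => t₁.eval M a = t₂.eval M a
  | _, .rel r ts, a => M.rel r (ts.eval M a)
  | _, .imp φ ψ, a => φ.Realize M a → ψ.Realize M a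
  | _, .all s φ, a => ∀ x : M.dom s, φ.Realize M ((x, a) : M.dom s × Tup M.dom _)
  | _, .hartig s t φ ψ, a =>
      #{y : M.dom s // φ.Realize M ((y, a) : M.dom s × Tup M.dom _)} =
        #{z : M.dom t // ψ.Realize M ((z, a) : M.dom t × Tup M.dom _)}

/-- `M ⊨ φ` for a sentence `φ`. -/
def Struct.Sat {τ : Voc.{u}} (M : Struct τ) (φ : Sentence τ) : Prop :=
  φ.Realize M (PUnit.unit : Tup M.dom [])

/-- A logic, given by its set of sentences in every vocabulary (within the syntax above). -/
abbrev Logic : Type (u + 1) := ∀ τ : Voc.{u}, Set (Sentence τ)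

/-- The Härtig-quantifier logic `L(I)`. -/
def LI : Logic.{u} := fun _ => Set.univ

/-- First-order logic `L_{ωω}`. -/
def LFO : Logic.{u} := fun _ => {φ | φ.IsFirstOrder}

/-! ## Bounded projections -/

/-- `K` is a bounded projection of `Mod(φ)`: it consists of the reducts of the models of `φ`, and the
cardinality of a model of `φ` is bounded in terms of its reduct. -/
def IsBoundedProjection {τ τ' : Voc.{u}} (i : Voc.Incl τ τ') (φ : Sentence τ')
    (K : Set (Struct τ)) : Prop :=
  (∀ A : Struct τ, A ∈ K ↔ ∃ B : Struct τ', B.Sat φ ∧ B.reduct i = A) ∧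
  ∀ A : Struct τ, ∃ c : Cardinal.{u}, ∀ B : Struct τ', B.Sat φ → B.reduct i = A → B.card ≤ c

/-- `K` is `Σ^B(L)`-axiomatisable. -/
def SigmaB (L : Logic.{u}) {τ : Voc.{u}} (K : Set (Struct τ)) : Prop :=
  ∃ (τ' : Voc.{u}) (i : Voc.Incl τ τ') (φ : Sentence τ'), φ ∈ L τ' ∧ IsBoundedProjection i φ K

/-- `K` is `Δ^B(L)`-axiomatisable. -/
def DeltaB (L : Logic.{u}) {τ : Voc.{u}} (K : Set (Struct τ)) : Prop :=
  SigmaB L K ∧ SigmaB L Kᶜ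

/-- The two sorts of the vocabulary used to compare cardinalities. -/
inductive TwoSort : Type u
  | A
  | B

/-- The vocabulary with two sorts and no other symbols. -/
def twoVoc : Voc.{u} where
  sorts := TwoSort
  rels := fun _ => PEmpty
  funs := fun _ _ => PEmpty

/-- `F` is definably bounding: it is non-decreasing, and the class of all `(A, B)` with
`|B| ≤ F(|A|)` is `Σ^B(L_{ωω})`-axiomatisable. -/
def DefinablyBounding (F : Cardinal.{u} → Cardinal.{u}) : Prop :=
  Monotone F ∧ SigmaB LFO {M : Struct twoVoc.{u} | #(M.dom TwoSort.B) ≤ F #(M.dom TwoSort.A)}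

/-! ## Bounded definability in set theory -/

/-- The transitive closure of a set. -/
noncomputable def trcl (x : ZFSet.{u}) : ZFSet.{u} :=
  ZFSet.sep (fun y => Relation.TransGen (fun a b : ZFSet.{u} => a ∈ b) y x)
    (ZFSet.vonNeumann x.rank)

theorem mem_trcl {x y : ZFSet.{u}} :
    y ∈ trcl x ↔ Relation.TransGen (fun a b : ZFSet.{u} => a ∈ b) y x := by
  refine ZFSet.mem_sep.trans ⟨fun h => h.2, fun h => ⟨?_, h⟩⟩
  rw [ZFSet.mem_vonNeumann]
  induction h using Relation.TransGen.head_induction_on with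
  | single h => exact ZFSet.rank_lt_of_mem h
  | head h _ ih => exact (ZFSet.rank_lt_of_mem h).trans ih

/-- The `H`-rank of `x`: the least infinite `κ` with `x ∈ H_{κ⁺}`, that is, with
`|trcl(x)| ≤ κ`. -/
noncomputable def hRank (x : ZFSet.{u}) : Cardinal.{u} := max ℵ₀ (trcl x).card

/-- `Δ₀(R)`-formulas of set theory, for a unary predicate `R`, with `n` free variables.
`ball i φ` is `∀ z ∈ xᵢ, φ(z, x)`; in `φ` the bound variable is number `0`, the others are shifted. -/
inductive Delta0 : ℕ → Type
  | falsum {n : ℕ} : Delta0 n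
  | mem {n : ℕ} (i j : Fin n) : Delta0 n
  | eq {n : ℕ} (i j : Fin n) : Delta0 n
  | pred {n : ℕ} (i : Fin n) : Delta0 n
  | imp {n : ℕ} (φ ψ : Delta0 n) : Delta0 n
  | ball {n : ℕ} (i : Fin n) (φ : Delta0 (n + 1)) : Delta0 n

/-- Truth of a `Δ₀(R)`-formula in the universe of sets. -/
def Delta0.Realize (R : ZFSet.{u} → Prop) : {n : ℕ} → Delta0 n → (Fin n → ZFSet.{u}) → Prop
  | _, .falsum, _ => False
  | _, .mem i j, v => v i ∈ v j
  | _, .eq i j, v => v i = v j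
  | _, .pred i, v => R (v i)
  | _, .imp φ ψ, v => φ.Realize R v → ψ.Realize R v
  | _, .ball i φ, v => ∀ z ∈ v i, φ.Realize R (Fin.cons z v)

/-- The class `X` is `Σ₁^F(R)`-definable (without parameters): for some `Δ₀(R)`-formula `ψ(x, y)`,
`x ∈ X ↔ ∃ y, ψ(x, y)`, and for `x ∈ X` there is such a `y` with `ρ_H(y) ≤ F(ρ_H(x))`. -/
def IsSigma1 (F : Cardinal.{u} → Cardinal.{u}) (R : ZFSet.{u} → Prop) (X : Set ZFSet.{u}) : Prop :=
  ∃ ψ : Delta0 2, (∀ x, x ∈ X ↔ ∃ y, ψ.Realize R ![x, y]) ∧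
    ∀ x ∈ X, ∃ y, hRank y ≤ F (hRank x) ∧ ψ.Realize R ![x, y]

/-- The class `X` is `Δ₁^F(R)`-definable. -/
def IsDelta1 (F : Cardinal.{u} → Cardinal.{u}) (R : ZFSet.{u} → Prop) (X : Set ZFSet.{u}) : Prop :=
  IsSigma1 F R X ∧ IsSigma1 F R Xᶜ

/-- The predicate `Cd`: `x` is a cardinal, that is, an initial ordinal. -/
def Cd (x : ZFSet.{u}) : Prop := x.IsOrdinal ∧ ∀ y ∈ x, y.card < x.card

/-! ## Structures and sentences as sets -/

/-- The natural number `n` as a set (a von Neumann ordinal). -/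
noncomputable def num : ℕ → ZFSet.{u}
  | 0 => ∅
  | n + 1 => insert (num n) (num n)

/-- Names (arbitrary sets) for the symbols of a vocabulary. As a set, a symbol is its name together
with its sorts, so symbols of different types may share a name. -/
structure Naming (τ : Voc.{u}) where
  sort : τ.sorts → ZFSet.{u}
  rel : ∀ {Δ : List τ.sorts}, τ.rels Δ → ZFSet.{u}
  fn : ∀ {Δ : List τ.sorts} {s : τ.sorts}, τ.funs Δ s → ZFSet.{u}
  sort_inj : Function.Injective sort
  rel_inj : ∀ Δ : List τ.sorts, Function.Injective (@rel Δ)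
  fn_inj : ∀ (Δ : List τ.sorts) (s : τ.sorts), Function.Injective (@fn Δ s)

/-- All names are natural numbers. -/
def Naming.IsNatural {τ : Voc.{u}} (ν : Naming τ) : Prop :=
  (∀ s, ∃ n, ν.sort s = num n) ∧
  (∀ (Δ : List τ.sorts) (r : τ.rels Δ), ∃ n, ν.rel r = num n) ∧
  (∀ (Δ : List τ.sorts) (s : τ.sorts) (f : τ.funs Δ s), ∃ n, ν.fn f = num n)

/-- The set coding a finite sequence of sets, as iterated ordered pairs ending in `∅`. -/
noncomputable def codeList : List ZFSet.{u} → ZFSet.{u}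
  | [] => ∅
  | x :: l => ZFSet.pair x (codeList l)

/-- A relation symbol as a set. -/
noncomputable def Naming.codeRel {τ : Voc.{u}} (ν : Naming τ) {Δ : List τ.sorts} (r : τ.rels Δ) :
    ZFSet.{u} :=
  ZFSet.pair (ν.rel r) (codeList (Δ.map ν.sort))

/-- A function symbol as a set. -/
noncomputable def Naming.codeFn {τ : Voc.{u}} (ν : Naming τ) {Δ : List τ.sorts} {s : τ.sorts}
    (f : τ.funs Δ s) : ZFSet.{u} :=
  ZFSet.pair (ν.fn f) (ZFSet.pair (codeList (Δ.map ν.sort)) (ν.sort s))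

/-- A choice of sets as the elements of the domains: it turns a structure into one whose domains are
sets of the universe of sets. -/
structure Elems {τ : Voc.{u}} (M : Struct τ) where
  el : ∀ s, M.dom s → ZFSet.{u}
  el_inj : ∀ s, Function.Injective (el s)

/-- A tuple of elements as a set. -/
noncomputable def codeTup {S : Type u} {D : S → Type u} (e : ∀ s, D s → ZFSet.{u}) :
    (Δ : List S) → Tup D Δ → ZFSet.{u}
  | [], _ => ∅
  | s :: Δ, t => ZFSet.pair (e s t.1) (codeTup e Δ t.2)

/-- A structure as a set: the triple of the functions which send each sort to its domain, each
relation symbol to its interpretation (a set of tuples), and each function symbol to its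
interpretation (the graph of a function on tuples). -/
noncomputable def codeStruct {τ : Voc.{u}} (ν : Naming τ) (M : Struct τ) (e : Elems M) :
    ZFSet.{u} :=
  ZFSet.pair
    (ZFSet.range fun s : τ.sorts => ZFSet.pair (ν.sort s) (ZFSet.range (e.el s)))
    (ZFSet.pair
      (ZFSet.range fun r : Σ Δ, τ.rels Δ =>
        ZFSet.pair (ν.codeRel r.2)
          (ZFSet.range fun t : {t : Tup M.dom r.1 // M.rel r.2 t} => codeTup e.el r.1 t.1))
      (ZFSet.range fun f : Σ p : List τ.sorts × τ.sorts, τ.funs p.1 p.2 =>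
        ZFSet.pair (ν.codeFn f.2)
          (ZFSet.range fun t : Tup M.dom f.1.1 =>
            ZFSet.pair (codeTup e.el f.1.1 t) (e.el f.1.2 (M.fn f.2 t)))))

mutual
/-- A term as a set. -/
noncomputable def codeTerm {τ : Voc.{u}} (ν : Naming τ) {Γ : List τ.sorts} :
    {s : τ.sorts} → Term τ Γ s → ZFSet.{u}
  | _, .var v => ZFSet.pair (num 0) (num v.index)
  | _, .app f ts => ZFSet.pair (num 1) (ZFSet.pair (ν.codeFn f) (codeTerms ν ts))
/-- A list of terms as a set. -/
noncomputable def codeTerms {τ : Voc.{u}} (ν : Naming τ) {Γ : List τ.sorts} :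
    {Δ : List τ.sorts} → Terms τ Γ Δ → ZFSet.{u}
  | _, .nil => ∅
  | _, .cons t ts => ZFSet.pair (codeTerm ν t) (codeTerms ν ts)
end

/-- A formula as a set. -/
noncomputable def codeFormula {τ : Voc.{u}} (ν : Naming τ) :
    {Γ : List τ.sorts} → Formula τ Γ → ZFSet.{u}
  | _, .falsum => ZFSet.pair (num 0) ∅
  | _, .eq t₁ t₂ => ZFSet.pair (num 1) (ZFSet.pair (codeTerm ν t₁) (codeTerm ν t₂))
  | _, .rel r ts => ZFSet.pair (num 2) (ZFSet.pair (ν.codeRel r) (codeTerms ν ts))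
  | _, .imp φ ψ => ZFSet.pair (num 3) (ZFSet.pair (codeFormula ν φ) (codeFormula ν ψ))
  | _, .all s φ => ZFSet.pair (num 4) (ZFSet.pair (ν.sort s) (codeFormula ν φ))
  | _, .hartig s t φ ψ =>
      ZFSet.pair (num 5)
        (ZFSet.pair (ZFSet.pair (ν.sort s) (codeFormula ν φ))
          (ZFSet.pair (ν.sort t) (codeFormula ν ψ)))

/-- The satisfaction relation of `L`, for all vocabularies at once, as a class of ordered pairs
`(A, φ)` of a structure and a sentence. -/
def satRel (L : Logic.{u}) : Set ZFSet.{u} :=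
  {x | ∃ (τ : Voc.{u}) (ν : Naming τ) (M : Struct τ) (e : Elems M) (φ : Sentence τ),
    φ ∈ L τ ∧ M.Sat φ ∧ x = ZFSet.pair (codeStruct ν M e) (codeFormula ν φ)}

/-- The class of all structures in `K`, as a class of sets. -/
def classCode {τ : Voc.{u}} (ν : Naming τ) (K : Set (Struct τ)) : Set ZFSet.{u} :=
  {x | ∃ M ∈ K, ∃ e : Elems M, x = codeStruct ν M e}

/-- `L` and `R` are boundedly symbiotic. -/
def BoundedlySymbiotic (L : Logic.{u}) (R : ZFSet.{u} → Prop) : Prop :=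
  (∃ F : Cardinal.{u} → Cardinal.{u}, DefinablyBounding F ∧ IsDelta1 F R (satRel L)) ∧
  ∀ F : Cardinal.{u} → Cardinal.{u}, DefinablyBounding F →
    ∀ (τ : Voc.{u}) (ν : Naming τ), τ.IsFinite → ν.IsNatural →
      ∀ K : Set (Struct τ), IsoClosed K → IsDelta1 F R (classCode ν K) → DeltaB L K

/-! ## The vocabularies for well-foundedness -/

/-- The only sort of the structures `(A, E)`. -/
inductive GSort : Type u
  | A

/-- The binary relation symbol `E`. -/
inductive GRel : List GSort.{u} → Type u
  | E : GRel [GSort.A, GSort.A]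

/-- The vocabulary of structures `(A, E)`. -/
def graphVoc : Voc.{u} where
  sorts := GSort
  rels := GRel
  funs := fun _ _ => PEmpty

/-- The relation of a structure `(A, E)`. -/
def graphE (M : Struct graphVoc.{u}) (a a' : M.dom GSort.A) : Prop :=
  M.rel GRel.E (a, a', PUnit.unit)

/-- The two sorts of the structures `(A, B, E, <, f)`. -/
inductive WSort : Type u
  | A
  | B

/-- The relation symbols `E` and `<`. -/
inductive WRel : List WSort.{u} → Type u
  | E : WRel [WSort.A, WSort.A]
  | lt : WRel [WSort.B, WSort.B]

/-- The function symbol `f`, from `A` to `B`. -/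
inductive WFun : List WSort.{u} → WSort.{u} → Type u
  | f : WFun [WSort.A] WSort.B

/-- The vocabulary of structures `(A, B, E, <, f)`. -/
def orderVoc : Voc.{u} where
  sorts := WSort
  rels := WRel
  funs := WFun

/-- The vocabulary of `(A, E)` as a part of that of `(A, B, E, <, f)`. -/
def graphIncl : Voc.Incl graphVoc.{u} orderVoc.{u} where
  sort := fun _ => WSort.A
  rel := fun r => match r with
    | GRel.E => WRel.E
  fn := fun f => f.elim
  sort_inj := fun a b _ => by cases a; cases b; rfl
  rel_inj := fun _ r r' _ => by cases r; cases r'; rfl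
  fn_inj := fun _ _ f => f.elim

section
variable (M : Struct orderVoc.{u})

/-- The relation `E` of `(A, B, E, <, f)`. -/
def orderE (a a' : M.dom WSort.A) : Prop := M.rel WRel.E (a, a', PUnit.unit)

/-- The relation `<` of `(A, B, E, <, f)`. -/
def orderLt (b b' : M.dom WSort.B) : Prop := M.rel WRel.lt (b, b', PUnit.unit)

/-- The function `f` of `(A, B, E, <, f)`. -/
def orderF (a : M.dom WSort.A) : M.dom WSort.B := M.fn WFun.f (a, PUnit.unit)

end

/-- The cardinality of the set of predecessors of `b`. -/
noncomputable def predCard {B : Type u} (lt : B → B → Prop) (b : B) : Cardinal.{u} :=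
  #{x : B // lt x b}

/-- The element `b` is cardinal-like. -/
def ElemCardinalLike {B : Type u} (lt : B → B → Prop) (b : B) : Prop :=
  ∀ b', lt b' b → predCard lt b' < predCard lt b

/-- The order itself is cardinal-like. -/
def CardinalLike {B : Type u} (lt : B → B → Prop) : Prop :=
  ∀ b, predCard lt b < #B

/-- The rank of a well-founded relation: the least ordinal greater than the ranks of all elements. -/
noncomputable def relRank {A : Type u} {E : A → A → Prop} (h : WellFounded E) : Ordinal.{u} :=
  ⨆ a, Order.succ (h.apply a).rank

end BSymb

namespace BSymb

/-! ## Sets -/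

theorem num_eq_toZFSet (n : ℕ) : num.{u} n = (n : Ordinal.{u}).toZFSet := by
  induction n with
  | zero => simp [num]
  | succ n ih => rw [num, ih, Nat.cast_succ, ← Ordinal.toZFSet_add_one]

theorem num_injective : Function.Injective num.{u} := fun m n h => by
  rw [num_eq_toZFSet, num_eq_toZFSet] at h
  exact_mod_cast Ordinal.toZFSet_injective h

@[simp] theorem num_inj {m n : ℕ} : num.{u} m = num n ↔ m = n := num_injective.eq_iff

theorem num_zero : num.{u} 0 = ∅ := rfl

theorem empty_ne_pair (a b : ZFSet.{u}) : ∅ ≠ ZFSet.pair a b := fun h =>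
  ZFSet.notMem_empty ({a} : ZFSet) (h ▸ by simp [ZFSet.pair])

theorem mem_pair_left (a b : ZFSet.{u}) : ({a} : ZFSet) ∈ ZFSet.pair a b := by simp [ZFSet.pair]

theorem mem_pair_right (a b : ZFSet.{u}) : ({a, b} : ZFSet) ∈ ZFSet.pair a b := by
  simp [ZFSet.pair]

theorem rank_lt_pair_left (a b : ZFSet.{u}) : a.rank < (ZFSet.pair a b).rank :=
  (ZFSet.rank_lt_of_mem (by simp : a ∈ ({a} : ZFSet))).trans
    (ZFSet.rank_lt_of_mem (mem_pair_left a b))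

theorem rank_lt_pair_right (a b : ZFSet.{u}) : b.rank < (ZFSet.pair a b).rank :=
  (ZFSet.rank_lt_of_mem (by simp : b ∈ ({a, b} : ZFSet))).trans
    (ZFSet.rank_lt_of_mem (mem_pair_right a b))

theorem fst_mem_of_pair_mem {U a b : ZFSet.{u}} (hU : U.IsTransitive) (h : ZFSet.pair a b ∈ U) :
    a ∈ U :=
  hU _ (hU _ h (mem_pair_left a b)) (by simp)

theorem snd_mem_of_pair_mem {U a b : ZFSet.{u}} (hU : U.IsTransitive) (h : ZFSet.pair a b ∈ U) :
    b ∈ U :=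
  hU _ (hU _ h (mem_pair_right a b)) (by simp)

theorem codeList_injective : Function.Injective codeList.{u} := fun l l' h => by
  induction l generalizing l' with
  | nil => cases l' with
    | nil => rfl
    | cons => exact absurd h (empty_ne_pair _ _)
  | cons a l ih => cases l' with
    | nil => exact absurd h.symm (empty_ne_pair _ _)
    | cons b l' =>
      obtain ⟨h1, h2⟩ := ZFSet.pair_inj.1 h
      rw [h1, ih _ h2]

theorem codeTup_injective {S : Type u} {D : S → Type u} {e : ∀ s, D s → ZFSet.{u}}
    (he : ∀ s, Function.Injective (e s)) (Δ : List S) : Function.Injective (codeTup e Δ) := by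
  intro t t' h
  induction Δ with
  | nil => rfl
  | cons s Δ ih =>
    obtain ⟨h1, h2⟩ := ZFSet.pair_inj.1 h
    exact Prod.ext (he s h1) (ih h2)

/-- Every set is the range of an injective family. -/
theorem exists_family (z : ZFSet.{u}) :
    ∃ (ι : Type u) (f : ι → ZFSet.{u}), Function.Injective f ∧ (∀ y, y ∈ z ↔ ∃ i, f i = y) ∧
      #ι = z.card := by
  refine ⟨Shrink.{u} z, fun i => ((equivShrink z).symm i).1,
    fun i j h => (equivShrink z).symm.injective (Subtype.ext h), fun y => ?_, rfl⟩
  constructor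
  · intro hy
    exact ⟨equivShrink z ⟨y, hy⟩, by simp⟩
  · rintro ⟨i, rfl⟩
    exact ((equivShrink z).symm i).2

theorem card_eq_of_family {ι : Type u} {f : ι → ZFSet.{u}} (hf : Function.Injective f)
    {z : ZFSet.{u}} (hz : ∀ y, y ∈ z ↔ ∃ i, f i = y) : z.card = #ι := by
  rw [← lift_inj.{u, u + 1}, ← ZFSet.cardinalMk_coe_sort]
  have : (z : Set ZFSet.{u}) = Set.range f := by ext y; simp [hz]
  have h2 := Cardinal.mk_range_eq_of_injective (f := f) hf
  rw [← this] at h2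
  rw [← h2]
  exact (lift_id'.{u, u + 1} _).symm

theorem card_range_le {ι : Type u} (f : ι → ZFSet.{u}) : (ZFSet.range f).card ≤ #ι := by
  simpa using ZFSet.lift_card_range_le (f := f)

theorem card_le_of_injOn {x y : ZFSet.{u}} (f : ZFSet.{u} → ZFSet.{u}) (hf : ∀ a ∈ x, f a ∈ y)
    (hi : ∀ a ∈ x, ∀ b ∈ x, f a = f b → a = b) : x.card ≤ y.card := by
  rw [← lift_le.{u + 1}, ← ZFSet.cardinalMk_coe_sort, ← ZFSet.cardinalMk_coe_sort]
  exact Cardinal.mk_le_of_injective (f := fun a : (x : Set ZFSet.{u}) => (⟨f a, hf a a.2⟩ : (y : Set ZFSet.{u})))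
    fun a b h => Subtype.ext (hi a a.2 b b.2 (congrArg Subtype.val h))

/-! ### Transitive closures and the `H`-rank -/

theorem mem_trcl_of_mem {x y : ZFSet.{u}} (h : y ∈ x) : y ∈ trcl x :=
  mem_trcl.2 (.single h)

theorem trcl_isTransitive (x : ZFSet.{u}) : (trcl x).IsTransitive := fun _ hy _ hz =>
  mem_trcl.2 (.head hz (mem_trcl.1 hy))

theorem trcl_subset {x W : ZFSet.{u}} (hW : W.IsTransitive) (h : x ⊆ W) : trcl x ⊆ W := by
  intro y hy
  have := mem_trcl.1 hy
  induction this using Relation.TransGen.head_induction_on with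
  | single h' => exact h h'
  | head h1 h2 ih => exact hW _ (ih (mem_trcl.2 h2)) h1

theorem aleph0_le_hRank (x : ZFSet.{u}) : ℵ₀ ≤ hRank x := le_max_left _ _

theorem card_trcl_le_hRank (x : ZFSet.{u}) : (trcl x).card ≤ hRank x := le_max_right _ _

theorem hRank_le {x W : ZFSet.{u}} {κ : Cardinal.{u}} (hκ : ℵ₀ ≤ κ) (hW : W.IsTransitive)
    (h : x ⊆ W) (hc : W.card ≤ κ) : hRank x ≤ κ :=
  max_le hκ ((ZFSet.card_mono (trcl_subset hW h)).trans hc)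

theorem card_insert_le_of {x y : ZFSet.{u}} {κ : Cardinal.{u}} (hκ : ℵ₀ ≤ κ) (h : y.card ≤ κ) :
    (insert x y).card ≤ κ :=
  ZFSet.card_insert_le.trans (Cardinal.add_le_of_le hκ h (one_le_aleph0.trans hκ))

theorem card_union_le_of {x y : ZFSet.{u}} {κ : Cardinal.{u}} (hκ : ℵ₀ ≤ κ) (hx : x.card ≤ κ)
    (hy : y.card ≤ κ) : (x ∪ y).card ≤ κ :=
  ZFSet.card_union_le.trans (Cardinal.add_le_of_le hκ hx hy)

theorem isTransitive_insert {x W : ZFSet.{u}} (hW : W.IsTransitive) (h : x ⊆ W) :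
    (insert x W).IsTransitive := by
  intro y hy z hz
  rcases ZFSet.mem_insert_iff.1 hy with rfl | hy
  · exact ZFSet.mem_insert_iff.2 (.inr (h hz))
  · exact ZFSet.mem_insert_iff.2 (.inr (hW _ hy hz))

theorem subset_trcl (x : ZFSet.{u}) : x ⊆ trcl x := fun _ => mem_trcl_of_mem

theorem hRank_range {ι : Type u} {f : ι → ZFSet.{u}} {κ : Cardinal.{u}} (hκ : ℵ₀ ≤ κ)
    (hι : #ι ≤ κ) (h : ∀ i, hRank (f i) ≤ κ) : hRank (ZFSet.range f) ≤ κ := by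
  refine hRank_le (W := ZFSet.iUnion fun i => insert (f i) (trcl (f i))) hκ ?_ ?_ ?_
  · exact ZFSet.IsTransitive.iUnion fun i =>
      isTransitive_insert (trcl_isTransitive _) (subset_trcl _)
  · intro y hy
    obtain ⟨i, rfl⟩ := ZFSet.mem_range.1 hy
    exact ZFSet.mem_iUnion.2 ⟨i, by simp⟩
  · have h1 := ZFSet.lift_card_iUnion_le_sum_card (f := fun i => insert (f i) (trcl (f i)))
    rw [lift_id] at h1
    refine h1.trans ((Cardinal.sum_le_sum _ (fun _ => κ) fun i =>
      card_insert_le_of hκ ((card_trcl_le_hRank _).trans (h i))).trans ?_)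
    rw [Cardinal.sum_const, lift_id, lift_id]
    exact Cardinal.mul_le_of_le hκ hι le_rfl

theorem hRank_upair {a b : ZFSet.{u}} {κ : Cardinal.{u}} (ha : hRank a ≤ κ) (hb : hRank b ≤ κ) :
    hRank {a, b} ≤ κ := by
  have hκ := (aleph0_le_hRank a).trans ha
  have hT := (trcl_isTransitive a).union (trcl_isTransitive b)
  refine hRank_le (W := insert a (insert b (trcl a ∪ trcl b))) hκ ?_ ?_ ?_
  · refine isTransitive_insert (isTransitive_insert hT ?_) ?_
    · intro z hz; simp [mem_trcl_of_mem hz]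
    · intro z hz; simp [mem_trcl_of_mem hz]
  · intro z hz
    rcases ZFSet.mem_pair.1 hz with rfl | rfl <;> simp
  · exact card_insert_le_of hκ (card_insert_le_of hκ (card_union_le_of hκ
      ((card_trcl_le_hRank a).trans ha) ((card_trcl_le_hRank b).trans hb)))

theorem hRank_pair {a b : ZFSet.{u}} {κ : Cardinal.{u}} (ha : hRank a ≤ κ) (hb : hRank b ≤ κ) :
    hRank (ZFSet.pair a b) ≤ κ := by
  have : ({a} : ZFSet.{u}) = {a, a} := (ZFSet.pair_eq_singleton a).symm
  rw [ZFSet.pair]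
  exact hRank_upair (this ▸ hRank_upair ha ha) (hRank_upair ha hb)

theorem hRank_toZFSet {o : Ordinal.{u}} {κ : Cardinal.{u}} (hκ : ℵ₀ ≤ κ) (ho : o.card ≤ κ) :
    hRank o.toZFSet ≤ κ :=
  hRank_le hκ (ZFSet.isOrdinal_toZFSet o).isTransitive (fun _ h => h) (by simpa using ho)

theorem hRank_num {n : ℕ} {κ : Cardinal.{u}} (hκ : ℵ₀ ≤ κ) : hRank (num.{u} n) ≤ κ := by
  rw [num_eq_toZFSet]
  exact hRank_toZFSet hκ (by simpa using (Cardinal.natCast_lt_aleph0 (n := n)).le.trans hκ)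

theorem hRank_empty {κ : Cardinal.{u}} (hκ : ℵ₀ ≤ κ) : hRank (∅ : ZFSet.{u}) ≤ κ :=
  hRank_num (n := 0) hκ

theorem hRank_codeList {l : List ZFSet.{u}} {κ : Cardinal.{u}} (hκ : ℵ₀ ≤ κ)
    (h : ∀ x ∈ l, hRank x ≤ κ) : hRank (codeList l) ≤ κ := by
  induction l with
  | nil => exact hRank_empty hκ
  | cons a l ih =>
    exact hRank_pair (h a (by simp)) (ih fun x hx => h x (by simp [hx]))

theorem hRank_codeTup {S : Type u} {D : S → Type u} {e : ∀ s, D s → ZFSet.{u}}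
    {κ : Cardinal.{u}} (hκ : ℵ₀ ≤ κ) (h : ∀ s x, hRank (e s x) ≤ κ) (Δ : List S) (t : Tup D Δ) :
    hRank (codeTup e Δ t) ≤ κ := by
  induction Δ with
  | nil => exact hRank_empty hκ
  | cons s Δ ih => exact hRank_pair (h s _) (ih _)

/-- Adding all unordered pairs of elements of a set. -/
noncomputable def addPairs (z : ZFSet.{u}) : ZFSet.{u} :=
  z ∪ ZFSet.range fun p : Shrink.{u} z × Shrink.{u} z =>
    ({((equivShrink z).symm p.1).1, ((equivShrink z).symm p.2).1} : ZFSet.{u})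

theorem mem_addPairs {z y : ZFSet.{u}} :
    y ∈ addPairs z ↔ y ∈ z ∨ ∃ a ∈ z, ∃ b ∈ z, y = {a, b} := by
  rw [addPairs, ZFSet.mem_union, ZFSet.mem_range]
  refine or_congr_right ⟨?_, ?_⟩
  · rintro ⟨p, rfl⟩
    exact ⟨_, ((equivShrink z).symm p.1).2, _, ((equivShrink z).symm p.2).2, rfl⟩
  · rintro ⟨a, ha, b, hb, rfl⟩
    exact ⟨(equivShrink z ⟨a, ha⟩, equivShrink z ⟨b, hb⟩), by simp⟩

theorem card_addPairs {z : ZFSet.{u}} {κ : Cardinal.{u}} (hκ : ℵ₀ ≤ κ) (h : z.card ≤ κ) :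
    (addPairs z).card ≤ κ :=
  card_union_le_of hκ h ((card_range_le _).trans
    (by rw [mk_prod, lift_id]; exact Cardinal.mul_le_of_le hκ h h))

/-- The closure of a set under unordered pairs. -/
theorem exists_pair_closure {z : ZFSet.{u}} {κ : Cardinal.{u}} (hκ : ℵ₀ ≤ κ)
    (hz : z.IsTransitive) (hc : z.card ≤ κ) :
    ∃ W : ZFSet.{u}, W.IsTransitive ∧ z ⊆ W ∧ W.card ≤ κ ∧ ∀ a ∈ W, ∀ b ∈ W, ZFSet.pair a b ∈ W := by
  have hmono : Monotone fun n : ℕ => addPairs^[n] z := monotone_nat_of_le_succ fun n y hy => by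
    rw [Function.iterate_succ_apply']
    exact mem_addPairs.2 (.inl hy)
  have key : ∀ W : ZFSet.{u}, W = ZFSet.iUnion (fun n : ULift.{u} ℕ => addPairs^[n.down] z) →
      ∀ a ∈ W, ∀ b ∈ W, ({a, b} : ZFSet.{u}) ∈ W := by
    rintro _ rfl a ha b hb
    obtain ⟨⟨m⟩, ha⟩ := ZFSet.mem_iUnion.1 ha
    obtain ⟨⟨n⟩, hb⟩ := ZFSet.mem_iUnion.1 hb
    refine ZFSet.mem_iUnion.2 ⟨⟨max m n + 1⟩, ?_⟩
    dsimp only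
    rw [Function.iterate_succ_apply']
    exact mem_addPairs.2 (.inr ⟨a, hmono (le_max_left m n) ha, b, hmono (le_max_right m n) hb, rfl⟩)
  refine ⟨ZFSet.iUnion (fun n : ULift.{u} ℕ => addPairs^[n.down] z),
    ZFSet.IsTransitive.iUnion fun n => ?_, fun y hy => ZFSet.mem_iUnion.2 ⟨⟨0⟩, hy⟩, ?_,
    fun a ha b hb => ?_⟩
  rotate_left
  · refine (lift_id (ZFSet.card _)).symm.trans_le (ZFSet.lift_card_iUnion_le_sum_card.trans
      ((Cardinal.sum_le_sum _ (fun _ => κ) fun n => ?_).trans ?_))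
    · obtain ⟨n⟩ := n
      dsimp only
      induction n with
      | zero => exact hc
      | succ n ih => rw [Function.iterate_succ_apply']; exact card_addPairs hκ ih
    · rw [Cardinal.sum_const]
      exact Cardinal.mul_le_of_le hκ (by simpa using hκ) (by simp)
  · have h := key _ rfl
    have h1 := h a ha a ha
    rw [ZFSet.pair_eq_singleton] at h1
    exact h _ h1 _ (h a ha b hb)
  · obtain ⟨n⟩ := n
    dsimp only
    induction n with
    | zero => exact hz
    | succ n ih =>
      rw [Function.iterate_succ_apply']
      intro y hy w hw
      rcases mem_addPairs.1 hy with hy | ⟨a, ha, b, hb, rfl⟩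
      · exact mem_addPairs.2 (.inl (ih _ hy hw))
      · rcases ZFSet.mem_pair.1 hw with rfl | rfl
        · exact mem_addPairs.2 (.inl ha)
        · exact mem_addPairs.2 (.inl hb)


/-! ## Renaming variables, enlarging vocabularies, isomorphisms -/

section Syntactic
variable {τ τ' : Voc.{u}}

/-- Extend a renaming of variables under a binder. -/
def Var.lift {S : Type u} {Γ Γ' : List S} (ρ : ∀ s, Var Γ s → Var Γ' s) (t : S) :
    ∀ s, Var (t :: Γ) s → Var (t :: Γ') s
  | _, .zero => .zero
  | _, .succ v => .succ (ρ _ v)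

mutual
/-- Renaming variables in a term. -/
def Term.rename {Γ Γ' : List τ.sorts} (ρ : ∀ s, Var Γ s → Var Γ' s) :
    {s : τ.sorts} → Term τ Γ s → Term τ Γ' s
  | _, .var v => .var (ρ _ v)
  | _, .app f ts => .app f (ts.rename ρ)
/-- Renaming variables in a list of terms. -/
def Terms.rename {Γ Γ' : List τ.sorts} (ρ : ∀ s, Var Γ s → Var Γ' s) :
    {Δ : List τ.sorts} → Terms τ Γ Δ → Terms τ Γ' Δ
  | _, .nil => .nil
  | _, .cons t ts => .cons (t.rename ρ) (ts.rename ρ)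
end

/-- Renaming variables in a formula. -/
def Formula.rename : {Γ Γ' : List τ.sorts} → (ρ : ∀ s, Var Γ s → Var Γ' s) →
    Formula τ Γ → Formula τ Γ'
  | _, _, _, .falsum => .falsum
  | _, _, ρ, .eq t₁ t₂ => .eq (t₁.rename ρ) (t₂.rename ρ)
  | _, _, ρ, .rel r ts => .rel r (ts.rename ρ)
  | _, _, ρ, .imp φ ψ => .imp (φ.rename ρ) (ψ.rename ρ)
  | _, _, ρ, .all s φ => .all s (φ.rename (Var.lift ρ s))
  | _, _, ρ, .hartig s t φ ψ => .hartig s t (φ.rename (Var.lift ρ s)) (ψ.rename (Var.lift ρ t))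

section
variable (M : Struct τ) {Γ Γ' : List τ.sorts} (ρ : ∀ s, Var Γ s → Var Γ' s)
  (a : Tup M.dom Γ) (a' : Tup M.dom Γ') (h : ∀ s v, (ρ s v).eval a' = v.eval a)
include h
set_option linter.unusedSectionVars false

mutual
theorem Term.eval_rename : ∀ {s : τ.sorts} (t : Term τ Γ s), (t.rename ρ).eval M a' = t.eval M a
  | _, .var v => by simpa only [Term.rename, Term.eval] using h _ v
  | _, .app f ts => by rw [Term.rename, Term.eval, Term.eval, Terms.eval_rename ts]
theorem Terms.eval_rename : ∀ {Δ : List τ.sorts} (ts : Terms τ Γ Δ),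
    (ts.rename ρ).eval M a' = ts.eval M a
  | _, .nil => rfl
  | _, .cons t ts => by
    rw [Terms.rename, Terms.eval, Terms.eval, Term.eval_rename t, Terms.eval_rename ts]
end
end

theorem Var.eval_lift {S : Type u} {D : S → Type u} {Γ Γ' : List S}
    (ρ : ∀ s, Var Γ s → Var Γ' s) (a : Tup D Γ) (a' : Tup D Γ')
    (h : ∀ s v, (ρ s v).eval a' = v.eval a) {t : S} (x : D t) :
    ∀ s (v : Var (t :: Γ) s), (Var.lift ρ t s v).eval ((x, a') : D t × Tup D Γ') =
      v.eval ((x, a) : D t × Tup D Γ)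
  | _, .zero => rfl
  | _, .succ v => h _ v

theorem Formula.realize_rename (M : Struct τ) {Γ : List τ.sorts} (φ : Formula τ Γ) :
    ∀ {Γ' : List τ.sorts} (ρ : ∀ s, Var Γ s → Var Γ' s) (a : Tup M.dom Γ) (a' : Tup M.dom Γ')
      (_ : ∀ s v, (ρ s v).eval a' = v.eval a), (φ.rename ρ).Realize M a' ↔ φ.Realize M a := by
  induction φ with
  | falsum => intros; rfl
  | eq t₁ t₂ =>
    intro Γ' ρ a a' h
    simp only [Formula.rename, Formula.Realize, Term.eval_rename M ρ a a' h]
  | rel r ts =>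
    intro Γ' ρ a a' h
    simp only [Formula.rename, Formula.Realize, Terms.eval_rename M ρ a a' h]
  | imp φ ψ ih1 ih2 =>
    intro Γ' ρ a a' h
    simp only [Formula.rename, Formula.Realize, ih1 ρ a a' h, ih2 ρ a a' h]
  | all s φ ih =>
    intro Γ' ρ a a' h
    simp only [Formula.rename, Formula.Realize]
    exact forall_congr' fun x => ih _ _ _ (Var.eval_lift ρ a a' h x)
  | hartig s t φ ψ ih1 ih2 =>
    intro Γ' ρ a a' h
    simp only [Formula.rename, Formula.Realize]
    rw [Cardinal.mk_congr (Equiv.subtypeEquivRight fun x => ih1 _ _ _ (Var.eval_lift ρ a a' h x)),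
      Cardinal.mk_congr (Equiv.subtypeEquivRight fun x => ih2 _ _ _ (Var.eval_lift ρ a a' h x))]

/-- A variable, after a change of sorts. -/
def Var.push {S S' : Type u} (i : S → S') : {Γ : List S} → {s : S} → Var Γ s → Var (Γ.map i) (i s)
  | _, _, .zero => .zero
  | _, _, .succ v => .succ (v.push i)

mutual
/-- A term, in a larger vocabulary. -/
def Term.lift (i : Voc.Incl τ τ') {Γ : List τ.sorts} :
    {s : τ.sorts} → Term τ Γ s → Term τ' (Γ.map i.sort) (i.sort s)
  | _, .var v => .var (v.push i.sort)
  | _, .app f ts => .app (i.fn f) (ts.lift i)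
/-- A list of terms, in a larger vocabulary. -/
def Terms.lift (i : Voc.Incl τ τ') {Γ : List τ.sorts} :
    {Δ : List τ.sorts} → Terms τ Γ Δ → Terms τ' (Γ.map i.sort) (Δ.map i.sort)
  | _, .nil => .nil
  | _, .cons t ts => .cons (t.lift i) (ts.lift i)
end

/-- A formula, in a larger vocabulary. -/
def Formula.lift (i : Voc.Incl τ τ') : {Γ : List τ.sorts} → Formula τ Γ →
    Formula τ' (Γ.map i.sort)
  | _, .falsum => .falsum
  | _, .eq t₁ t₂ => .eq (t₁.lift i) (t₂.lift i)
  | _, .rel r ts => .rel (i.rel r) (ts.lift i)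
  | _, .imp φ ψ => .imp (φ.lift i) (ψ.lift i)
  | _, .all s φ => .all (i.sort s) (φ.lift i)
  | _, .hartig s t φ ψ => .hartig (i.sort s) (i.sort t) (φ.lift i) (ψ.lift i)

theorem Var.eval_push {S S' : Type u} (i : S → S') (D : S' → Type u) :
    ∀ {Γ : List S} {s : S} (v : Var Γ s) (a : Tup (fun s => D (i s)) Γ),
      (v.push i).eval (Tup.push i D Γ a) = v.eval a
  | _, _, .zero, _ => rfl
  | _, _, .succ v, a => Var.eval_push i D v a.2

section
variable (i : Voc.Incl τ τ') (M : Struct τ') {Γ : List τ.sorts} (a : Tup (M.reduct i).dom Γ)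
mutual
theorem Term.eval_lift : ∀ {s : τ.sorts} (t : Term τ Γ s),
    (t.lift i).eval M (Tup.push i.sort M.dom Γ a) = t.eval (M.reduct i) a
  | _, .var v => by
    simp only [Term.lift, Term.eval]
    exact Var.eval_push i.sort M.dom v a
  | _, .app f ts => by rw [Term.lift, Term.eval, Term.eval, Terms.eval_lift ts]; rfl
theorem Terms.eval_lift : ∀ {Δ : List τ.sorts} (ts : Terms τ Γ Δ),
    (ts.lift i).eval M (Tup.push i.sort M.dom Γ a) =
      Tup.push i.sort M.dom Δ (ts.eval (M.reduct i) a)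
  | _, .nil => rfl
  | _, .cons t ts => by
    rw [Terms.lift, Terms.eval, Terms.eval, Term.eval_lift t, Terms.eval_lift ts]; rfl
end
end

theorem Formula.realize_lift (i : Voc.Incl τ τ') (M : Struct τ') {Γ : List τ.sorts}
    (φ : Formula τ Γ) : ∀ a : Tup (M.reduct i).dom Γ,
      (φ.lift i).Realize M (Tup.push i.sort M.dom Γ a) ↔ φ.Realize (M.reduct i) a := by
  induction φ with
  | falsum => intro a; rfl
  | eq t₁ t₂ => intro a; simp only [Formula.lift, Formula.Realize, Term.eval_lift]; rfl
  | rel r ts => intro a; simp only [Formula.lift, Formula.Realize, Terms.eval_lift]; rfl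
  | imp φ ψ ih1 ih2 => intro a; simp only [Formula.lift, Formula.Realize, ih1, ih2]
  | all s φ ih =>
    intro a
    simp only [Formula.lift, Formula.Realize]
    exact forall_congr' fun x => ih (x, a)
  | hartig s t φ ψ ih1 ih2 =>
    intro a
    simp only [Formula.lift, Formula.Realize]
    exact Eq.congr
      (Cardinal.mk_congr (Equiv.subtypeEquivRight fun x => ih1 (x, a)))
      (Cardinal.mk_congr (Equiv.subtypeEquivRight fun x => ih2 (x, a)))

theorem Struct.sat_lift (i : Voc.Incl τ τ') (M : Struct τ') (φ : Sentence τ) :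
    M.Sat (φ.lift i) ↔ (M.reduct i).Sat φ :=
  φ.realize_lift i M PUnit.unit

theorem Var.eval_map {S : Type u} {D D' : S → Type u} (g : ∀ s, D s → D' s) :
    ∀ {Γ : List S} {s : S} (v : Var Γ s) (a : Tup D Γ), v.eval (Tup.map g Γ a) = g s (v.eval a)
  | _, _, .zero, _ => rfl
  | _, _, .succ v, a => Var.eval_map g v a.2

section
variable {M N : Struct τ} (I : Struct.Iso M N) {Γ : List τ.sorts} (a : Tup M.dom Γ)
mutual
theorem Struct.Iso.eval_term : ∀ {s : τ.sorts} (t : Term τ Γ s),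
    t.eval N (Tup.map (fun s => I.equiv s) Γ a) = I.equiv s (t.eval M a)
  | _, .var v => by
    simpa only [Term.eval] using Var.eval_map (fun s => I.equiv s) v a
  | _, .app f ts => by rw [Term.eval, Term.eval, Struct.Iso.eval_terms ts, I.map_fn]
theorem Struct.Iso.eval_terms : ∀ {Δ : List τ.sorts} (ts : Terms τ Γ Δ),
    ts.eval N (Tup.map (fun s => I.equiv s) Γ a) = Tup.map (fun s => I.equiv s) Δ (ts.eval M a)
  | _, .nil => rfl
  | _, .cons t ts => by
    rw [Terms.eval, Terms.eval, Struct.Iso.eval_term t, Struct.Iso.eval_terms ts]; rfl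
end
end

theorem Struct.Iso.realize {M N : Struct τ} (I : Struct.Iso M N) {Γ : List τ.sorts}
    (φ : Formula τ Γ) : ∀ a : Tup M.dom Γ,
      φ.Realize N (Tup.map (fun s => I.equiv s) Γ a) ↔ φ.Realize M a := by
  induction φ with
  | falsum => intro a; rfl
  | eq t₁ t₂ => intro a; simp [Formula.Realize, Struct.Iso.eval_term]
  | rel r ts => intro a; simp [Formula.Realize, Struct.Iso.eval_terms, I.map_rel]
  | imp φ ψ ih1 ih2 => intro a; simp only [Formula.Realize, ih1, ih2]
  | all s φ ih =>
    intro a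
    simp only [Formula.Realize]
    exact ((I.equiv s).forall_congr fun x => (ih (x, a)).symm).symm
  | hartig s t φ ψ ih1 ih2 =>
    intro a
    simp only [Formula.Realize]
    exact Eq.congr
      (Cardinal.mk_congr ((I.equiv s).subtypeEquiv fun x => (ih1 (x, a)).symm)).symm
      (Cardinal.mk_congr ((I.equiv t).subtypeEquiv fun x => (ih2 (x, a)).symm)).symm

theorem Struct.Iso.sat {M N : Struct τ} (I : Struct.Iso M N) (φ : Sentence τ) :
    N.Sat φ ↔ M.Sat φ :=
  I.realize φ PUnit.unit

theorem Tup.map_map {S : Type u} {D D' D'' : S → Type u} (g : ∀ s, D s → D' s)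
    (h : ∀ s, D' s → D'' s) : ∀ (Δ : List S) (t : Tup D Δ),
      Tup.map h Δ (Tup.map g Δ t) = Tup.map (fun s x => h s (g s x)) Δ t
  | [], _ => rfl
  | _ :: Δ, t => Prod.ext rfl (Tup.map_map g h Δ t.2)

theorem Tup.map_eq_self {S : Type u} {D : S → Type u} {g : ∀ s, D s → D s}
    (hg : ∀ s x, g s x = x) : ∀ (Δ : List S) (t : Tup D Δ), Tup.map g Δ t = t
  | [], _ => rfl
  | _ :: Δ, t => Prod.ext (hg _ _) (Tup.map_eq_self hg Δ t.2)

/-- The copy of a structure on other domains. -/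
def Struct.transport (M : Struct τ) {D : τ.sorts → Type u} (g : ∀ s, M.dom s ≃ D s) :
    Struct τ where
  dom := D
  dom_nonempty := fun s => (M.dom_nonempty s).map (g s)
  rel := fun {Δ} r t => M.rel r (Tup.map (fun s => (g s).symm) Δ t)
  fn := fun {Δ s} f t => g s (M.fn f (Tup.map (fun s => (g s).symm) Δ t))

/-- A structure is isomorphic to its copies. -/
def Struct.transportIso (M : Struct τ) {D : τ.sorts → Type u} (g : ∀ s, M.dom s ≃ D s) :
    Struct.Iso M (M.transport g) where
  equiv := g
  map_rel := fun {Δ} r t => iff_of_eq (congrArg (M.rel r) ((Tup.map_map _ _ Δ t).trans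
    (Tup.map_eq_self (fun s x => (g s).symm_apply_apply x) Δ t)).symm)
  map_fn := fun {Δ s} f t => congrArg (fun t => g s (M.fn f t)) ((Tup.map_map _ _ Δ t).trans
    (Tup.map_eq_self (fun s x => (g s).symm_apply_apply x) Δ t)).symm

end Syntactic

/-! ## Definability in a class of structures -/

section Definability
variable {τ : Voc.{u}}

/-- The first entry of a tuple. -/
def Tup.hd {S : Type u} {D : S → Type u} {s : S} {Γ : List S} (a : Tup D (s :: Γ)) : D s := a.1

/-- The tuple without its first entry. -/
def Tup.tl {S : Type u} {D : S → Type u} {s : S} {Γ : List S} (a : Tup D (s :: Γ)) : Tup D Γ := a.2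

/-- A relation is definable, uniformly in all structures of the class `G`. -/
def Def (G : Struct τ → Prop) {Γ : List τ.sorts} (P : ∀ M : Struct τ, Tup M.dom Γ → Prop) : Prop :=
  ∃ φ : Formula τ Γ, ∀ M, G M → ∀ a, φ.Realize M a ↔ P M a

/-- A map of tuples which rearranges the entries. -/
def VDef {Γ Δ : List τ.sorts} (g : ∀ M : Struct τ, Tup M.dom Γ → Tup M.dom Δ) : Prop :=
  ∃ ρ : ∀ s, Var Δ s → Var Γ s, ∀ M a s v, (ρ s v).eval a = v.eval (g M a)

/-- A function is given by a term. -/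
def TDef {Γ : List τ.sorts} {s : τ.sorts} (f : ∀ M : Struct τ, Tup M.dom Γ → M.dom s) : Prop :=
  ∃ t : Term τ Γ s, ∀ M a, t.eval M a = f M a

/-- A tuple of functions is given by terms. -/
def TsDef {Γ Δ : List τ.sorts} (f : ∀ M : Struct τ, Tup M.dom Γ → Tup M.dom Δ) : Prop :=
  ∃ t : Terms τ Γ Δ, ∀ M a, t.eval M a = f M a

theorem VDef.id {Γ : List τ.sorts} : VDef (τ := τ) (Γ := Γ) fun _ a => a :=
  ⟨fun _ v => v, fun _ _ _ _ => rfl⟩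

theorem VDef.tl {Γ Δ : List τ.sorts} {s : τ.sorts}
    {g : ∀ M : Struct τ, Tup M.dom Γ → Tup M.dom (s :: Δ)} (hg : VDef g) :
    VDef fun M a => Tup.tl (g M a) := by
  obtain ⟨ρ, h⟩ := hg
  exact ⟨fun s v => ρ s (.succ v), fun M a s v => h M a s (.succ v)⟩

theorem TDef.hd {Γ Δ : List τ.sorts} {s : τ.sorts}
    {g : ∀ M : Struct τ, Tup M.dom Γ → Tup M.dom (s :: Δ)} (hg : VDef g) :
    TDef fun M a => Tup.hd (g M a) := by
  obtain ⟨ρ, h⟩ := hg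
  exact ⟨.var (ρ s .zero), fun M a => by rw [Term.eval]; exact h M a s .zero⟩

theorem TDef.fn {Γ Δ : List τ.sorts} {s : τ.sorts} (c : τ.funs Δ s)
    {f : ∀ M : Struct τ, Tup M.dom Γ → Tup M.dom Δ} (hf : TsDef f) :
    TDef fun M a => M.fn c (f M a) := by
  obtain ⟨t, h⟩ := hf
  exact ⟨.app c t, fun M a => by rw [Term.eval, h]⟩

theorem TsDef.nil {Γ : List τ.sorts} : TsDef (τ := τ) (Γ := Γ) (Δ := []) fun _ _ => PUnit.unit :=
  ⟨.nil, fun _ _ => rfl⟩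

theorem TsDef.cons {Γ Δ : List τ.sorts} {s : τ.sorts}
    {f : ∀ M : Struct τ, Tup M.dom Γ → M.dom s} {g : ∀ M : Struct τ, Tup M.dom Γ → Tup M.dom Δ}
    (hf : TDef f) (hg : TsDef g) : TsDef (Δ := s :: Δ) fun M a => (f M a, g M a) := by
  obtain ⟨t, h⟩ := hf
  obtain ⟨ts, hs⟩ := hg
  exact ⟨.cons t ts, fun M a => by rw [Terms.eval, h, hs]⟩

variable {G : Struct τ → Prop} {Γ : List τ.sorts}

theorem Def.congr {P Q : ∀ M : Struct τ, Tup M.dom Γ → Prop} (h : Def G P)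
    (hPQ : ∀ M, G M → ∀ a, Q M a ↔ P M a) : Def G Q := by
  obtain ⟨φ, hφ⟩ := h
  exact ⟨φ, fun M hM a => (hφ M hM a).trans (hPQ M hM a).symm⟩

theorem Def.subst {Δ : List τ.sorts} {P : ∀ M : Struct τ, Tup M.dom Δ → Prop} (h : Def G P)
    {g : ∀ M : Struct τ, Tup M.dom Γ → Tup M.dom Δ} (hg : VDef g) :
    Def G fun M a => P M (g M a) := by
  obtain ⟨φ, hφ⟩ := h
  obtain ⟨ρ, hρ⟩ := hg
  exact ⟨φ.rename ρ, fun M hM a =>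
    (φ.realize_rename M ρ (g M a) a (hρ M a)).trans (hφ M hM _)⟩

theorem Def.false : Def G (Γ := Γ) fun _ _ => False := ⟨.falsum, fun _ _ _ => Iff.rfl⟩

theorem Def.imp {P Q : ∀ M : Struct τ, Tup M.dom Γ → Prop} (hP : Def G P) (hQ : Def G Q) :
    Def G fun M a => P M a → Q M a := by
  obtain ⟨φ, hφ⟩ := hP
  obtain ⟨ψ, hψ⟩ := hQ
  exact ⟨.imp φ ψ, fun M hM a => by simp only [Formula.Realize, hφ M hM, hψ M hM]⟩

theorem Def.not {P : ∀ M : Struct τ, Tup M.dom Γ → Prop} (hP : Def G P) :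
    Def G fun M a => ¬ P M a :=
  hP.imp .false

theorem Def.true : Def G (Γ := Γ) fun _ _ => True :=
  Def.false.not.congr fun _ _ _ => by simp

theorem Def.and {P Q : ∀ M : Struct τ, Tup M.dom Γ → Prop} (hP : Def G P) (hQ : Def G Q) :
    Def G fun M a => P M a ∧ Q M a :=
  (hP.imp hQ.not).not.congr fun M _ a => by tauto

theorem Def.or {P Q : ∀ M : Struct τ, Tup M.dom Γ → Prop} (hP : Def G P) (hQ : Def G Q) :
    Def G fun M a => P M a ∨ Q M a :=
  (hP.not.imp hQ).congr fun M _ a => by tauto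

theorem Def.iff {P Q : ∀ M : Struct τ, Tup M.dom Γ → Prop} (hP : Def G P) (hQ : Def G Q) :
    Def G fun M a => P M a ↔ Q M a :=
  ((hP.imp hQ).and (hQ.imp hP)).congr fun M _ a => by tauto

theorem Def.all {s : τ.sorts} {P : ∀ M : Struct τ, Tup M.dom Γ → M.dom s → Prop}
    (h : Def G (Γ := s :: Γ) fun M b => P M (Tup.tl b) (Tup.hd b)) :
    Def G fun M a => ∀ z : M.dom s, P M a z := by
  obtain ⟨φ, hφ⟩ := h
  exact ⟨.all s φ, fun M hM a => forall_congr' fun z => hφ M hM (z, a)⟩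

theorem Def.ex {s : τ.sorts} {P : ∀ M : Struct τ, Tup M.dom Γ → M.dom s → Prop}
    (h : Def G (Γ := s :: Γ) fun M b => P M (Tup.tl b) (Tup.hd b)) :
    Def G fun M a => ∃ z : M.dom s, P M a z :=
  (Def.all (P := fun M a z => ¬ P M a z) h.not).not.congr fun M _ a => by simp

theorem Def.hartig {s t : τ.sorts} {P : ∀ M : Struct τ, Tup M.dom Γ → M.dom s → Prop}
    {Q : ∀ M : Struct τ, Tup M.dom Γ → M.dom t → Prop}
    (hP : Def G (Γ := s :: Γ) fun M b => P M (Tup.tl b) (Tup.hd b))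
    (hQ : Def G (Γ := t :: Γ) fun M b => Q M (Tup.tl b) (Tup.hd b)) :
    Def G fun M a => #{y : M.dom s // P M a y} = #{z : M.dom t // Q M a z} := by
  obtain ⟨φ, hφ⟩ := hP
  obtain ⟨ψ, hψ⟩ := hQ
  refine ⟨.hartig s t φ ψ, fun M hM a => Eq.congr ?_ ?_⟩
  · exact Cardinal.mk_congr (Equiv.subtypeEquivRight fun x => hφ M hM (x, a))
  · exact Cardinal.mk_congr (Equiv.subtypeEquivRight fun x => hψ M hM (x, a))

theorem Def.eq {s : τ.sorts} {f g : ∀ M : Struct τ, Tup M.dom Γ → M.dom s} (hf : TDef f)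
    (hg : TDef g) : Def G fun M a => f M a = g M a := by
  obtain ⟨t, ht⟩ := hf
  obtain ⟨t', ht'⟩ := hg
  exact ⟨.eq t t', fun M _ a => by rw [Formula.Realize, ht, ht']⟩

theorem Def.rel {Δ : List τ.sorts} (r : τ.rels Δ)
    {f : ∀ M : Struct τ, Tup M.dom Γ → Tup M.dom Δ} (hf : TsDef f) :
    Def G fun M a => M.rel r (f M a) := by
  obtain ⟨t, ht⟩ := hf
  exact ⟨.rel r t, fun M _ a => by rw [Formula.Realize, ht]⟩

/-- A finite conjunction. -/
theorem Def.forall_finite {ι : Type*} [Finite ι] {P : ι → ∀ M : Struct τ, Tup M.dom Γ → Prop}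
    (h : ∀ i, Def G (P i)) : Def G fun M a => ∀ i, P i M a := by
  have key : ∀ l : List ι, Def G fun M a => ∀ i ∈ l, P i M a := fun l => by
    induction l with
    | nil => exact Def.true.congr fun _ _ _ => by simp
    | cons i l ih => exact ((h i).and ih).congr fun _ _ _ => by simp
  obtain ⟨l, hl⟩ := Finite.exists_univ_list ι
  exact (key l).congr fun _ _ _ => by simp [hl.2]

/-- A finite disjunction. -/
theorem Def.exists_finite {ι : Type*} [Finite ι] {P : ι → ∀ M : Struct τ, Tup M.dom Γ → Prop}
    (h : ∀ i, Def G (P i)) : Def G fun M a => ∃ i, P i M a :=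
  (Def.forall_finite fun i => (h i).not).not.congr fun _ _ _ => by simp

end Definability

/-! ## Well-foundedness -/

theorem predCard_insert {B : Type u} {lt : B → B → Prop} (hirr : ∀ b, ¬ lt b b) (b : B) :
    #{x : B // lt x b ∨ x = b} = predCard lt b + 1 := by
  have h := mk_insert (s := {x | lt x b}) (a := b) (hirr b)
  exact (congrArg (fun s : Set B => #s) (Set.ext fun x => or_comm :
    {x | lt x b ∨ x = b} = insert b {x | lt x b})).trans h

theorem aleph0_le_iff_add_one {c : Cardinal.{u}} : ℵ₀ ≤ c ↔ c = c + 1 := by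
  refine ⟨fun h => (add_one_eq h).symm, fun h => ?_⟩
  by_contra h'
  obtain ⟨n, rfl⟩ := lt_aleph0.1 (not_le.1 h')
  norm_cast at h
  omega

theorem aleph0_le_predCard_iff {B : Type u} {lt : B → B → Prop} (hirr : ∀ b, ¬ lt b b) (b : B) :
    ℵ₀ ≤ predCard lt b ↔ #{x : B // lt x b} = #{x : B // lt x b ∨ x = b} := by
  rw [predCard_insert hirr, aleph0_le_iff_add_one]; rfl

/-- A set all of whose proper initial segments have cardinality less than `κ` has cardinality at
most `κ`. -/
theorem mk_le_of_segments_lt {B : Type u} {lt : B → B → Prop}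
    (htri : ∀ x y, lt x y ∨ x = y ∨ lt y x) {p : Set B} {κ : Cardinal.{u}} (hκ : ℵ₀ ≤ κ)
    (h : ∀ b ∈ p, predCard lt b < κ) : #p ≤ κ := by
  by_contra hlt
  obtain ⟨T, hTp, hT⟩ := le_mk_iff_exists_subset.1 (not_le.1 hlt).le
  have hcof : p ⊆ ⋃ t ∈ T, insert t {x | lt x t} := by
    intro x hx
    by_contra hx'
    have hsub : T ⊆ {y | lt y x} := by
      intro t ht
      rcases htri t x with h1 | rfl | h1
      · exact h1
      · exact absurd (Set.mem_biUnion ht (Set.mem_insert _ _)) hx'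
      · exact absurd (Set.mem_biUnion ht (Set.mem_insert_of_mem t (show x ∈ {y | lt y t} from h1))) hx'
    exact absurd ((hT ▸ mk_le_mk_of_subset hsub).trans_lt (h x hx)) (lt_irrefl _)
  refine hlt ((mk_le_mk_of_subset hcof).trans ((mk_biUnion_le _ _).trans ?_))
  rw [hT]
  refine mul_le_of_le hκ le_rfl (ciSup_le' fun t => ?_)
  exact mk_insert_le.trans (add_le_of_le hκ (h t (hTp t.2)).le (one_le_aleph0.trans hκ))

/-- The map `f` labels the elements of `A` by infinite cardinal-like elements of the linear order
`B`, increasingly and with no superfluous values. -/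
structure CardLabel {A B : Type u} (E : A → A → Prop) (lt : B → B → Prop) (f : A → B) : Prop where
  irrefl : ∀ b, ¬ lt b b
  trans : ∀ x y z, lt x y → lt y z → lt x z
  tri : ∀ x y, lt x y ∨ x = y ∨ lt y x
  order_ne : ∀ b, ¬ #{x : B // lt x b} = #{_x : B // True}
  mono : ∀ a a', E a a' → lt (f a) (f a')
  infinite : ∀ a, #{x : B // lt x (f a)} = #{x : B // lt x (f a) ∨ x = f a}
  elem_ne : ∀ a b, lt b (f a) → ¬ #{x : B // lt x b} = #{x : B // lt x (f a)}
  elem_le : ∀ a b, lt b (f a) → ¬ #{x : B // lt x b} = #{x : B // lt x b ∨ x = b} ∨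
    ∃ a', E a' a ∧ (lt b (f a') ∨ #{x : B // lt x b} = #{x : B // lt x (f a')})
  order_le : ∀ b, ¬ #{x : B // lt x b} = #{x : B // lt x b ∨ x = b} ∨
    ∃ a', lt b (f a') ∨ #{x : B // lt x b} = #{x : B // lt x (f a')}

namespace CardLabel
variable {A B : Type u} {E : A → A → Prop} {lt : B → B → Prop} {f : A → B}

theorem predCard_mono (h : CardLabel E lt f) {b b' : B} (hb : lt b b') :
    predCard lt b ≤ predCard lt b' :=
  mk_le_mk_of_subset (s := {x | lt x b}) (t := {x | lt x b'}) fun x hx => h.trans x b b' hx hb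

theorem elemCardinalLike (h : CardLabel E lt f) (a : A) : ElemCardinalLike lt (f a) :=
  fun b hb => lt_of_le_of_ne (h.predCard_mono hb) (h.elem_ne a b hb)

theorem cardinalLike (h : CardLabel E lt f) : CardinalLike lt := fun b =>
  lt_of_le_of_ne (mk_set_le {x | lt x b}) fun he => h.order_ne b (he.trans (mk_univ (α := B)).symm)

theorem aleph0_le (h : CardLabel E lt f) (a : A) : ℵ₀ ≤ predCard lt (f a) :=
  (aleph0_le_predCard_iff h.irrefl _).2 (h.infinite a)

theorem isStrictTotalOrder (h : CardLabel E lt f) : IsStrictTotalOrder B lt :=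
  { irrefl := h.irrefl
    trans := h.trans
    trichotomous := fun a b hab hba => by
      rcases h.tri a b with h1 | h1 | h1
      exacts [absurd h1 hab, h1, absurd h1 hba] }

theorem wellFounded (h : CardLabel E lt f) : WellFounded E :=
  Subrelation.wf (r := InvImage (· < ·) fun a => predCard lt (f a))
    (fun {_ a'} ha => h.elemCardinalLike a' _ (h.mono _ _ ha)) (InvImage.wf _ Cardinal.lt_wf)

theorem predCard_le (h : CardLabel E lt f) (hwf : WellFounded E) (a : A) :
    predCard lt (f a) ≤ ℵ_ (hwf.apply a).rank := by
  induction a using hwf.induction with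
  | _ a ih =>
    refine mk_le_of_segments_lt (p := {x | lt x (f a)}) h.tri (aleph0_le_aleph _) fun b hb => ?_
    rcases h.elem_le a b hb with h1 | ⟨a', ha', h1⟩
    · rw [← aleph0_le_predCard_iff h.irrefl, not_le] at h1
      exact h1.trans_le (aleph0_le_aleph _)
    · refine lt_of_le_of_lt ?_ (aleph_lt_aleph.2 (Acc.rank_lt_of_rel (hwf.apply a) ha'))
      exact (h1.elim (fun h2 => h.predCard_mono h2) fun h2 => h2.le).trans (ih a' ha')

theorem card_le (h : CardLabel E lt f) (hwf : WellFounded E) : #B ≤ ℵ_ (relRank hwf) := by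
  rw [← mk_univ]
  refine mk_le_of_segments_lt h.tri (aleph0_le_aleph _) fun b _ => ?_
  rcases h.order_le b with h1 | ⟨a, h1⟩
  · rw [← aleph0_le_predCard_iff h.irrefl, not_le] at h1
    exact h1.trans_le (aleph0_le_aleph _)
  · refine lt_of_le_of_lt ?_ (aleph_lt_aleph.2 ((Order.lt_succ _).trans_le
      (Ordinal.le_iSup (fun a => Order.succ (hwf.apply a).rank) a)))
    exact (h1.elim (fun h2 => h.predCard_mono h2) fun h2 => h2.le).trans (h.predCard_le hwf a)

end CardLabel

/-- Every well-founded relation on a nonempty set has a labelling. -/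
theorem exists_cardLabel {A : Type u} {E : A → A → Prop} (hwf : WellFounded E) :
    ∃ (B : Type u) (lt : B → B → Prop) (f : A → B), Nonempty B ∧ CardLabel E lt f := by
  let ρ := relRank hwf
  let rk : A → Ordinal.{u} := fun a => (hwf.apply a).rank
  have hρ : ∀ a, rk a < ρ := fun a => (Order.lt_succ _).trans_le
    (Ordinal.le_iSup (fun a => Order.succ (hwf.apply a).rank) a)
  let B := (Ordinal.omega ρ).ToType
  let val : B → Ordinal.{u} := fun b => (Ordinal.ToType.toOrd b : Ordinal.{u})
  have val_lt : ∀ b, val b < Ordinal.omega ρ := fun b => (Ordinal.ToType.toOrd b).2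
  have lt_iff : ∀ b b' : B, b < b' ↔ val b < val b' := fun b b' => by
    change _ ↔ (Ordinal.ToType.toOrd b) < Ordinal.ToType.toOrd b'
    exact (Ordinal.ToType.mk.symm.lt_iff_lt).symm
  have hcard : ∀ b : B, #{x : B // x < b} = (val b).card := fun b =>
    (Ordinal.card_typein (r := ((· < ·) : B → B → Prop)) b)
  let f : A → B := fun a => Ordinal.ToType.mk ⟨Ordinal.omega (rk a), Ordinal.omega_lt_omega.2 (hρ a)⟩
  have val_f : ∀ a, val (f a) = Ordinal.omega (rk a) := fun a => by
    simp [val, f, Ordinal.ToType.toOrd]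
  have irr : ∀ b : B, ¬ b < b := fun b => lt_irrefl b
  have hinf : ∀ b : B, ℵ₀ ≤ (val b).card ↔ #{x : B // x < b} = #{x : B // x < b ∨ x = b} :=
    fun b => by rw [← aleph0_le_predCard_iff irr, predCard, hcard]
  have main : ∀ (o : Ordinal.{u}) (b : B), val b < Ordinal.omega o →
      (∀ β < o, ∃ a', β ≤ rk a') → (∀ β < o, ∀ a', β ≤ rk a' → (val b).card = ℵ_ β → b < f a' ∨
        #{x : B // x < b} = #{x : B // x < f a'}) := by
    intro o b hb _ β hβ a' hle hc
    rcases hle.eq_or_lt with h1 | h1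
    · right; rw [hcard, hcard, hc, val_f, h1]; simp
    · left; rw [lt_iff, val_f, lt_omega_iff_card_lt, hc]; exact aleph_lt_aleph.2 h1
  refine ⟨B, (· < ·), f, ?_, irr, fun _ _ _ => lt_trans, fun x y => lt_trichotomy x y, ?_, ?_, ?_,
    ?_, ?_, ?_⟩
  · exact Ordinal.nonempty_toType_iff.2 (Ordinal.omega_pos _).ne'
  · intro b
    rw [hcard]
    have : #{_x : B // True} = ℵ_ ρ := mk_univ.trans (by simp [B])
    rw [this]
    exact (lt_omega_iff_card_lt.1 (val_lt b)).ne
  · intro a a' h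
    rw [lt_iff, val_f, val_f]
    exact Ordinal.omega_lt_omega.2 (Acc.rank_lt_of_rel (hwf.apply a') h)
  · intro a
    rw [← hinf, val_f]; simp
  · intro a b hb
    rw [hcard, hcard, val_f]
    rw [lt_iff, val_f, lt_omega_iff_card_lt] at hb
    simpa using hb.ne
  · intro a b hb
    rw [← hinf, or_iff_not_imp_left, not_not]
    intro hi
    rw [lt_iff, val_f] at hb
    obtain ⟨β, hβ⟩ := mem_range_aleph_iff.2 hi
    have h1 : β < rk a := by
      rw [lt_omega_iff_card_lt, ← hβ] at hb
      exact aleph_lt_aleph.1 hb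
    have h2 := h1
    simp only [rk] at h2
    rw [Acc.rank_eq, Ordinal.lt_iSup_iff] at h2
    obtain ⟨⟨a', ha'⟩, h2⟩ := h2
    have h3 : β ≤ rk a' := Order.lt_succ_iff.1 h2
    refine ⟨a', ha', main (rk a) b hb (fun γ hγ => ⟨a, hγ.le⟩) β h1 a' h3 hβ.symm⟩
  · intro b
    rw [← hinf, or_iff_not_imp_left, not_not]
    intro hi
    obtain ⟨β, hβ⟩ := mem_range_aleph_iff.2 hi
    have h1 : β < ρ := by
      have hb := val_lt b
      rw [lt_omega_iff_card_lt, ← hβ] at hb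
      exact aleph_lt_aleph.1 hb
    obtain ⟨a', h2⟩ := Ordinal.lt_iSup_iff.1 h1
    have h3 : β ≤ rk a' := Order.lt_succ_iff.1 h2
    rcases h3.eq_or_lt with h4 | h4
    · exact ⟨a', .inr (by rw [hcard, hcard, ← hβ, val_f, h4]; simp)⟩
    · exact ⟨a', .inl (by
        rw [lt_iff, val_f, lt_omega_iff_card_lt, ← hβ]; exact aleph_lt_aleph.2 h4)⟩

/-- There is a sentence which says that `(A, B, E, <, f)` is a labelling. -/
theorem def_cardLabel : Def (τ := orderVoc.{u}) (Γ := []) (fun _ => True)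
    fun M _ => CardLabel (orderE M) (orderLt M) (orderF M) := by
  have hE : ∀ {Γ : List orderVoc.{u}.sorts} {f g : ∀ M : Struct orderVoc.{u}, Tup M.dom Γ →
      M.dom WSort.A}, TDef f → TDef g → Def (fun _ => True) fun M a => orderE M (f M a) (g M a) :=
    fun hf hg => Def.rel (τ := orderVoc) WRel.E (TsDef.cons hf (TsDef.cons hg TsDef.nil))
  have hlt : ∀ {Γ : List orderVoc.{u}.sorts} {f g : ∀ M : Struct orderVoc.{u}, Tup M.dom Γ →
      M.dom WSort.B}, TDef f → TDef g → Def (fun _ => True) fun M a => orderLt M (f M a) (g M a) :=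
    fun hf hg => Def.rel (τ := orderVoc) WRel.lt (TsDef.cons hf (TsDef.cons hg TsDef.nil))
  have hf : ∀ {Γ : List orderVoc.{u}.sorts} {f : ∀ M : Struct orderVoc.{u}, Tup M.dom Γ →
      M.dom WSort.A}, TDef f → TDef fun M a => orderF M (f M a) :=
    fun hf => TDef.fn (τ := orderVoc) WFun.f (TsDef.cons hf TsDef.nil)
  have h1 : Def (τ := orderVoc.{u}) (Γ := []) (fun _ => True) fun M _ => ∀ b, ¬ orderLt M b b := by
    apply_rules (maxDepth := 200) [Def.not, Def.all, Def.false, hlt, TDef.hd, VDef.tl, VDef.id]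
  have h2 : Def (τ := orderVoc.{u}) (Γ := []) (fun _ => True) fun M _ =>
      ∀ x y z, orderLt M x y → orderLt M y z → orderLt M x z := by
    apply_rules (maxDepth := 200) [Def.all, Def.imp, hlt, TDef.hd, VDef.tl, VDef.id]
  have h3 : Def (τ := orderVoc.{u}) (Γ := []) (fun _ => True) fun M _ =>
      ∀ x y, orderLt M x y ∨ x = y ∨ orderLt M y x := by
    apply_rules (maxDepth := 200) [Def.all, Def.or, Def.eq, hlt, TDef.hd, VDef.tl, VDef.id]
  have h4 : Def (τ := orderVoc.{u}) (Γ := []) (fun _ => True) fun M _ =>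
      ∀ b, ¬ #{x // orderLt M x b} = #{_x : M.dom WSort.B // True} := by
    apply_rules (maxDepth := 200) [Def.not, Def.all, Def.false, Def.hartig, Def.true, hlt, TDef.hd, VDef.tl, VDef.id]
  have h5 : Def (τ := orderVoc.{u}) (Γ := []) (fun _ => True) fun M _ =>
      ∀ a a', orderE M a a' → orderLt M (orderF M a) (orderF M a') := by
    apply_rules (maxDepth := 200) [Def.all, Def.imp, hE, hlt, hf, TDef.hd, VDef.tl, VDef.id]
  have h6 : Def (τ := orderVoc.{u}) (Γ := []) (fun _ => True) fun M _ =>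
      ∀ a, #{x // orderLt M x (orderF M a)} =
        #{x // orderLt M x (orderF M a) ∨ x = orderF M a} := by
    apply_rules (maxDepth := 200) [Def.all, Def.hartig, Def.or, Def.eq, hlt, hf, TDef.hd, VDef.tl, VDef.id]
  have h7 : Def (τ := orderVoc.{u}) (Γ := []) (fun _ => True) fun M _ =>
      ∀ a b, orderLt M b (orderF M a) →
        ¬ #{x // orderLt M x b} = #{x // orderLt M x (orderF M a)} := by
    apply_rules (maxDepth := 200) [Def.not, Def.all, Def.imp, Def.false, Def.hartig, hlt, hf, TDef.hd, VDef.tl, VDef.id]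
  have h8 : Def (τ := orderVoc.{u}) (Γ := []) (fun _ => True) fun M _ =>
      ∀ a b, orderLt M b (orderF M a) →
        ¬ #{x // orderLt M x b} = #{x // orderLt M x b ∨ x = b} ∨
        ∃ a', orderE M a' a ∧ (orderLt M b (orderF M a') ∨
          #{x // orderLt M x b} = #{x // orderLt M x (orderF M a')}) := by
    apply_rules (maxDepth := 200) [Def.not, Def.all, Def.imp, Def.false, Def.ex, Def.and, Def.or, Def.hartig, Def.eq, hE, hlt,
      hf, TDef.hd, VDef.tl, VDef.id]
  have h9 : Def (τ := orderVoc.{u}) (Γ := []) (fun _ => True) fun M _ =>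
      ∀ b, ¬ #{x // orderLt M x b} = #{x // orderLt M x b ∨ x = b} ∨
        ∃ a', orderLt M b (orderF M a') ∨
          #{x // orderLt M x b} = #{x // orderLt M x (orderF M a')} := by
    apply_rules (maxDepth := 200) [Def.not, Def.all, Def.false, Def.ex, Def.or, Def.hartig, Def.eq, hlt, hf, TDef.hd, VDef.tl,
      VDef.id]
  exact (h1.and (h2.and (h3.and (h4.and (h5.and (h6.and (h7.and (h8.and h9)))))))).congr
    fun M _ _ => ⟨fun h => ⟨h.1, h.2, h.3, h.4, h.5, h.6, h.7, h.8, h.9⟩,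
      fun ⟨h1, h2, h3, h4, h5, h6, h7, h8, h9⟩ => ⟨h1, h2, h3, h4, h5, h6, h7, h8, h9⟩⟩

/-- The structure `(A, B, E, <, f)` with reduct `M = (A, E)`. -/
def labelStruct (M : Struct graphVoc.{u}) (B : Type u) (hB : Nonempty B) (lt : B → B → Prop)
    (f : M.dom GSort.A → B) : Struct orderVoc.{u} where
  dom := fun s => match s with
    | WSort.A => M.dom GSort.A
    | WSort.B => B
  dom_nonempty := fun s => match s with
    | WSort.A => M.dom_nonempty _
    | WSort.B => hB
  rel := fun r => match r with
    | WRel.E => fun t => M.rel GRel.E (t.1, t.2.1, PUnit.unit)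
    | WRel.lt => fun t => lt t.1 t.2.1
  fn := fun c => match c with
    | WFun.f => fun t => f t.1

theorem labelStruct_reduct (M : Struct graphVoc.{u}) (B : Type u) (hB : Nonempty B)
    (lt : B → B → Prop) (f : M.dom GSort.A → B) :
    (labelStruct M B hB lt f).reduct graphIncl = M := by
  obtain ⟨dom, hd, rel, fn⟩ := M
  unfold Struct.reduct labelStruct
  congr 1
  · funext Δ r t
    cases r
    rfl
  · funext Δ s c
    exact c.elim

/-- The sentence `Φ` for well-foundedness. -/
theorem exists_wellFounded_sentence : ∃ φ : Sentence orderVoc.{u},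
    (∀ M, M.Sat φ ↔ CardLabel (orderE M) (orderLt M) (orderF M)) ∧
    IsBoundedProjection graphIncl φ {M : Struct graphVoc.{u} | WellFounded (graphE M)} := by
  obtain ⟨φ, hφ⟩ := def_cardLabel.{u}
  have hφ : ∀ M, M.Sat φ ↔ CardLabel (orderE M) (orderLt M) (orderF M) :=
    fun M => hφ M trivial PUnit.unit
  refine ⟨φ, hφ, fun M => ⟨fun h => ?_, ?_⟩, fun M => ?_⟩
  · obtain ⟨B, lt, f, hB, hl⟩ := exists_cardLabel h
    exact ⟨labelStruct M B hB lt f, (hφ _).2 hl, labelStruct_reduct M B hB lt f⟩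
  · rintro ⟨N, hN, rfl⟩
    exact ((hφ N).1 hN).wellFounded
  · by_cases h : WellFounded (graphE M)
    · refine ⟨#(M.dom GSort.A) + ℵ_ (relRank h), ?_⟩
      rintro N hN rfl
      have hle := ((hφ N).1 hN).card_le h
      have : N.card ≤ #(N.dom WSort.A) + #(N.dom WSort.B) := by
        rw [Struct.card, add_def]
        refine mk_le_of_injective (f := fun x => match x with
          | ⟨WSort.A, a⟩ => Sum.inl a
          | ⟨WSort.B, b⟩ => Sum.inr b) ?_
        rintro ⟨_ | _, x⟩ ⟨_ | _, y⟩ hxy <;> simp_all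
      exact this.trans (add_le_add le_rfl hle)
    · refine ⟨0, ?_⟩
      rintro N hN rfl
      exact absurd ((hφ N).1 hN).wellFounded h

/-! ## The double power set is definably bounding -/

/-- The sorts `A`, `B` and a sort of subsets of `A`. -/
inductive PowSort : Type u
  | A
  | P
  | B

/-- Membership between `A` and subsets of `A`, and between subsets of `A` and sets of them. -/
inductive PowRel : List PowSort.{u} → Type u
  | mem : PowRel [PowSort.A, PowSort.P]
  | mem' : PowRel [PowSort.P, PowSort.B]

/-- The vocabulary for comparing `B` to the double power set of `A`. -/
def powVoc : Voc.{u} where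
  sorts := PowSort
  rels := PowRel
  funs := fun _ _ => PEmpty

/-- `powVoc` contains the two sorts `A`, `B`. -/
def powIncl : Voc.Incl twoVoc.{u} powVoc.{u} where
  sort := fun s => match s with
    | TwoSort.A => PowSort.A
    | TwoSort.B => PowSort.B
  rel := fun r => r.elim
  fn := fun f => f.elim
  sort_inj := fun a b h => by cases a <;> cases b <;> first | rfl | cases h
  rel_inj := fun _ r => r.elim
  fn_inj := fun _ _ f => f.elim

/-- Extensionality for a binary relation. -/
def extSentence {s t : powVoc.{u}.sorts} (r : powVoc.rels [s, t]) : Sentence powVoc.{u} :=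
  .all t (.all t (.imp
    (.all s (.imp (.rel r (.cons (.var .zero) (.cons (.var (.succ .zero)) .nil)))
      (.rel r (.cons (.var .zero) (.cons (.var (.succ (.succ .zero))) .nil)))))
    (.imp
      (.all s (.imp (.rel r (.cons (.var .zero) (.cons (.var (.succ (.succ .zero))) .nil)))
        (.rel r (.cons (.var .zero) (.cons (.var (.succ .zero)) .nil)))))
      (.eq (.var .zero) (.var (.succ .zero))))))

theorem sat_extSentence {s t : powVoc.{u}.sorts} (r : powVoc.rels [s, t])
    (M : Struct powVoc.{u}) : M.Sat (extSentence r) ↔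
      Function.Injective fun (y : M.dom t) (x : M.dom s) => M.rel r (x, y, PUnit.unit) := by
  simp only [Struct.Sat, extSentence, Formula.Realize, Terms.eval, Term.eval, Var.eval]
  constructor
  · intro h y z hyz
    refine h z y ?_ ?_ <;> intro x hx <;> have := congrFun hyz x <;> simp_all
  · intro h y z h1 h2
    exact h (funext fun x => propext ⟨h1 x, h2 x⟩)

/-- The structure with `A`, its power set, and `B` embedded into the double power set of `A`. -/
def powStruct (M : Struct twoVoc.{u}) (g : M.dom TwoSort.B → Set (Set (M.dom TwoSort.A))) :
    Struct powVoc.{u} where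
  dom := fun s => match s with
    | PowSort.A => M.dom TwoSort.A
    | PowSort.P => Set (M.dom TwoSort.A)
    | PowSort.B => M.dom TwoSort.B
  dom_nonempty := fun s => match s with
    | PowSort.A => M.dom_nonempty _
    | PowSort.P => ⟨∅⟩
    | PowSort.B => M.dom_nonempty _
  rel := fun r => match r with
    | PowRel.mem => fun t => t.1 ∈ t.2.1
    | PowRel.mem' => fun t => t.1 ∈ g t.2.1
  fn := fun c => c.elim

theorem twoVoc_ext {M N : Struct twoVoc.{u}} (h : M.dom = N.dom) : M = N := by
  obtain ⟨dom, hd, rel, fn⟩ := M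
  obtain ⟨dom', hd', rel', fn'⟩ := N
  obtain rfl : dom = dom' := h
  congr 1
  · funext Δ r
    exact r.elim
  · funext Δ s c
    exact c.elim

theorem definablyBounding_two_power :
    DefinablyBounding (fun κ : Cardinal.{u} => 2 ^ (2 : Cardinal.{u}) ^ κ) := by
  refine ⟨fun a b h => power_le_power_left two_ne_zero (power_le_power_left two_ne_zero h),
    powVoc, powIncl, .imp (.imp (extSentence (s := PowSort.A) (t := PowSort.P) PowRel.mem) (.imp
      (extSentence (s := PowSort.P) (t := PowSort.B) PowRel.mem') .falsum)) .falsum, ?_, ?_⟩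
  · simp [LFO, extSentence, Formula.IsFirstOrder]
  have key : ∀ M : Struct powVoc.{u}, M.Sat (.imp (.imp
      (extSentence (s := PowSort.A) (t := PowSort.P) PowRel.mem) (.imp
      (extSentence (s := PowSort.P) (t := PowSort.B) PowRel.mem') .falsum)) .falsum) ↔
      (Function.Injective fun (y : M.dom PowSort.P) (x : M.dom PowSort.A) =>
        M.rel PowRel.mem (x, y, PUnit.unit)) ∧
      (Function.Injective fun (y : M.dom PowSort.B) (x : M.dom PowSort.P) =>
        M.rel PowRel.mem' (x, y, PUnit.unit)) := fun M => by
    refine Iff.trans ?_ (and_congr (sat_extSentence (s := PowSort.A) (t := PowSort.P) PowRel.mem M)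
      (sat_extSentence (s := PowSort.P) (t := PowSort.B) PowRel.mem' M))
    simp only [Struct.Sat, Formula.Realize]
    tauto
  have bound : ∀ M : Struct powVoc.{u}, _ → #(M.dom PowSort.P) ≤ 2 ^ #(M.dom PowSort.A) ∧
      #(M.dom PowSort.B) ≤ 2 ^ (2 : Cardinal.{u}) ^ #(M.dom PowSort.A) := fun M h => by
    obtain ⟨h1, h2⟩ := (key M).1 h
    have h1' : #(M.dom PowSort.P) ≤ 2 ^ #(M.dom PowSort.A) := by
      rw [← mk_set]; exact mk_le_of_injective (β := Set (M.dom PowSort.A)) h1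
    have h2' : #(M.dom PowSort.B) ≤ 2 ^ #(M.dom PowSort.P) := by
      rw [← mk_set]; exact mk_le_of_injective (β := Set (M.dom PowSort.P)) h2
    exact ⟨h1', h2'.trans (power_le_power_left two_ne_zero h1')⟩
  refine ⟨fun M => ⟨fun h => ?_, ?_⟩, fun M => ?_⟩
  · have h : #(M.dom TwoSort.B) ≤ #(Set (Set (M.dom TwoSort.A))) := by simpa using h
    obtain ⟨g⟩ := h
    refine ⟨powStruct M g, (key _).2 ⟨fun y z h => ?_, fun y z h => g.injective ?_⟩, ?_⟩
    · exact Set.ext fun x => iff_of_eq (congrFun h x)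
    · exact Set.ext fun x => iff_of_eq (congrFun h x)
    · exact twoVoc_ext (funext fun s => by cases s <;> rfl)
  · rintro ⟨N, hN, rfl⟩
    exact (bound N hN).2
  · refine ⟨#(M.dom TwoSort.A) + (2 ^ #(M.dom TwoSort.A) + #(M.dom TwoSort.B)), ?_⟩
    rintro N hN rfl
    have : N.card ≤ #(N.dom PowSort.A) + (#(N.dom PowSort.P) + #(N.dom PowSort.B)) := by
      rw [Struct.card, add_def, add_def]
      refine mk_le_of_injective (f := fun x => match x with
        | ⟨PowSort.A, a⟩ => Sum.inl a
        | ⟨PowSort.P, b⟩ => Sum.inr (Sum.inl b)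
        | ⟨PowSort.B, b⟩ => Sum.inr (Sum.inr b)) ?_
      rintro ⟨_ | _ | _, x⟩ ⟨_ | _ | _, y⟩ hxy <;> simp_all
    exact this.trans (add_le_add le_rfl (add_le_add (bound N hN).1 le_rfl))


/-! ## `Δ₀` definability -/

/-- Renaming variables in a `Δ₀`-formula. -/
def Delta0.rename : {n m : ℕ} → (Fin n → Fin m) → Delta0 n → Delta0 m
  | _, _, _, .falsum => .falsum
  | _, _, ρ, .mem i j => .mem (ρ i) (ρ j)
  | _, _, ρ, .eq i j => .eq (ρ i) (ρ j)
  | _, _, ρ, .pred i => .pred (ρ i)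
  | _, _, ρ, .imp φ ψ => .imp (φ.rename ρ) (ψ.rename ρ)
  | _, _, ρ, .ball i φ => .ball (ρ i) (φ.rename (Fin.cases 0 fun j => (ρ j).succ))

theorem Delta0.realize_rename (R : ZFSet.{u} → Prop) {n : ℕ} (φ : Delta0 n) :
    ∀ {m : ℕ} (ρ : Fin n → Fin m) (v : Fin m → ZFSet.{u}),
      (φ.rename ρ).Realize R v ↔ φ.Realize R fun i => v (ρ i) := by
  induction φ with
  | falsum => intros; rfl
  | mem i j => intros; rfl
  | eq i j => intros; rfl
  | pred i => intros; rfl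
  | imp φ ψ ih1 ih2 => intro m ρ v; simp only [Delta0.rename, Delta0.Realize, ih1, ih2]
  | ball i φ ih =>
    intro m ρ v
    simp only [Delta0.rename, Delta0.Realize, ih]
    refine forall₂_congr fun z _ => iff_of_eq (congrArg _ (funext fun j => ?_))
    refine Fin.cases ?_ (fun j => ?_) j <;> simp

section
variable {n m k : ℕ}

/-- The most recent variable of an environment. -/
def envHead (v : Fin (n + 1) → ZFSet.{u}) : ZFSet.{u} := v 0

/-- The environment without its most recent variable. -/
def envTail (v : Fin (n + 1) → ZFSet.{u}) : Fin n → ZFSet.{u} := fun i => v i.succ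

@[simp] theorem envHead_cons (z : ZFSet.{u}) (v : Fin n → ZFSet.{u}) :
    envHead (Fin.cons z v : Fin (n + 1) → ZFSet.{u}) = z := rfl

@[simp] theorem envTail_cons (z : ZFSet.{u}) (v : Fin n → ZFSet.{u}) :
    envTail (Fin.cons z v : Fin (n + 1) → ZFSet.{u}) = v := rfl

/-- A relation is `Δ₀(R)`-definable. -/
def D0 (R : ZFSet.{u} → Prop) (P : (Fin n → ZFSet.{u}) → Prop) : Prop :=
  ∃ ψ : Delta0 n, ∀ v, ψ.Realize R v ↔ P v

/-- A map of environments which rearranges the variables. -/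
def SD (g : (Fin n → ZFSet.{u}) → Fin m → ZFSet.{u}) : Prop :=
  ∃ ρ : Fin m → Fin n, ∀ v i, g v i = v (ρ i)

/-- A function is the value of a variable. -/
def VD (f : (Fin n → ZFSet.{u}) → ZFSet.{u}) : Prop := ∃ i, ∀ v, f v = v i

/-- A function has a `Δ₀(R)`-definable graph. -/
def GD (R : ZFSet.{u} → Prop) (f : (Fin n → ZFSet.{u}) → ZFSet.{u}) : Prop :=
  D0 R fun w : Fin (n + 1) → ZFSet.{u} => envHead w = f (envTail w)

variable {R : ZFSet.{u} → Prop}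

theorem SD.id : SD fun v : Fin n → ZFSet.{u} => v := ⟨fun i => i, fun _ _ => rfl⟩

theorem SD.tail {g : (Fin n → ZFSet.{u}) → Fin (m + 1) → ZFSet.{u}} (hg : SD g) :
    SD fun v => envTail (g v) := by
  obtain ⟨ρ, h⟩ := hg
  exact ⟨fun i => ρ i.succ, fun v i => h v i.succ⟩

theorem SD.cons {f : (Fin n → ZFSet.{u}) → ZFSet.{u}} {g : (Fin n → ZFSet.{u}) → Fin m → ZFSet.{u}}
    (hf : VD f) (hg : SD g) :
    SD (m := m + 1) fun v => (Fin.cons (f v) (g v) : Fin (m + 1) → ZFSet.{u}) := by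
  obtain ⟨ρ, h⟩ := hg
  obtain ⟨i, hi⟩ := hf
  exact ⟨Fin.cases i ρ, fun v j => by refine Fin.cases ?_ (fun j => ?_) j <;> simp [hi, h]⟩

theorem VD.get {g : (Fin n → ZFSet.{u}) → Fin m → ZFSet.{u}} (hg : SD g) (i : Fin m) :
    VD fun v => g v i := by
  obtain ⟨ρ, h⟩ := hg
  exact ⟨ρ i, fun v => h v i⟩

theorem VD.head {g : (Fin n → ZFSet.{u}) → Fin (m + 1) → ZFSet.{u}} (hg : SD g) :
    VD fun v => envHead (g v) :=
  VD.get hg 0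

theorem D0.congr {P Q : (Fin n → ZFSet.{u}) → Prop} (h : D0 R P) (hPQ : ∀ v, Q v ↔ P v) :
    D0 R Q := by
  obtain ⟨ψ, hψ⟩ := h
  exact ⟨ψ, fun v => (hψ v).trans (hPQ v).symm⟩

theorem D0.subst {P : (Fin m → ZFSet.{u}) → Prop} (h : D0 R P)
    {g : (Fin n → ZFSet.{u}) → Fin m → ZFSet.{u}} (hg : SD g) : D0 R fun v => P (g v) := by
  obtain ⟨ψ, hψ⟩ := h
  obtain ⟨ρ, hρ⟩ := hg
  refine ⟨ψ.rename ρ, fun v => ?_⟩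
  rw [Delta0.realize_rename, hψ, ← funext (hρ v)]

theorem D0.false : D0 R fun _ : Fin n → ZFSet.{u} => False := ⟨.falsum, fun _ => Iff.rfl⟩

theorem D0.imp {P Q : (Fin n → ZFSet.{u}) → Prop} (hP : D0 R P) (hQ : D0 R Q) :
    D0 R fun v => P v → Q v := by
  obtain ⟨φ, hφ⟩ := hP
  obtain ⟨ψ, hψ⟩ := hQ
  exact ⟨.imp φ ψ, fun v => by simp only [Delta0.Realize, hφ, hψ]⟩

theorem D0.not {P : (Fin n → ZFSet.{u}) → Prop} (hP : D0 R P) : D0 R fun v => ¬ P v :=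
  hP.imp .false

theorem D0.and {P Q : (Fin n → ZFSet.{u}) → Prop} (hP : D0 R P) (hQ : D0 R Q) :
    D0 R fun v => P v ∧ Q v :=
  (hP.imp hQ.not).not.congr fun v => by tauto

theorem D0.or {P Q : (Fin n → ZFSet.{u}) → Prop} (hP : D0 R P) (hQ : D0 R Q) :
    D0 R fun v => P v ∨ Q v :=
  (hP.not.imp hQ).congr fun v => by tauto

theorem D0.iff {P Q : (Fin n → ZFSet.{u}) → Prop} (hP : D0 R P) (hQ : D0 R Q) :
    D0 R fun v => P v ↔ Q v :=
  ((hP.imp hQ).and (hQ.imp hP)).congr fun v => by tauto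

theorem D0.ball {f : (Fin n → ZFSet.{u}) → ZFSet.{u}} (hf : VD f)
    {P : (Fin n → ZFSet.{u}) → ZFSet.{u} → Prop}
    (h : D0 R fun w : Fin (n + 1) → ZFSet.{u} => P (envTail w) (envHead w)) :
    D0 R fun v => ∀ z ∈ f v, P v z := by
  obtain ⟨i, hi⟩ := hf
  obtain ⟨ψ, hψ⟩ := h
  refine ⟨.ball i ψ, fun v => ?_⟩
  simp only [Delta0.Realize, hi, hψ]
  exact Iff.rfl

theorem D0.bex {f : (Fin n → ZFSet.{u}) → ZFSet.{u}} (hf : VD f)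
    {P : (Fin n → ZFSet.{u}) → ZFSet.{u} → Prop}
    (h : D0 R fun w : Fin (n + 1) → ZFSet.{u} => P (envTail w) (envHead w)) :
    D0 R fun v => ∃ z ∈ f v, P v z :=
  (D0.ball hf (P := fun v z => ¬ P v z) h.not).not.congr fun v => by simp

theorem D0.pred {f : (Fin n → ZFSet.{u}) → ZFSet.{u}} (hf : VD f) : D0 R fun v => R (f v) := by
  obtain ⟨i, hi⟩ := hf
  exact ⟨.pred i, fun v => by simp only [Delta0.Realize, hi]⟩

theorem D0.mem_var {f g : (Fin n → ZFSet.{u}) → ZFSet.{u}} (hf : VD f) (hg : VD g) :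
    D0 R fun v => f v ∈ g v := by
  obtain ⟨i, hi⟩ := hf
  obtain ⟨j, hj⟩ := hg
  exact ⟨.mem i j, fun v => by simp only [Delta0.Realize, hi, hj]⟩

theorem D0.eq_var {f g : (Fin n → ZFSet.{u}) → ZFSet.{u}} (hf : VD f) (hg : VD g) :
    D0 R fun v => f v = g v := by
  obtain ⟨i, hi⟩ := hf
  obtain ⟨j, hj⟩ := hg
  exact ⟨.eq i j, fun v => by simp only [Delta0.Realize, hi, hj]⟩

theorem VD.comp {f : (Fin m → ZFSet.{u}) → ZFSet.{u}} (hf : VD f)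
    {g : (Fin n → ZFSet.{u}) → Fin m → ZFSet.{u}} (hg : SD g) : VD fun v => f (g v) := by
  obtain ⟨i, hi⟩ := hf
  obtain ⟨ρ, hρ⟩ := hg
  exact ⟨ρ i, fun v => by dsimp only; rw [hi, hρ]⟩

theorem GD.var {f : (Fin n → ZFSet.{u}) → ZFSet.{u}} (hf : VD f) : GD R f :=
  D0.eq_var (.head .id) (hf.comp (.tail .id))

theorem GD.comp {f : (Fin m → ZFSet.{u}) → ZFSet.{u}} (hf : GD R f)
    {g : (Fin n → ZFSet.{u}) → Fin m → ZFSet.{u}} (hg : SD g) : GD R fun v => f (g v) := by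
  have h : SD fun w : Fin (n + 1) → ZFSet.{u} =>
      (Fin.cons (envHead w) (g (envTail w)) : Fin (m + 1) → ZFSet.{u}) := by
    refine SD.cons (.head .id) ?_
    obtain ⟨ρ, hρ⟩ := hg
    exact ⟨fun i => (ρ i).succ, fun w i => hρ _ i⟩
  exact (D0.subst hf h).congr fun w => by simp

theorem D0.eq {f g : (Fin n → ZFSet.{u}) → ZFSet.{u}} (hf : VD f) (hg : GD R g) :
    D0 R fun v => f v = g v :=
  (D0.subst hg (SD.cons hf .id)).congr fun v => by simp

theorem D0.mem {f g : (Fin n → ZFSet.{u}) → ZFSet.{u}} (hf : GD R f) (hg : VD g) :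
    D0 R fun v => f v ∈ g v :=
  (D0.bex hg (P := fun v z => z = f v) hf).congr fun v => by simp

theorem D0.eq_pair_var {f g h : (Fin n → ZFSet.{u}) → ZFSet.{u}} (hf : VD f) (hg : VD g)
    (hh : VD h) : D0 R fun v => f v = ZFSet.pair (g v) (h v) := by
  have h1 : ∀ {k : ℕ} {p a b : (Fin k → ZFSet.{u}) → ZFSet.{u}}, VD p → VD a → VD b →
      D0 R fun v => a v ∈ p v ∧ b v ∈ p v ∧ ∀ y ∈ p v, y = a v ∨ y = b v := fun hp ha hb =>
    (D0.mem_var ha hp).and ((D0.mem_var hb hp).and (D0.ball hp ((D0.eq_var (.head .id)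
      (ha.comp (.tail .id))).or (D0.eq_var (.head .id) (hb.comp (.tail .id))))))
  have h2 : ∀ a b p : ZFSet.{u}, (a ∈ p ∧ b ∈ p ∧ ∀ y ∈ p, y = a ∨ y = b) ↔ p = {a, b} := by
    intro a b p
    constructor
    · rintro ⟨ha, hb, h⟩
      ext y
      rw [ZFSet.mem_pair]
      exact ⟨h y, by rintro (rfl | rfl) <;> assumption⟩
    · rintro rfl
      simp
  have h3 : ∀ {k : ℕ} {p a b : (Fin k → ZFSet.{u}) → ZFSet.{u}}, VD p → VD a → VD b →
      D0 R fun v => p v = {a v, b v} := fun hp ha hb =>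
    (h1 hp ha hb).congr fun v => (h2 _ _ _).symm
  have hg' := hg.comp (.tail (SD.id (n := n + 1)))
  have hh' := hh.comp (.tail (SD.id (n := n + 1)))
  refine ((D0.bex hf (P := fun v p => p = {g v, g v}) (h3 (.head .id) hg' hg')).and
    ((D0.bex hf (P := fun v p => p = {g v, h v}) (h3 (.head .id) hg' hh')).and
    (D0.ball hf (P := fun v p => p = {g v, g v} ∨ p = {g v, h v}) ((h3 (.head .id) hg' hg').or (h3 (.head .id) hg' hh'))))).congr fun v => ?_
  have hp : ZFSet.pair (g v) (h v) = {{g v, g v}, {g v, h v}} := by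
    rw [ZFSet.pair, ZFSet.pair_eq_singleton (g v)]
  rw [hp]
  simp only [exists_eq_right]
  exact (h2 _ _ _).symm

/-- Quantification over the components of an ordered pair is bounded. -/
theorem D0.exPair {f : (Fin n → ZFSet.{u}) → ZFSet.{u}} (hf : VD f)
    {P : (Fin n → ZFSet.{u}) → ZFSet.{u} → ZFSet.{u} → Prop}
    (h : D0 R fun w : Fin (n + 2) → ZFSet.{u} =>
      P (envTail (envTail w)) (envHead (envTail w)) (envHead w)) :
    D0 R fun v => ∃ a b, f v = ZFSet.pair a b ∧ P v a b := by
  have h1 : D0 R fun v => ∃ p ∈ f v, ∃ a ∈ p, ∃ q ∈ f v, ∃ b ∈ q,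
      f v = ZFSet.pair a b ∧ P v a b := by
    refine D0.bex hf (D0.bex (.head .id) (D0.bex (hf.comp (.tail (.tail .id)))
      (D0.bex (.head .id) (D0.and (D0.eq_pair_var (hf.comp (.tail (.tail (.tail (.tail .id)))))
        (.head (.tail (.tail .id))) (.head .id)) ?_))))
    refine (D0.subst h (g := fun w => Fin.cons (envHead w) (Fin.cons (envHead (envTail (envTail w)))
      (envTail (envTail (envTail (envTail w)))))) (SD.cons (.head .id) (SD.cons
      (.head (.tail (.tail .id))) (.tail (.tail (.tail (.tail .id))))))).congr fun v => ?_
    simp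
  refine h1.congr fun v => ⟨?_, ?_⟩
  · rintro ⟨a, b, hab, hP⟩
    exact ⟨{a}, hab ▸ mem_pair_left a b, a, by simp, {a, b}, hab ▸ mem_pair_right a b, b, by simp,
      hab, hP⟩
  · rintro ⟨p, _, a, _, q, _, b, _, hab, hP⟩
    exact ⟨a, b, hab, hP⟩

theorem GD.pair {f g : (Fin n → ZFSet.{u}) → ZFSet.{u}} (hf : GD R f) (hg : GD R g) :
    GD R fun v => ZFSet.pair (f v) (g v) := by
  have h : D0 R fun w : Fin (n + 1) → ZFSet.{u} => ∃ a b, envHead w = ZFSet.pair a b ∧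
      (a = f (envTail w) ∧ b = g (envTail w)) :=
    D0.exPair (.head .id) ((D0.eq (.head (.tail .id)) (hf.comp (.tail (.tail (.tail .id))))).and
      (D0.eq (.head .id) (hg.comp (.tail (.tail (.tail .id))))))
  refine h.congr fun w => ⟨fun h => ⟨_, _, h, rfl, rfl⟩, ?_⟩
  rintro ⟨_, _, h, rfl, rfl⟩
  exact h

theorem GD.num (k : ℕ) : GD R fun _ : Fin n → ZFSet.{u} => num k := by
  induction k generalizing n with
  | zero =>
    refine (D0.ball (.head .id) (P := fun _ _ => False) D0.false).congr fun w => ?_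
    rw [num_zero, ZFSet.eq_empty]
  | succ k ih =>
    have h : D0 R fun w : Fin (n + 1) → ZFSet.{u} => ∃ m ∈ envHead w, m = BSymb.num k ∧
        ((∀ z ∈ envHead w, z = m ∨ z ∈ m) ∧ ∀ z ∈ m, z ∈ envHead w) :=
      D0.bex (.head .id) ((D0.eq (.head .id) (ih (n := n + 2))).and
        ((D0.ball (.head (.tail .id)) ((D0.eq_var (.head .id) (.head (.tail .id))).or
          (D0.mem_var (.head .id) (.head (.tail .id))))).and
          (D0.ball (.head .id) (D0.mem_var (.head .id) (.head (.tail (.tail .id)))))))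
    refine h.congr fun w => ?_
    rw [BSymb.num]
    constructor
    · intro h
      rw [h]
      exact ⟨_, by simp, rfl, by simp, fun z hz => by simp [hz]⟩
    · rintro ⟨_, h1, rfl, h2, h3⟩
      ext z
      rw [ZFSet.mem_insert_iff]
      refine ⟨h2 z, ?_⟩
      rintro (rfl | hz)
      exacts [h1, h3 z hz]

theorem GD.empty : GD R fun _ : Fin n → ZFSet.{u} => ∅ := GD.num 0

/-- Quantification over the values of a set of ordered pairs is bounded. -/
theorem D0.exValue {f g : (Fin n → ZFSet.{u}) → ZFSet.{u}} (hf : VD f) (hg : VD g)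
    {P : (Fin n → ZFSet.{u}) → ZFSet.{u} → Prop}
    (h : D0 R fun w : Fin (n + 1) → ZFSet.{u} => P (envTail w) (envHead w)) :
    D0 R fun v => ∃ b, ZFSet.pair (f v) b ∈ g v ∧ P v b := by
  have h1 : D0 R fun v => ∃ m ∈ g v, ∃ a b, m = ZFSet.pair a b ∧ (a = f v ∧ P v b) := by
    refine D0.bex hg (D0.exPair (.head .id) (D0.and (D0.eq_var (.head (.tail .id))
      (hf.comp (.tail (.tail (.tail .id))))) ?_))
    refine (D0.subst h (g := fun w => Fin.cons (envHead w) (envTail (envTail (envTail w))))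
      (SD.cons (.head .id) (.tail (.tail (.tail .id))))).congr fun v => ?_
    simp
  refine h1.congr fun v => ⟨?_, ?_⟩
  · rintro ⟨b, hb, hP⟩
    exact ⟨_, hb, _, b, rfl, rfl, hP⟩
  · rintro ⟨_, hm, _, b, rfl, rfl, hP⟩
    exact ⟨b, hm, hP⟩

theorem D0.subset {f g : (Fin n → ZFSet.{u}) → ZFSet.{u}} (hf : VD f) (hg : VD g) :
    D0 R fun v => f v ⊆ g v :=
  (D0.ball hf (D0.mem_var (.head .id) (hg.comp (.tail .id)))).congr fun _ => Iff.rfl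

end

/-! ## Recursive clauses for tuples, terms and formulas -/

/-- The code of `(a₁, …, a₄)`. -/
noncomputable abbrev quad (p Γ a b : ZFSet.{u}) : ZFSet.{u} :=
  ZFSet.pair p (ZFSet.pair Γ (ZFSet.pair a b))

/-- The code of `(a₁, …, a₆)`. -/
noncomputable abbrev sext (t k Γ a s d : ZFSet.{u}) : ZFSet.{u} :=
  ZFSet.pair t (ZFSet.pair k (quad Γ a s d))

/-- `b` is the truth value of `P`. -/
def IsTruth (b : ZFSet.{u}) (P : Prop) : Prop := (b = num 1 ∧ P) ∨ (b = num 0 ∧ ¬ P)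

/-- `h` contains a bijection between `X` and `Y`. -/
def SetBij (h X Y : ZFSet.{u}) : Prop :=
  (∀ a ∈ X, ∃ b ∈ Y, ZFSet.pair a b ∈ h) ∧ (∀ b ∈ Y, ∃ a ∈ X, ZFSet.pair a b ∈ h) ∧
  ∀ a ∈ X, ∀ b ∈ Y, ZFSet.pair a b ∈ h → ∀ a' ∈ X, ∀ b' ∈ Y, ZFSet.pair a' b' ∈ h →
    (a = a' ↔ b = b')

/-- The elements of `z` are ordered pairs, and `z` is single-valued. -/
def SetFunctional (z : ZFSet.{u}) : Prop :=
  ∀ m ∈ z, ∃ a b, m = ZFSet.pair a b ∧ ∀ m' ∈ z, ∃ a' b', m' = ZFSet.pair a' b' ∧ (a = a' → b = b')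

/-- The clause for pairs `(l, t)` such that `t` is a tuple of the type `l`. -/
def TupClause (S : ZFSet.{u}) (T : ZFSet.{u} → Prop) (u : ZFSet.{u}) : Prop :=
  ∃ l t, u = ZFSet.pair l t ∧ ((l = ∅ ∧ t = ∅) ∨
    ∃ s l', l = ZFSet.pair s l' ∧ ∃ d t', t = ZFSet.pair d t' ∧
      ((∃ D, ZFSet.pair s D ∈ S ∧ d ∈ D) ∧ T (ZFSet.pair l' t')))

/-- The clause for variables. -/
def VarClause (T : ZFSet.{u} → Prop) (r Γ a s d : ZFSet.{u}) : Prop :=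
  ∃ s' Γ', Γ = ZFSet.pair s' Γ' ∧ ∃ d' a', a = ZFSet.pair d' a' ∧
    ((r = ∅ ∧ s = s' ∧ d = d') ∨
      ∃ m ∈ r, r = insert m m ∧ T (sext (num 0) (ZFSet.pair (num 0) m) Γ' a' s d))

/-- The clause for function symbols. -/
def AppClause (G : ZFSet.{u}) (T : ZFSet.{u} → Prop) (r Γ a s d : ZFSet.{u}) : Prop :=
  ∃ f ts, r = ZFSet.pair f ts ∧ ∃ n q, f = ZFSet.pair n q ∧ ∃ Δ s', q = ZFSet.pair Δ s' ∧
    (s = s' ∧ ∃ g, ZFSet.pair f g ∈ G ∧ ∃ m ∈ g, ∃ t d', m = ZFSet.pair t d' ∧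
      (d' = d ∧ T (sext (num 1) ts Γ a Δ t)))

/-- The clause for lists of terms. -/
def TermsClause (T : ZFSet.{u} → Prop) (k Γ a s d : ZFSet.{u}) : Prop :=
  (k = ∅ ∧ s = ∅ ∧ d = ∅) ∨ ∃ t ts, k = ZFSet.pair t ts ∧ ∃ s₁ Δ, s = ZFSet.pair s₁ Δ ∧
    ∃ d₁ d₂, d = ZFSet.pair d₁ d₂ ∧
      (T (sext (num 0) t Γ a s₁ d₁) ∧ T (sext (num 1) ts Γ a Δ d₂))

/-- The clause for `(i, k, Γ, a, s, d)` such that `k` is a term (for `i = 0`) or a list of terms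
(for `i = 1`) of type `s` in the context `Γ`, with value `d` under the assignment `a`. -/
def TermClause (G : ZFSet.{u}) (T : ZFSet.{u} → Prop) (u : ZFSet.{u}) : Prop :=
  ∃ i u₁, u = ZFSet.pair i u₁ ∧ ∃ k u₂, u₁ = ZFSet.pair k u₂ ∧ ∃ Γ u₃, u₂ = ZFSet.pair Γ u₃ ∧
    ∃ a u₄, u₃ = ZFSet.pair a u₄ ∧ ∃ s d, u₄ = ZFSet.pair s d ∧
      ((i = num 0 ∧ ∃ c r, k = ZFSet.pair c r ∧
          ((c = num 0 ∧ VarClause T r Γ a s d) ∨ (c = num 1 ∧ AppClause G T r Γ a s d))) ∨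
        (i = num 1 ∧ TermsClause T k Γ a s d))

/-- `X` is the set of the elements `d` of `D` such that `p` holds of `(d, a)`. -/
def IsExtension (T : ZFSet.{u} → Prop) (X D s p Γ a : ZFSet.{u}) : Prop :=
  X ⊆ D ∧ ∀ d ∈ D, (d ∈ X ∧ T (quad p (ZFSet.pair s Γ) (ZFSet.pair d a) (num 1))) ∨
    (d ∉ X ∧ T (quad p (ZFSet.pair s Γ) (ZFSet.pair d a) (num 0)))

/-- The clause for equations. -/
def EqClause (U₀ E q Γ a b : ZFSet.{u}) : Prop :=
  ∃ t₁ t₂, q = ZFSet.pair t₁ t₂ ∧ ∃ s ∈ U₀, ∃ d₁ ∈ U₀, ∃ d₂ ∈ U₀,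
    sext (num 0) t₁ Γ a s d₁ ∈ E ∧ sext (num 0) t₂ Γ a s d₂ ∈ E ∧ IsTruth b (d₁ = d₂)

/-- The clause for relation symbols. -/
def RelClause (U₀ E R q Γ a b : ZFSet.{u}) : Prop :=
  ∃ r ts, q = ZFSet.pair r ts ∧ ∃ n Δ, r = ZFSet.pair n Δ ∧ ∃ I, ZFSet.pair r I ∈ R ∧
    ∃ t ∈ U₀, sext (num 1) ts Γ a Δ t ∈ E ∧ IsTruth b (t ∈ I)

/-- The clause for implications. -/
def ImpClause (U₀ : ZFSet.{u}) (T : ZFSet.{u} → Prop) (q Γ a b : ZFSet.{u}) : Prop :=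
  ∃ p₁ p₂, q = ZFSet.pair p₁ p₂ ∧ ∃ b₁ ∈ U₀, ∃ b₂ ∈ U₀,
    T (quad p₁ Γ a b₁) ∧ T (quad p₂ Γ a b₂) ∧ IsTruth b (b₁ = num 1 → b₂ = num 1)

/-- The clause for universal quantifiers. -/
def AllClause (U S : ZFSet.{u}) (T : ZFSet.{u} → Prop) (q Γ a b : ZFSet.{u}) : Prop :=
  ∃ s p, q = ZFSet.pair s p ∧ ∃ D, ZFSet.pair s D ∈ S ∧ ∃ X ∈ U,
    IsExtension T X D s p Γ a ∧ IsTruth b (D ⊆ X)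

/-- The clause for Härtig quantifiers. -/
def HartigClause (U S : ZFSet.{u}) (T : ZFSet.{u} → Prop) (q Γ a b : ZFSet.{u}) : Prop :=
  ∃ q₁ q₂, q = ZFSet.pair q₁ q₂ ∧ ∃ s p, q₁ = ZFSet.pair s p ∧ ∃ s' p', q₂ = ZFSet.pair s' p' ∧
    ∃ D, ZFSet.pair s D ∈ S ∧ ∃ D', ZFSet.pair s' D' ∈ S ∧ ∃ X ∈ U, ∃ Y ∈ U,
      IsExtension T X D s p Γ a ∧ IsExtension T Y D' s' p' Γ a ∧
      ∃ κ ∈ U, ∃ μ ∈ U, ∃ h ∈ U, ∃ k ∈ U,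
        Cd κ ∧ Cd μ ∧ SetBij h X κ ∧ SetBij k Y μ ∧ IsTruth b (κ = μ)

/-- The clause for `(p, Γ, a, b)` such that `p` is a formula in the context `Γ` with truth value `b`
under the assignment `a`. -/
def ValClause (U₀ U S R E : ZFSet.{u}) (T : ZFSet.{u} → Prop) (u : ZFSet.{u}) : Prop :=
  ∃ p u₁, u = ZFSet.pair p u₁ ∧ ∃ Γ u₂, u₁ = ZFSet.pair Γ u₂ ∧ ∃ a b, u₂ = ZFSet.pair a b ∧
    ∃ c q, p = ZFSet.pair c q ∧
      ((c = num 0 ∧ q = ∅ ∧ b = num 0) ∨ (c = num 1 ∧ EqClause U₀ E q Γ a b) ∨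
        (c = num 2 ∧ RelClause U₀ E R q Γ a b) ∨ (c = num 3 ∧ ImpClause U₀ T q Γ a b) ∨
        (c = num 4 ∧ AllClause U S T q Γ a b) ∨ (c = num 5 ∧ HartigClause U S T q Γ a b))

/-- The triple `(S, R, G)` is a structure, where `T` tells the types of tuples. -/
def IsStruct (U₀ S R G T : ZFSet.{u}) : Prop :=
  (SetFunctional S ∧ ∀ m ∈ S, ∃ s D, m = ZFSet.pair s D ∧ D ≠ ∅) ∧
  (SetFunctional R ∧ ∀ m ∈ R, ∃ r I, m = ZFSet.pair r I ∧ ∃ n Δ, r = ZFSet.pair n Δ ∧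
    ((∃ t ∈ U₀, ZFSet.pair Δ t ∈ T) ∧ ∀ t ∈ I, ZFSet.pair Δ t ∈ T)) ∧
  (SetFunctional G ∧ ∀ m ∈ G, ∃ f g, m = ZFSet.pair f g ∧ ∃ n q, f = ZFSet.pair n q ∧
    ∃ Δ s, q = ZFSet.pair Δ s ∧ ((∃ t ∈ U₀, ZFSet.pair Δ t ∈ T) ∧ ∃ D, ZFSet.pair s D ∈ S ∧
      (SetFunctional g ∧
        (∀ w ∈ g, ∃ t d, w = ZFSet.pair t d ∧ (ZFSet.pair Δ t ∈ T ∧ d ∈ D)) ∧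
        ∀ t ∈ U₀, ZFSet.pair Δ t ∈ T → ∃ d, ZFSet.pair t d ∈ g ∧ d ∈ D)))

/-- `U₀` is a transitive set closed under pairs which contains `x`. -/
def IsUniverse (U₀ x : ZFSet.{u}) : Prop :=
  (∀ a ∈ U₀, a ⊆ U₀) ∧ (∀ a ∈ U₀, ∀ b ∈ U₀, ZFSet.pair a b ∈ U₀) ∧ x ∈ U₀ ∧ num 0 ∈ U₀ ∧ num 1 ∈ U₀

/-- `U` contains the extensions of all formulas and the cardinals of its elements. -/
def IsRich (U₀ U T : ZFSet.{u}) : Prop :=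
  (∀ p ∈ U₀, ∀ Γ ∈ U₀, ∀ a ∈ U₀, ∀ s ∈ U₀, ∀ D ∈ U₀, ∃ X ∈ U, X ⊆ D ∧
    ∀ d ∈ D, (d ∈ X ↔ quad p (ZFSet.pair s Γ) (ZFSet.pair d a) (num 1) ∈ T)) ∧
  ∀ X ∈ U, ∀ D ∈ U₀, X ⊆ D → ∃ κ ∈ U, Cd κ ∧ ∃ h ∈ U, SetBij h X κ

/-- The sets `T₁`, `T₂`, `T₃` are the fixed points of the clauses for tuples, terms, formulas. -/
def IsFixed (U₀ U S R G T₁ T₂ T₃ : ZFSet.{u}) : Prop :=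
  (T₁ ⊆ U₀ ∧ ∀ u ∈ U₀, u ∈ T₁ ↔ TupClause S (· ∈ T₁) u) ∧
  (T₂ ⊆ U₀ ∧ ∀ u ∈ U₀, u ∈ T₂ ↔ TermClause G (· ∈ T₂) u) ∧
  (T₃ ⊆ U₀ ∧ ∀ u ∈ U₀, u ∈ T₃ ↔ ValClause U₀ U S R T₂ (· ∈ T₃) u)

section
variable {n : ℕ} {u v w x y z b p q r s t d a Γ U₀ U S R G E T T₁ T₂ T₃ m D X h κ g k :
  (Fin n → ZFSet.{u}) → ZFSet.{u}}

theorem VD.eq_get {f : (Fin n → ZFSet.{u}) → ZFSet.{u}} (hf : VD f) : ∃ i, f = fun v => v i :=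
  hf.imp fun _ hi => funext hi

theorem D0.succ (hr : VD r) (hm : VD m) : D0 Cd fun v => r v = insert (m v) (m v) := by
  obtain ⟨r, rfl⟩ := hr.eq_get
  obtain ⟨m, rfl⟩ := hm.eq_get
  have : D0 Cd fun v : Fin n → ZFSet.{u} =>
      (∀ z ∈ v r, z = v m ∨ z ∈ v m) ∧ v m ∈ v r ∧ ∀ z ∈ v m, z ∈ v r := by
    apply_rules (maxDepth := 1000) (transparency := .reducible) [D0.and, D0.ball, D0.or, D0.eq_var,
      D0.mem_var, VD.head, VD.get, SD.tail, SD.id]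
  refine this.congr fun v => ⟨fun h => by simp +contextual [h], fun ⟨h1, h2, h3⟩ => ?_⟩
  ext z
  rw [ZFSet.mem_insert_iff]
  exact ⟨h1 z, by rintro (rfl | h); exacts [h2, h3 z h]⟩

theorem D0.quad_mem (hp : GD Cd p) (hΓ : GD Cd Γ) (ha : GD Cd a) (hb : GD Cd b) (hT : VD T) :
    D0 Cd fun v => quad (p v) (Γ v) (a v) (b v) ∈ T v :=
  .mem (.pair hp (.pair hΓ (.pair ha hb))) hT

theorem D0.isTruth (hb : VD b) {P : (Fin n → ZFSet.{u}) → Prop} (hP : D0 Cd P) :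
    D0 Cd fun v => IsTruth (b v) (P v) :=
  .or (.and (.eq hb (.num 1)) hP) (.and (.eq hb (.num 0)) hP.not)

theorem D0.setBij (hh : VD h) (hX : VD X) (hy : VD y) :
    D0 Cd fun v => SetBij (h v) (X v) (y v) := by
  obtain ⟨h, rfl⟩ := hh.eq_get
  obtain ⟨X, rfl⟩ := hX.eq_get
  obtain ⟨y, rfl⟩ := hy.eq_get
  unfold SetBij
  apply_rules (maxDepth := 1000) (transparency := .reducible)
    [D0.and, D0.or, D0.not, D0.ball, D0.bex, D0.exPair, D0.exValue, D0.iff, D0.isTruth, D0.subset,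
    D0.pred, D0.quad_mem, D0.mem, D0.eq, D0.imp, D0.succ, GD.num, GD.empty, GD.pair,
    GD.var, VD.head, VD.get, SD.tail, SD.id]

theorem D0.setFunctional (hz : VD z) :
    D0 Cd fun v => SetFunctional (z v) := by
  obtain ⟨z, rfl⟩ := hz.eq_get
  unfold SetFunctional
  apply_rules (maxDepth := 1000) (transparency := .reducible)
    [D0.and, D0.or, D0.not, D0.ball, D0.bex, D0.exPair, D0.exValue, D0.iff, D0.isTruth, D0.subset,
    D0.pred, D0.quad_mem, D0.mem, D0.eq, D0.imp, D0.succ, GD.num, GD.empty, GD.pair,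
    GD.var, VD.head, VD.get, SD.tail, SD.id]

theorem D0.tupClause (hS : VD S) (hT : VD T) (hu : VD u) :
    D0 Cd fun v => TupClause (S v) (· ∈ T v) (u v) := by
  obtain ⟨S, rfl⟩ := hS.eq_get
  obtain ⟨T, rfl⟩ := hT.eq_get
  obtain ⟨u, rfl⟩ := hu.eq_get
  unfold TupClause
  apply_rules (maxDepth := 1000) (transparency := .reducible)
    [D0.and, D0.or, D0.not, D0.ball, D0.bex, D0.exPair, D0.exValue, D0.iff, D0.isTruth, D0.subset,
    D0.pred, D0.quad_mem, D0.mem, D0.eq, D0.imp, D0.succ, GD.num, GD.empty, GD.pair,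
    GD.var, VD.head, VD.get, SD.tail, SD.id]

theorem D0.varClause (hT : VD T) (hr : VD r) (hΓ : VD Γ) (ha : VD a) (hs : VD s) (hd : VD d) :
    D0 Cd fun v => VarClause (· ∈ T v) (r v) (Γ v) (a v) (s v) (d v) := by
  obtain ⟨T, rfl⟩ := hT.eq_get
  obtain ⟨r, rfl⟩ := hr.eq_get
  obtain ⟨Γ, rfl⟩ := hΓ.eq_get
  obtain ⟨a, rfl⟩ := ha.eq_get
  obtain ⟨s, rfl⟩ := hs.eq_get
  obtain ⟨d, rfl⟩ := hd.eq_get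
  unfold VarClause
  apply_rules (maxDepth := 1000) (transparency := .reducible)
    [D0.and, D0.or, D0.not, D0.ball, D0.bex, D0.exPair, D0.exValue, D0.iff, D0.isTruth, D0.subset,
    D0.pred, D0.quad_mem, D0.mem, D0.succ, D0.eq, D0.imp, GD.num, GD.empty, GD.pair,
    GD.var, VD.head, VD.get, SD.tail, SD.id]

theorem D0.appClause (hG : VD G) (hT : VD T) (hr : VD r) (hΓ : VD Γ) (ha : VD a) (hs : VD s) (hd : VD d) :
    D0 Cd fun v => AppClause (G v) (· ∈ T v) (r v) (Γ v) (a v) (s v) (d v) := by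
  obtain ⟨G, rfl⟩ := hG.eq_get
  obtain ⟨T, rfl⟩ := hT.eq_get
  obtain ⟨r, rfl⟩ := hr.eq_get
  obtain ⟨Γ, rfl⟩ := hΓ.eq_get
  obtain ⟨a, rfl⟩ := ha.eq_get
  obtain ⟨s, rfl⟩ := hs.eq_get
  obtain ⟨d, rfl⟩ := hd.eq_get
  unfold AppClause
  apply_rules (maxDepth := 1000) (transparency := .reducible)
    [D0.and, D0.or, D0.not, D0.ball, D0.bex, D0.exPair, D0.exValue, D0.iff, D0.isTruth, D0.subset,
    D0.pred, D0.quad_mem, D0.mem, D0.eq, D0.imp, D0.succ, GD.num, GD.empty, GD.pair,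
    GD.var, VD.head, VD.get, SD.tail, SD.id]

theorem D0.termsClause (hT : VD T) (hk : VD k) (hΓ : VD Γ) (ha : VD a) (hs : VD s) (hd : VD d) :
    D0 Cd fun v => TermsClause (· ∈ T v) (k v) (Γ v) (a v) (s v) (d v) := by
  obtain ⟨T, rfl⟩ := hT.eq_get
  obtain ⟨k, rfl⟩ := hk.eq_get
  obtain ⟨Γ, rfl⟩ := hΓ.eq_get
  obtain ⟨a, rfl⟩ := ha.eq_get
  obtain ⟨s, rfl⟩ := hs.eq_get
  obtain ⟨d, rfl⟩ := hd.eq_get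
  unfold TermsClause
  apply_rules (maxDepth := 1000) (transparency := .reducible)
    [D0.and, D0.or, D0.not, D0.ball, D0.bex, D0.exPair, D0.exValue, D0.iff, D0.isTruth, D0.subset,
    D0.pred, D0.quad_mem, D0.mem, D0.eq, D0.imp, D0.succ, GD.num, GD.empty, GD.pair,
    GD.var, VD.head, VD.get, SD.tail, SD.id]

theorem D0.termClause (hG : VD G) (hT : VD T) (hu : VD u) :
    D0 Cd fun v => TermClause (G v) (· ∈ T v) (u v) := by
  obtain ⟨G, rfl⟩ := hG.eq_get
  obtain ⟨T, rfl⟩ := hT.eq_get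
  obtain ⟨u, rfl⟩ := hu.eq_get
  unfold TermClause
  apply_rules (maxDepth := 1000) (transparency := .reducible)
    [D0.and, D0.or, D0.not, D0.ball, D0.bex, D0.exPair, D0.exValue, D0.iff, D0.isTruth, D0.subset,
    D0.pred, D0.quad_mem, D0.mem, D0.eq, D0.imp, D0.succ, GD.num, GD.empty, GD.pair,
    GD.var, VD.head, VD.get, SD.tail, SD.id, D0.varClause, D0.appClause, D0.termsClause]

theorem D0.isExtension (hT : VD T) (hX : VD X) (hD : VD D) (hs : VD s) (hp : VD p) (hΓ : VD Γ) (ha : VD a) :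
    D0 Cd fun v => IsExtension (· ∈ T v) (X v) (D v) (s v) (p v) (Γ v) (a v) := by
  obtain ⟨T, rfl⟩ := hT.eq_get
  obtain ⟨X, rfl⟩ := hX.eq_get
  obtain ⟨D, rfl⟩ := hD.eq_get
  obtain ⟨s, rfl⟩ := hs.eq_get
  obtain ⟨p, rfl⟩ := hp.eq_get
  obtain ⟨Γ, rfl⟩ := hΓ.eq_get
  obtain ⟨a, rfl⟩ := ha.eq_get
  unfold IsExtension
  apply_rules (maxDepth := 1000) (transparency := .reducible)
    [D0.and, D0.or, D0.not, D0.ball, D0.bex, D0.exPair, D0.exValue, D0.iff, D0.isTruth, D0.subset,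
    D0.pred, D0.quad_mem, D0.mem, D0.eq, D0.imp, D0.succ, GD.num, GD.empty, GD.pair,
    GD.var, VD.head, VD.get, SD.tail, SD.id]

theorem D0.eqClause (hU₀ : VD U₀) (hE : VD E) (hq : VD q) (hΓ : VD Γ) (ha : VD a) (hb : VD b) :
    D0 Cd fun v => EqClause (U₀ v) (E v) (q v) (Γ v) (a v) (b v) := by
  obtain ⟨U₀, rfl⟩ := hU₀.eq_get
  obtain ⟨E, rfl⟩ := hE.eq_get
  obtain ⟨q, rfl⟩ := hq.eq_get
  obtain ⟨Γ, rfl⟩ := hΓ.eq_get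
  obtain ⟨a, rfl⟩ := ha.eq_get
  obtain ⟨b, rfl⟩ := hb.eq_get
  unfold EqClause
  apply_rules (maxDepth := 1000) (transparency := .reducible)
    [D0.and, D0.or, D0.not, D0.ball, D0.bex, D0.exPair, D0.exValue, D0.iff, D0.isTruth, D0.subset,
    D0.pred, D0.quad_mem, D0.mem, D0.eq, D0.imp, D0.succ, GD.num, GD.empty, GD.pair,
    GD.var, VD.head, VD.get, SD.tail, SD.id]

theorem D0.relClause (hU₀ : VD U₀) (hE : VD E) (hR : VD R) (hq : VD q) (hΓ : VD Γ) (ha : VD a) (hb : VD b) :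
    D0 Cd fun v => RelClause (U₀ v) (E v) (R v) (q v) (Γ v) (a v) (b v) := by
  obtain ⟨U₀, rfl⟩ := hU₀.eq_get
  obtain ⟨E, rfl⟩ := hE.eq_get
  obtain ⟨R, rfl⟩ := hR.eq_get
  obtain ⟨q, rfl⟩ := hq.eq_get
  obtain ⟨Γ, rfl⟩ := hΓ.eq_get
  obtain ⟨a, rfl⟩ := ha.eq_get
  obtain ⟨b, rfl⟩ := hb.eq_get
  unfold RelClause
  apply_rules (maxDepth := 1000) (transparency := .reducible)
    [D0.and, D0.or, D0.not, D0.ball, D0.bex, D0.exPair, D0.exValue, D0.iff, D0.isTruth, D0.subset,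
    D0.pred, D0.quad_mem, D0.mem, D0.eq, D0.imp, D0.succ, GD.num, GD.empty, GD.pair,
    GD.var, VD.head, VD.get, SD.tail, SD.id]

theorem D0.impClause (hU₀ : VD U₀) (hT : VD T) (hq : VD q) (hΓ : VD Γ) (ha : VD a) (hb : VD b) :
    D0 Cd fun v => ImpClause (U₀ v) (· ∈ T v) (q v) (Γ v) (a v) (b v) := by
  obtain ⟨U₀, rfl⟩ := hU₀.eq_get
  obtain ⟨T, rfl⟩ := hT.eq_get
  obtain ⟨q, rfl⟩ := hq.eq_get
  obtain ⟨Γ, rfl⟩ := hΓ.eq_get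
  obtain ⟨a, rfl⟩ := ha.eq_get
  obtain ⟨b, rfl⟩ := hb.eq_get
  unfold ImpClause
  apply_rules (maxDepth := 1000) (transparency := .reducible)
    [D0.and, D0.or, D0.not, D0.ball, D0.bex, D0.exPair, D0.exValue, D0.iff, D0.isTruth, D0.subset,
    D0.pred, D0.quad_mem, D0.mem, D0.eq, D0.imp, D0.succ, GD.num, GD.empty, GD.pair,
    GD.var, VD.head, VD.get, SD.tail, SD.id]

theorem D0.allClause (hU : VD U) (hS : VD S) (hT : VD T) (hq : VD q) (hΓ : VD Γ) (ha : VD a) (hb : VD b) :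
    D0 Cd fun v => AllClause (U v) (S v) (· ∈ T v) (q v) (Γ v) (a v) (b v) := by
  obtain ⟨U, rfl⟩ := hU.eq_get
  obtain ⟨S, rfl⟩ := hS.eq_get
  obtain ⟨T, rfl⟩ := hT.eq_get
  obtain ⟨q, rfl⟩ := hq.eq_get
  obtain ⟨Γ, rfl⟩ := hΓ.eq_get
  obtain ⟨a, rfl⟩ := ha.eq_get
  obtain ⟨b, rfl⟩ := hb.eq_get
  unfold AllClause
  apply_rules (maxDepth := 1000) (transparency := .reducible)
    [D0.and, D0.or, D0.not, D0.ball, D0.bex, D0.exPair, D0.exValue, D0.iff, D0.isTruth, D0.subset,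
    D0.pred, D0.quad_mem, D0.mem, D0.eq, D0.imp, D0.succ, GD.num, GD.empty, GD.pair,
    GD.var, VD.head, VD.get, SD.tail, SD.id, D0.isExtension]

theorem D0.hartigClause (hU : VD U) (hS : VD S) (hT : VD T) (hq : VD q) (hΓ : VD Γ) (ha : VD a) (hb : VD b) :
    D0 Cd fun v => HartigClause (U v) (S v) (· ∈ T v) (q v) (Γ v) (a v) (b v) := by
  obtain ⟨U, rfl⟩ := hU.eq_get
  obtain ⟨S, rfl⟩ := hS.eq_get
  obtain ⟨T, rfl⟩ := hT.eq_get
  obtain ⟨q, rfl⟩ := hq.eq_get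
  obtain ⟨Γ, rfl⟩ := hΓ.eq_get
  obtain ⟨a, rfl⟩ := ha.eq_get
  obtain ⟨b, rfl⟩ := hb.eq_get
  unfold HartigClause
  apply_rules (maxDepth := 1000) (transparency := .reducible)
    [D0.and, D0.or, D0.not, D0.ball, D0.bex, D0.exPair, D0.exValue, D0.iff, D0.isTruth, D0.subset,
    D0.pred, D0.quad_mem, D0.mem, D0.eq, D0.imp, D0.succ, GD.num, GD.empty, GD.pair,
    GD.var, VD.head, VD.get, SD.tail, SD.id, D0.isExtension, D0.setBij]

theorem D0.valClause (hU₀ : VD U₀) (hU : VD U) (hS : VD S) (hR : VD R) (hE : VD E) (hT : VD T) (hu : VD u) :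
    D0 Cd fun v => ValClause (U₀ v) (U v) (S v) (R v) (E v) (· ∈ T v) (u v) := by
  obtain ⟨U₀, rfl⟩ := hU₀.eq_get
  obtain ⟨U, rfl⟩ := hU.eq_get
  obtain ⟨S, rfl⟩ := hS.eq_get
  obtain ⟨R, rfl⟩ := hR.eq_get
  obtain ⟨E, rfl⟩ := hE.eq_get
  obtain ⟨T, rfl⟩ := hT.eq_get
  obtain ⟨u, rfl⟩ := hu.eq_get
  unfold ValClause
  apply_rules (maxDepth := 1000) (transparency := .reducible)
    [D0.and, D0.or, D0.not, D0.ball, D0.bex, D0.exPair, D0.exValue, D0.iff, D0.isTruth, D0.subset,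
    D0.pred, D0.quad_mem, D0.mem, D0.eq, D0.imp, D0.succ, GD.num, GD.empty, GD.pair,
    GD.var, VD.head, VD.get, SD.tail, SD.id, D0.eqClause, D0.relClause, D0.impClause,
    D0.allClause, D0.hartigClause]

theorem D0.isStruct (hU₀ : VD U₀) (hS : VD S) (hR : VD R) (hG : VD G) (hT : VD T) :
    D0 Cd fun v => IsStruct (U₀ v) (S v) (R v) (G v) (T v) := by
  obtain ⟨U₀, rfl⟩ := hU₀.eq_get
  obtain ⟨S, rfl⟩ := hS.eq_get
  obtain ⟨R, rfl⟩ := hR.eq_get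
  obtain ⟨G, rfl⟩ := hG.eq_get
  obtain ⟨T, rfl⟩ := hT.eq_get
  unfold IsStruct
  apply_rules (maxDepth := 1000) (transparency := .reducible)
    [D0.and, D0.or, D0.not, D0.ball, D0.bex, D0.exPair, D0.exValue, D0.iff, D0.isTruth, D0.subset,
    D0.pred, D0.quad_mem, D0.mem, D0.eq, D0.imp, D0.succ, GD.num, GD.empty, GD.pair,
    GD.var, VD.head, VD.get, SD.tail, SD.id, D0.setFunctional]

theorem D0.isUniverse (hU₀ : VD U₀) (hx : VD x) :
    D0 Cd fun v => IsUniverse (U₀ v) (x v) := by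
  obtain ⟨U₀, rfl⟩ := hU₀.eq_get
  obtain ⟨x, rfl⟩ := hx.eq_get
  unfold IsUniverse
  apply_rules (maxDepth := 1000) (transparency := .reducible)
    [D0.and, D0.or, D0.not, D0.ball, D0.bex, D0.exPair, D0.exValue, D0.iff, D0.isTruth, D0.subset,
    D0.pred, D0.quad_mem, D0.mem, D0.eq, D0.imp, D0.succ, GD.num, GD.empty, GD.pair,
    GD.var, VD.head, VD.get, SD.tail, SD.id]

theorem D0.isRich (hU₀ : VD U₀) (hU : VD U) (hT : VD T) :
    D0 Cd fun v => IsRich (U₀ v) (U v) (T v) := by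
  obtain ⟨U₀, rfl⟩ := hU₀.eq_get
  obtain ⟨U, rfl⟩ := hU.eq_get
  obtain ⟨T, rfl⟩ := hT.eq_get
  unfold IsRich
  apply_rules (maxDepth := 1000) (transparency := .reducible)
    [D0.and, D0.or, D0.not, D0.ball, D0.bex, D0.exPair, D0.exValue, D0.iff, D0.isTruth, D0.subset,
    D0.pred, D0.quad_mem, D0.mem, D0.eq, D0.imp, D0.succ, GD.num, GD.empty, GD.pair,
    GD.var, VD.head, VD.get, SD.tail, SD.id, D0.setBij]

theorem D0.isFixed (hU₀ : VD U₀) (hU : VD U) (hS : VD S) (hR : VD R) (hG : VD G) (hT₁ : VD T₁) (hT₂ : VD T₂) (hT₃ : VD T₃) :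
    D0 Cd fun v => IsFixed (U₀ v) (U v) (S v) (R v) (G v) (T₁ v) (T₂ v) (T₃ v) := by
  obtain ⟨U₀, rfl⟩ := hU₀.eq_get
  obtain ⟨U, rfl⟩ := hU.eq_get
  obtain ⟨S, rfl⟩ := hS.eq_get
  obtain ⟨R, rfl⟩ := hR.eq_get
  obtain ⟨G, rfl⟩ := hG.eq_get
  obtain ⟨T₁, rfl⟩ := hT₁.eq_get
  obtain ⟨T₂, rfl⟩ := hT₂.eq_get
  obtain ⟨T₃, rfl⟩ := hT₃.eq_get
  unfold IsFixed
  apply_rules (maxDepth := 1000) (transparency := .reducible)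
    [D0.and, D0.or, D0.not, D0.ball, D0.bex, D0.exPair, D0.exValue, D0.iff, D0.isTruth, D0.subset,
    D0.pred, D0.quad_mem, D0.mem, D0.eq, D0.imp, D0.succ, GD.num, GD.empty, GD.pair,
    GD.var, VD.head, VD.get, SD.tail, SD.id, D0.tupClause, D0.termClause, D0.valClause]

end

/-! ## The tuples and terms of a coded structure -/

theorem IsUniverse.pair_mem {U₀ x a b : ZFSet.{u}} (h : IsUniverse U₀ x) :
    ZFSet.pair a b ∈ U₀ ↔ a ∈ U₀ ∧ b ∈ U₀ :=
  ⟨fun hab => ⟨fst_mem_of_pair_mem h.1 hab, snd_mem_of_pair_mem h.1 hab⟩,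
    fun hab => h.2.1 a hab.1 b hab.2⟩

theorem IsUniverse.empty_mem {U₀ x : ZFSet.{u}} (h : IsUniverse U₀ x) : ∅ ∈ U₀ := h.2.2.2.1

theorem insert_self_inj {m n : ZFSet.{u}} (h : insert m m = insert n n) : m = n := by
  have h1 : m ∈ insert n n := h ▸ ZFSet.mem_insert m m
  have h2 : n ∈ insert m m := h ▸ ZFSet.mem_insert n n
  rw [ZFSet.mem_insert_iff] at h1 h2
  rcases h1 with h1 | h1
  · exact h1
  · rcases h2 with h2 | h2
    · exact h2.symm
    · exact absurd h2 (ZFSet.mem_asymm h1)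

/-- The set coding a family of domains with names. -/
noncomputable def codeDomains {ι : Type u} {D : ι → Type u} (nm : ι → ZFSet.{u})
    (el : ∀ s, D s → ZFSet.{u}) : ZFSet.{u} :=
  ZFSet.range fun s => ZFSet.pair (nm s) (ZFSet.range (el s))

section
variable {ι : Type u} {D : ι → Type u} {nm : ι → ZFSet.{u}} {el : ∀ s, D s → ZFSet.{u}}

theorem pair_mem_codeDomains {x y : ZFSet.{u}} :
    ZFSet.pair x y ∈ codeDomains nm el ↔ ∃ s, x = nm s ∧ y = ZFSet.range (el s) := by
  simp only [codeDomains, ZFSet.mem_range, ZFSet.pair_inj]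
  exact exists_congr fun s => and_congr eq_comm eq_comm

theorem nm_pair_mem_codeDomains (hnm : Function.Injective nm) {s : ι} {y : ZFSet.{u}} :
    ZFSet.pair (nm s) y ∈ codeDomains nm el ↔ y = ZFSet.range (el s) := by
  rw [pair_mem_codeDomains]
  constructor
  · rintro ⟨s', hs, rfl⟩
    rw [hnm hs]
  · exact fun h => ⟨s, rfl, h⟩

variable {U₀ x T₁ : ZFSet.{u}}

theorem IsUniverse.nm_mem (hU : IsUniverse U₀ x) (hS : codeDomains nm el ∈ U₀) (s : ι) :
    nm s ∈ U₀ :=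
  (hU.pair_mem.1 (hU.1 _ hS (pair_mem_codeDomains.2 ⟨s, rfl, rfl⟩))).1

theorem IsUniverse.domain_mem (hU : IsUniverse U₀ x) (hS : codeDomains nm el ∈ U₀) (s : ι) :
    ZFSet.range (el s) ∈ U₀ :=
  (hU.pair_mem.1 (hU.1 _ hS (pair_mem_codeDomains.2 ⟨s, rfl, rfl⟩))).2

theorem IsUniverse.el_mem (hU : IsUniverse U₀ x) (hS : codeDomains nm el ∈ U₀) (s : ι) (d : D s) :
    el s d ∈ U₀ :=
  hU.1 _ (hU.domain_mem hS s) (ZFSet.mem_range.2 ⟨d, rfl⟩)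

theorem IsUniverse.codeList_mem (hU : IsUniverse U₀ x) (hS : codeDomains nm el ∈ U₀)
    (Δ : List ι) : codeList (Δ.map nm) ∈ U₀ := by
  induction Δ with
  | nil => exact hU.empty_mem
  | cons s Δ ih => exact hU.pair_mem.2 ⟨hU.nm_mem hS s, ih⟩

theorem IsUniverse.codeTup_mem (hU : IsUniverse U₀ x) (hS : codeDomains nm el ∈ U₀)
    (Δ : List ι) (t : Tup D Δ) : codeTup el Δ t ∈ U₀ := by
  induction Δ with
  | nil => exact hU.empty_mem
  | cons s Δ ih => exact hU.pair_mem.2 ⟨hU.el_mem hS s t.1, ih t.2⟩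

theorem tup_mem_iff (hU : IsUniverse U₀ x) (hnm : Function.Injective nm)
    (hS : codeDomains nm el ∈ U₀)
    (hT : T₁ ⊆ U₀ ∧ ∀ u ∈ U₀, u ∈ T₁ ↔ TupClause (codeDomains nm el) (· ∈ T₁) u)
    (Δ : List ι) (z : ZFSet.{u}) :
    ZFSet.pair (codeList (Δ.map nm)) z ∈ T₁ ↔ ∃ t, z = codeTup el Δ t := by
  induction Δ generalizing z with
  | nil =>
    constructor
    · intro h
      have h1 := (hT.2 _ (hT.1 h)).1 h
      simp only [TupClause, ZFSet.pair_inj] at h1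
      obtain ⟨_, _, ⟨rfl, rfl⟩, h1 | ⟨s, l', h1, _⟩⟩ := h1
      · exact ⟨PUnit.unit, h1.2⟩
      · exact absurd h1 (empty_ne_pair _ _)
    · rintro ⟨t, rfl⟩
      refine (hT.2 _ (hU.pair_mem.2 ⟨hU.empty_mem, hU.empty_mem⟩)).2 ?_
      exact ⟨_, _, rfl, Or.inl ⟨rfl, rfl⟩⟩
  | cons s Δ ih =>
    constructor
    · intro h
      have h1 := (hT.2 _ (hT.1 h)).1 h
      simp only [TupClause, ZFSet.pair_inj] at h1
      obtain ⟨_, _, ⟨rfl, rfl⟩, ⟨h1, _⟩ | ⟨s', l', h1, d, t', rfl, ⟨E, hE, hd⟩, h2⟩⟩ := h1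
      · exact absurd h1.symm (empty_ne_pair _ _)
      · obtain ⟨rfl, rfl⟩ := ZFSet.pair_injective h1
        rw [nm_pair_mem_codeDomains hnm] at hE
        subst hE
        obtain ⟨y, rfl⟩ := ZFSet.mem_range.1 hd
        obtain ⟨t, rfl⟩ := (ih _).1 h2
        exact ⟨(y, t), rfl⟩
    · rintro ⟨t, rfl⟩
      refine (hT.2 _ (hU.pair_mem.2 ⟨hU.codeList_mem hS _, hU.codeTup_mem hS _ t⟩)).2 ?_
      exact ⟨_, _, rfl, Or.inr ⟨_, _, rfl, _, _, rfl,
        ⟨_, (nm_pair_mem_codeDomains hnm).2 rfl, ZFSet.mem_range.2 ⟨t.1, rfl⟩⟩,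
        (ih _).2 ⟨t.2, rfl⟩⟩⟩

theorem exists_list_of_tup_mem
    (hT : T₁ ⊆ U₀ ∧ ∀ u ∈ U₀, u ∈ T₁ ↔ TupClause (codeDomains nm el) (· ∈ T₁) u)
    {l : ZFSet.{u}} : ∀ {z : ZFSet.{u}}, ZFSet.pair l z ∈ T₁ → ∃ Δ : List ι, l = codeList (Δ.map nm) := by
  induction l using WellFounded.induction (InvImage.wf ZFSet.rank Ordinal.lt_wf) with
  | h l ih =>
    intro z h
    have h1 := (hT.2 _ (hT.1 h)).1 h
    simp only [TupClause, ZFSet.pair_inj] at h1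
    obtain ⟨_, _, ⟨rfl, rfl⟩, ⟨rfl, _⟩ | ⟨s', l', rfl, d, t', rfl, ⟨E, hE, hd⟩, h2⟩⟩ := h1
    · exact ⟨[], rfl⟩
    · obtain ⟨Δ, rfl⟩ := ih l' (rank_lt_pair_right _ _) h2
      obtain ⟨s, rfl, _⟩ := pair_mem_codeDomains.1 hE
      exact ⟨s :: Δ, rfl⟩

end

section
variable {τ : Voc.{u}} (ν : Naming τ) (M : Struct τ) (e : Elems M)

/-- The set coding the domains of a structure. -/
noncomputable abbrev codeSorts : ZFSet.{u} := codeDomains ν.sort e.el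

/-- The set coding the interpretation of a relation symbol. -/
noncomputable def codeRelGraph {Δ : List τ.sorts} (r : τ.rels Δ) : ZFSet.{u} :=
  ZFSet.range fun t : {t : Tup M.dom Δ // M.rel r t} => codeTup e.el Δ t.1

/-- The set coding the interpretation of a function symbol. -/
noncomputable def codeFnGraph {Δ : List τ.sorts} {s : τ.sorts} (f : τ.funs Δ s) : ZFSet.{u} :=
  ZFSet.range fun t : Tup M.dom Δ => ZFSet.pair (codeTup e.el Δ t) (e.el s (M.fn f t))

/-- The set coding the relations of a structure. -/
noncomputable def codeRels : ZFSet.{u} :=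
  ZFSet.range fun r : Σ Δ, τ.rels Δ => ZFSet.pair (ν.codeRel r.2) (codeRelGraph M e r.2)

/-- The set coding the functions of a structure. -/
noncomputable def codeFns : ZFSet.{u} :=
  ZFSet.range fun f : Σ p : List τ.sorts × τ.sorts, τ.funs p.1 p.2 =>
    ZFSet.pair (ν.codeFn f.2) (codeFnGraph M e f.2)

theorem codeStruct_eq :
    codeStruct ν M e = ZFSet.pair (codeSorts ν M e) (ZFSet.pair (codeRels ν M e) (codeFns ν M e)) :=
  rfl

variable {ν M e}

theorem Naming.codeList_inj {Δ Δ' : List τ.sorts}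
    (h : codeList (Δ.map ν.sort) = codeList (Δ'.map ν.sort)) : Δ = Δ' :=
  ν.sort_inj.list_map (codeList_injective h)

theorem pair_mem_codeRels {Δ : List τ.sorts} (r : τ.rels Δ) {y : ZFSet.{u}} :
    ZFSet.pair (ν.codeRel r) y ∈ codeRels ν M e ↔ y = codeRelGraph M e r := by
  simp only [codeRels, ZFSet.mem_range, ZFSet.pair_inj]
  constructor
  · rintro ⟨⟨Δ', r'⟩, h, rfl⟩
    obtain ⟨h1, h2⟩ := ZFSet.pair_injective h
    obtain rfl := Naming.codeList_inj h2
    obtain rfl := ν.rel_inj _ h1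
    rfl
  · rintro rfl
    exact ⟨⟨Δ, r⟩, rfl, rfl⟩

theorem pair_mem_codeFns {Δ : List τ.sorts} {s : τ.sorts} (f : τ.funs Δ s) {y : ZFSet.{u}} :
    ZFSet.pair (ν.codeFn f) y ∈ codeFns ν M e ↔ y = codeFnGraph M e f := by
  simp only [codeFns, ZFSet.mem_range, ZFSet.pair_inj]
  constructor
  · rintro ⟨⟨⟨Δ', s'⟩, f'⟩, h, rfl⟩
    obtain ⟨h1, h2⟩ := ZFSet.pair_injective h
    obtain ⟨h2, h3⟩ := ZFSet.pair_injective h2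
    obtain rfl := Naming.codeList_inj h2
    obtain rfl := ν.sort_inj h3
    obtain rfl := ν.fn_inj _ _ h1
    rfl
  · rintro rfl
    exact ⟨⟨⟨Δ, s⟩, f⟩, rfl, rfl⟩

theorem exists_rel_of_pair_mem {x y : ZFSet.{u}} (h : ZFSet.pair x y ∈ codeRels ν M e) :
    ∃ (Δ : List τ.sorts) (r : τ.rels Δ), x = ν.codeRel r := by
  obtain ⟨r, hr⟩ := ZFSet.mem_range.1 h
  exact ⟨_, r.2, (ZFSet.pair_injective hr).1.symm⟩

theorem exists_fn_of_pair_mem {x y : ZFSet.{u}} (h : ZFSet.pair x y ∈ codeFns ν M e) :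
    ∃ (Δ : List τ.sorts) (s : τ.sorts) (f : τ.funs Δ s), x = ν.codeFn f := by
  obtain ⟨r, hr⟩ := ZFSet.mem_range.1 h
  exact ⟨_, _, r.2, (ZFSet.pair_injective hr).1.symm⟩

theorem codeTup_mem_codeRelGraph {Δ : List τ.sorts} (r : τ.rels Δ) (t : Tup M.dom Δ) :
    codeTup e.el Δ t ∈ codeRelGraph M e r ↔ M.rel r t := by
  simp only [codeRelGraph, ZFSet.mem_range]
  constructor
  · rintro ⟨t', h⟩
    exact codeTup_injective e.el_inj _ h ▸ t'.2
  · exact fun h => ⟨⟨t, h⟩, rfl⟩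

variable {U₀ x T₂ : ZFSet.{u}}

theorem sext_mem_iff
    (hT : T₂ ⊆ U₀ ∧ ∀ u ∈ U₀, u ∈ T₂ ↔ TermClause (codeFns ν M e) (· ∈ T₂) u)
    {i k Γ a s d : ZFSet.{u}} :
    sext i k Γ a s d ∈ T₂ ↔ sext i k Γ a s d ∈ U₀ ∧
      ((i = num 0 ∧ ∃ c r, k = ZFSet.pair c r ∧
          ((c = num 0 ∧ VarClause (· ∈ T₂) r Γ a s d) ∨
            (c = num 1 ∧ AppClause (codeFns ν M e) (· ∈ T₂) r Γ a s d))) ∨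
        (i = num 1 ∧ TermsClause (· ∈ T₂) k Γ a s d)) := by
  refine (and_iff_right_of_imp fun h => hT.1 h).symm.trans
    (and_congr_right fun h => (hT.2 _ h).trans ?_)
  constructor
  · rintro ⟨_, _, h1, _, _, h2, _, _, h3, _, _, h4, _, _, h5, h⟩
    obtain ⟨rfl, rfl⟩ := ZFSet.pair_injective h1
    obtain ⟨rfl, rfl⟩ := ZFSet.pair_injective h2
    obtain ⟨rfl, rfl⟩ := ZFSet.pair_injective h3
    obtain ⟨rfl, rfl⟩ := ZFSet.pair_injective h4
    obtain ⟨rfl, rfl⟩ := ZFSet.pair_injective h5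
    exact h
  · exact fun h => ⟨_, _, rfl, _, _, rfl, _, _, rfl, _, _, rfl, _, _, rfl, h⟩

theorem var_mem_iff
    (hT : T₂ ⊆ U₀ ∧ ∀ u ∈ U₀, u ∈ T₂ ↔ TermClause (codeFns ν M e) (· ∈ T₂) u)
    {r Γ a s d : ZFSet.{u}} :
    sext (num 0) (ZFSet.pair (num 0) r) Γ a s d ∈ T₂ ↔
      sext (num 0) (ZFSet.pair (num 0) r) Γ a s d ∈ U₀ ∧ VarClause (· ∈ T₂) r Γ a s d := by
  rw [sext_mem_iff hT]
  refine and_congr_right fun _ => ?_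
  simp [ZFSet.pair_inj]

theorem app_mem_iff
    (hT : T₂ ⊆ U₀ ∧ ∀ u ∈ U₀, u ∈ T₂ ↔ TermClause (codeFns ν M e) (· ∈ T₂) u)
    {r Γ a s d : ZFSet.{u}} :
    sext (num 0) (ZFSet.pair (num 1) r) Γ a s d ∈ T₂ ↔
      sext (num 0) (ZFSet.pair (num 1) r) Γ a s d ∈ U₀ ∧
        AppClause (codeFns ν M e) (· ∈ T₂) r Γ a s d := by
  rw [sext_mem_iff hT]
  refine and_congr_right fun _ => ?_
  simp [ZFSet.pair_inj]

theorem terms_mem_iff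
    (hT : T₂ ⊆ U₀ ∧ ∀ u ∈ U₀, u ∈ T₂ ↔ TermClause (codeFns ν M e) (· ∈ T₂) u)
    {k Γ a s d : ZFSet.{u}} :
    sext (num 1) k Γ a s d ∈ T₂ ↔
      sext (num 1) k Γ a s d ∈ U₀ ∧ TermsClause (· ∈ T₂) k Γ a s d := by
  rw [sext_mem_iff hT]
  refine and_congr_right fun _ => ?_
  simp

theorem num_index_mem_iff (hU : IsUniverse U₀ x) (hS : codeSorts ν M e ∈ U₀)
    (hT : T₂ ⊆ U₀ ∧ ∀ u ∈ U₀, u ∈ T₂ ↔ TermClause (codeFns ν M e) (· ∈ T₂) u)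
    {Γ : List τ.sorts} {s : τ.sorts} (w : Var Γ s) (hw : num w.index ∈ U₀) (a : Tup M.dom Γ)
    (s' d : ZFSet.{u}) :
    sext (num 0) (ZFSet.pair (num 0) (num w.index)) (codeList (Γ.map ν.sort)) (codeTup e.el Γ a)
      s' d ∈ T₂ ↔ s' = ν.sort s ∧ d = e.el s (w.eval a) := by
  induction w with
  | zero =>
    rw [var_mem_iff hT]
    constructor
    · rintro ⟨_, s₁, Γ', h1, d', a', h2, h | ⟨m, hm, _⟩⟩
      · obtain ⟨rfl, rfl⟩ := ZFSet.pair_injective h1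
        obtain ⟨rfl, rfl⟩ := ZFSet.pair_injective h2
        exact h.2
      · exact absurd hm (ZFSet.notMem_empty _)
    · rintro ⟨rfl, rfl⟩
      refine ⟨?_, _, _, rfl, _, _, rfl, Or.inl ⟨rfl, rfl, rfl⟩⟩
      simp only [hU.pair_mem, hU.codeList_mem hS, hU.codeTup_mem hS, hU.nm_mem hS, hU.el_mem hS,
        hw, hU.2.2.2.1, and_self]
  | @succ Γ s t w ih =>
    have hs : num (Var.index (.succ (t := t) w)) = insert (num.{u} w.index) (num w.index) := rfl
    have hw' : num w.index ∈ U₀ := hU.1 _ hw (hs ▸ ZFSet.mem_insert _ _)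
    rw [var_mem_iff hT]
    constructor
    · rintro ⟨_, s₁, Γ', h1, d', a', h2, h | ⟨m, hm, h, h3⟩⟩
      · exact absurd (h.1 ▸ hs ▸ ZFSet.mem_insert (num w.index) (num w.index))
          (ZFSet.notMem_empty _)
      · obtain ⟨rfl, rfl⟩ := ZFSet.pair_injective h1
        obtain ⟨rfl, rfl⟩ := ZFSet.pair_injective h2
        obtain rfl := insert_self_inj (hs.symm.trans h)
        exact (ih hw' a.2).1 h3
    · intro h
      refine ⟨?_, _, _, rfl, _, _, rfl, Or.inr ⟨num w.index, hs ▸ ZFSet.mem_insert _ _, hs,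
        (ih hw' a.2).2 h⟩⟩
      rw [h.1, h.2]
      simp only [hU.pair_mem, hU.codeList_mem hS, hU.codeTup_mem hS, hU.nm_mem hS, hU.el_mem hS,
        hw, hU.2.2.2.1, and_self]

theorem exists_var_of_mem
    (hT : T₂ ⊆ U₀ ∧ ∀ u ∈ U₀, u ∈ T₂ ↔ TermClause (codeFns ν M e) (· ∈ T₂) u)
    (Γ : List τ.sorts) (a : Tup M.dom Γ) {r s' d : ZFSet.{u}}
    (h : sext (num 0) (ZFSet.pair (num 0) r) (codeList (Γ.map ν.sort)) (codeTup e.el Γ a)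
      s' d ∈ T₂) : ∃ (s : τ.sorts) (w : Var Γ s), r = num w.index := by
  induction Γ generalizing r with
  | nil =>
    obtain ⟨_, s₁, Γ', h1, _⟩ := (var_mem_iff hT).1 h
    exact absurd h1 (empty_ne_pair _ _)
  | cons s Γ ih =>
    obtain ⟨_, s₁, Γ', h1, d', a', h2, h | ⟨m, hm, h, h3⟩⟩ := (var_mem_iff hT).1 h
    · exact ⟨s, .zero, h.1⟩
    · obtain ⟨rfl, rfl⟩ := ZFSet.pair_injective h1
      obtain ⟨rfl, rfl⟩ := ZFSet.pair_injective h2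
      obtain ⟨s', w, rfl⟩ := ih a.2 h3
      exact ⟨s', .succ w, h⟩

mutual

theorem codeTerm_mem_iff (hU : IsUniverse U₀ x) (hS : codeSorts ν M e ∈ U₀)
    (hT : T₂ ⊆ U₀ ∧ ∀ u ∈ U₀, u ∈ T₂ ↔ TermClause (codeFns ν M e) (· ∈ T₂) u)
    {Γ : List τ.sorts} (a : Tup M.dom Γ) {s : τ.sorts} : (t : Term τ Γ s) →
    codeTerm ν t ∈ U₀ → ∀ s' d : ZFSet.{u},
    (sext (num 0) (codeTerm ν t) (codeList (Γ.map ν.sort)) (codeTup e.el Γ a)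
      s' d ∈ T₂ ↔ s' = ν.sort s ∧ d = e.el s (t.eval M a))
  | .var w, ht, s', d => by
    rw [codeTerm] at ht ⊢
    rw [Term.eval]
    exact num_index_mem_iff hU hS hT w (hU.pair_mem.1 ht).2 a s' d
  | .app (Δ := Δ) f ts, ht, s', d => by
    have ih := codeTerms_mem_iff hU hS hT a ts
    rw [codeTerm] at ht ⊢
    have ht' := hU.pair_mem.1 (hU.pair_mem.1 ht).2
    rw [app_mem_iff hT, Term.eval]
    constructor
    · rintro ⟨_, f', ts', h1, n, q, h2, Δ', s₁, h3, rfl, g, hg, m, hm, t, d', rfl, rfl, h4⟩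
      obtain ⟨rfl, rfl⟩ := ZFSet.pair_injective h1
      obtain ⟨rfl, rfl⟩ := ZFSet.pair_injective h2
      obtain ⟨rfl, rfl⟩ := ZFSet.pair_injective h3
      refine ⟨rfl, ?_⟩
      obtain rfl := ((ih ht'.2 _ _).1 h4).2
      rw [pair_mem_codeFns] at hg
      subst hg
      obtain ⟨t', h5⟩ := ZFSet.mem_range.1 hm
      obtain ⟨h6, rfl⟩ := ZFSet.pair_injective h5
      rw [codeTup_injective e.el_inj _ h6]
    · rintro ⟨rfl, rfl⟩
      refine ⟨?_, _, _, rfl, _, _, rfl, _, _, rfl, rfl, _, (pair_mem_codeFns f).2 rfl, _,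
        ZFSet.mem_range.2 ⟨ts.eval M a, rfl⟩, _, _, rfl, rfl, (ih ht'.2 _ _).2 ⟨rfl, rfl⟩⟩
      rw [hU.pair_mem]
      refine ⟨hU.2.2.2.1, hU.pair_mem.2 ⟨ht, ?_⟩⟩
      simp only [hU.pair_mem, hU.codeList_mem hS, hU.codeTup_mem hS, hU.nm_mem hS, hU.el_mem hS,
        and_self]

theorem codeTerms_mem_iff (hU : IsUniverse U₀ x) (hS : codeSorts ν M e ∈ U₀)
    (hT : T₂ ⊆ U₀ ∧ ∀ u ∈ U₀, u ∈ T₂ ↔ TermClause (codeFns ν M e) (· ∈ T₂) u)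
    {Γ : List τ.sorts} (a : Tup M.dom Γ) {Δ : List τ.sorts} : (ts : Terms τ Γ Δ) →
    codeTerms ν ts ∈ U₀ → ∀ s' d : ZFSet.{u},
    (sext (num 1) (codeTerms ν ts) (codeList (Γ.map ν.sort)) (codeTup e.el Γ a)
      s' d ∈ T₂ ↔ s' = codeList (Δ.map ν.sort) ∧ d = codeTup e.el Δ (ts.eval M a))
  | .nil, ht, s', d => by
    rw [codeTerms] at ht ⊢
    rw [terms_mem_iff hT]
    constructor
    · rintro ⟨_, h | ⟨_, _, h, _⟩⟩
      · exact h.2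
      · exact absurd h (empty_ne_pair _ _)
    · rintro ⟨rfl, rfl⟩
      refine ⟨?_, Or.inl ⟨rfl, rfl, rfl⟩⟩
      simp only [hU.pair_mem, hU.codeList_mem hS, hU.codeTup_mem hS, hU.2.2.2.2, hU.empty_mem,
        and_self]
  | .cons t ts, ht, s', d => by
    have ih1 := codeTerm_mem_iff hU hS hT a t
    have ih2 := codeTerms_mem_iff hU hS hT a ts
    rw [codeTerms] at ht ⊢
    have ht' := hU.pair_mem.1 ht
    rw [terms_mem_iff hT, Terms.eval]
    constructor
    · rintro ⟨_, h | ⟨_, _, h, s₁, Δ₁, rfl, d₁, d₂, rfl, h1, h2⟩⟩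
      · exact absurd h.1.symm (empty_ne_pair _ _)
      · obtain ⟨rfl, rfl⟩ := ZFSet.pair_injective h
        obtain ⟨rfl, rfl⟩ := (ih1 ht'.1 _ _).1 h1
        obtain ⟨rfl, rfl⟩ := (ih2 ht'.2 _ _).1 h2
        exact ⟨rfl, rfl⟩
    · rintro ⟨rfl, rfl⟩
      refine ⟨?_, Or.inr ⟨_, _, rfl, _, _, rfl, _, _, rfl, (ih1 ht'.1 _ _).2 ⟨rfl, rfl⟩,
        (ih2 ht'.2 _ _).2 ⟨rfl, rfl⟩⟩⟩
      rw [hU.pair_mem]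
      exact ⟨hU.2.2.2.2, hU.pair_mem.2 ⟨ht, hU.pair_mem.2 ⟨hU.codeList_mem hS Γ, hU.pair_mem.2
        ⟨hU.codeTup_mem hS Γ a, hU.pair_mem.2 ⟨hU.codeList_mem hS (_ :: _),
          hU.codeTup_mem hS (_ :: _) (_, _)⟩⟩⟩⟩⟩

end

theorem exists_term_of_mem (hU : IsUniverse U₀ x) (hS : codeSorts ν M e ∈ U₀)
    (hT : T₂ ⊆ U₀ ∧ ∀ u ∈ U₀, u ∈ T₂ ↔ TermClause (codeFns ν M e) (· ∈ T₂) u)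
    {Γ : List τ.sorts} (a : Tup M.dom Γ) (k : ZFSet.{u}) :
    (∀ s' d, sext (num 0) k (codeList (Γ.map ν.sort)) (codeTup e.el Γ a) s' d ∈ T₂ →
      ∃ (s : τ.sorts) (t : Term τ Γ s), k = codeTerm ν t) ∧
    (∀ s' d, sext (num 1) k (codeList (Γ.map ν.sort)) (codeTup e.el Γ a) s' d ∈ T₂ →
      ∃ (Δ : List τ.sorts) (ts : Terms τ Γ Δ), k = codeTerms ν ts) := by
  induction k using WellFounded.induction (InvImage.wf ZFSet.rank Ordinal.lt_wf) with
  | h k ih =>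
    have hk : ∀ {i s' d : ZFSet.{u}}, sext i k (codeList (Γ.map ν.sort)) (codeTup e.el Γ a) s' d ∈ T₂ →
        k ∈ U₀ := fun h => (hU.pair_mem.1 (hU.pair_mem.1 (hT.1 h)).2).1
    constructor
    · intro s' d h
      have h1 := ((sext_mem_iff hT).1 h).2
      obtain ⟨_, c, r, rfl, ⟨rfl, _⟩ | ⟨rfl, h2⟩⟩ | h2 := h1
      · obtain ⟨s, w, rfl⟩ := exists_var_of_mem hT Γ a h
        exact ⟨s, .var w, by rw [codeTerm]⟩
      · obtain ⟨f', ts', rfl, n, q, rfl, Δ', s₁, rfl, rfl, g, hg, m, hm, t, d', rfl, rfl, h4⟩ := h2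
        obtain ⟨Δ, s, f, h5⟩ := exists_fn_of_pair_mem hg
        obtain ⟨Δ₁, ts, rfl⟩ := (ih ts' ((rank_lt_pair_right _ _).trans (rank_lt_pair_right _ _))).2
          _ _ h4
        rw [h5] at h ⊢
        obtain ⟨rfl, h6⟩ := ZFSet.pair_injective h5
        obtain ⟨rfl, rfl⟩ := ZFSet.pair_injective h6
        have h7 := ((codeTerms_mem_iff hU hS hT a ts
          (hU.pair_mem.1 (hU.pair_mem.1 (hk h)).2).2 _ _).1 h4).1
        obtain rfl := Naming.codeList_inj h7
        exact ⟨s, .app f ts, by rw [codeTerm]⟩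
      · exact absurd h2.1 (by simp)
    · intro s' d h
      obtain ⟨_, ⟨rfl, _⟩ | ⟨t, ts, rfl, s₁, Δ₁, rfl, d₁, d₂, rfl, h1, h2⟩⟩ := (terms_mem_iff hT).1 h
      · exact ⟨[], .nil, by rw [codeTerms]⟩
      · obtain ⟨s, t, rfl⟩ := (ih t (rank_lt_pair_left _ _)).1 _ _ h1
        obtain ⟨Δ, ts, rfl⟩ := (ih ts (rank_lt_pair_right _ _)).2 _ _ h2
        exact ⟨s :: Δ, .cons t ts, by rw [codeTerms]⟩

end

/-! ## The truth values of coded formulas -/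

theorem isTruth_one {P : Prop} : IsTruth (num.{u} 1) P ↔ P := by simp [IsTruth]

theorem isTruth_zero {P : Prop} : IsTruth (num.{u} 0) P ↔ ¬ P := by simp [IsTruth]

theorem isTruth_congr {b : ZFSet.{u}} {P Q : Prop} (h : P ↔ Q) : IsTruth b P ↔ IsTruth b Q := by
  rw [IsTruth, IsTruth, h]

theorem exists_isTruth (P : Prop) : ∃ b : ZFSet.{u}, (b = num 0 ∨ b = num 1) ∧ IsTruth b P := by
  by_cases h : P
  · exact ⟨num 1, Or.inr rfl, isTruth_one.2 h⟩
  · exact ⟨num 0, Or.inl rfl, isTruth_zero.2 h⟩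

theorem IsTruth.eq_num {b : ZFSet.{u}} {P : Prop} (h : IsTruth b P) : b = num 0 ∨ b = num 1 :=
  h.elim (fun h => Or.inr h.1) fun h => Or.inl h.1

theorem IsTruth.eq_one_iff {b : ZFSet.{u}} {P : Prop} (h : IsTruth b P) : b = num 1 ↔ P := by
  rcases h with ⟨rfl, h⟩ | ⟨rfl, h⟩ <;> simp [h]

theorem SetBij.card_eq {h X Y : ZFSet.{u}} (H : SetBij h X Y) : X.card = Y.card := by
  obtain ⟨H1, H2, H3⟩ := H
  choose! f hf hfh using H1
  choose! g hg hgh using H2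
  refine le_antisymm (card_le_of_injOn f hf fun a ha b hb hab => ?_)
    (card_le_of_injOn g hg fun a ha b hb hab => ?_)
  · exact (H3 a ha _ (hf a ha) (hfh a ha) b hb _ (hf b hb) (hfh b hb)).2 hab
  · exact (H3 _ (hg a ha) a ha (hgh a ha) _ (hg b hb) b hb (hgh b hb)).1 hab

theorem Cd.eq_of_card_eq {κ μ : ZFSet.{u}} (hκ : Cd κ) (hμ : Cd μ) (h : κ.card = μ.card) :
    κ = μ := by
  rcases hκ.1.mem_trichotomous hμ.1 with h1 | h1 | h1
  · exact absurd h (hμ.2 _ h1).ne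
  · exact h1
  · exact absurd h.symm (hκ.2 _ h1).ne

variable {τ : Voc.{u}} {ν : Naming τ} {M : Struct τ} {e : Elems M} {U₀ U T₂ T₃ x : ZFSet.{u}}

theorem quad_mem_iff {S R E : ZFSet.{u}}
    (hT : T₃ ⊆ U₀ ∧ ∀ u ∈ U₀, u ∈ T₃ ↔ ValClause U₀ U S R E (· ∈ T₃) u) {c q Γ a b : ZFSet.{u}} :
    quad (ZFSet.pair c q) Γ a b ∈ T₃ ↔ quad (ZFSet.pair c q) Γ a b ∈ U₀ ∧
      ((c = num 0 ∧ q = ∅ ∧ b = num 0) ∨ (c = num 1 ∧ EqClause U₀ E q Γ a b) ∨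
        (c = num 2 ∧ RelClause U₀ E R q Γ a b) ∨ (c = num 3 ∧ ImpClause U₀ (· ∈ T₃) q Γ a b) ∨
        (c = num 4 ∧ AllClause U S (· ∈ T₃) q Γ a b) ∨
        (c = num 5 ∧ HartigClause U S (· ∈ T₃) q Γ a b)) := by
  refine (and_iff_right_of_imp fun h => hT.1 h).symm.trans
    (and_congr_right fun h => (hT.2 _ h).trans ?_)
  constructor
  · rintro ⟨_, _, h1, _, _, h2, _, _, h3, _, _, h4, h⟩
    obtain ⟨rfl, rfl⟩ := ZFSet.pair_injective h1
    obtain ⟨rfl, rfl⟩ := ZFSet.pair_injective h2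
    obtain ⟨rfl, rfl⟩ := ZFSet.pair_injective h3
    obtain ⟨rfl, rfl⟩ := ZFSet.pair_injective h4
    exact h
  · exact fun h => ⟨_, _, rfl, _, _, rfl, _, _, rfl, _, _, rfl, h⟩

theorem falsum_mem_iff {S R E : ZFSet.{u}}
    (hT : T₃ ⊆ U₀ ∧ ∀ u ∈ U₀, u ∈ T₃ ↔ ValClause U₀ U S R E (· ∈ T₃) u) {q Γ a b : ZFSet.{u}} :
    quad (ZFSet.pair (num 0) q) Γ a b ∈ T₃ ↔ quad (ZFSet.pair (num 0) q) Γ a b ∈ U₀ ∧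
      (q = ∅ ∧ b = num 0) := by
  rw [quad_mem_iff hT]
  simp

theorem eq_mem_iff {S R E : ZFSet.{u}}
    (hT : T₃ ⊆ U₀ ∧ ∀ u ∈ U₀, u ∈ T₃ ↔ ValClause U₀ U S R E (· ∈ T₃) u) {q Γ a b : ZFSet.{u}} :
    quad (ZFSet.pair (num 1) q) Γ a b ∈ T₃ ↔ quad (ZFSet.pair (num 1) q) Γ a b ∈ U₀ ∧
      EqClause U₀ E q Γ a b := by
  rw [quad_mem_iff hT]
  simp

theorem rel_mem_iff {S R E : ZFSet.{u}}
    (hT : T₃ ⊆ U₀ ∧ ∀ u ∈ U₀, u ∈ T₃ ↔ ValClause U₀ U S R E (· ∈ T₃) u) {q Γ a b : ZFSet.{u}} :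
    quad (ZFSet.pair (num 2) q) Γ a b ∈ T₃ ↔ quad (ZFSet.pair (num 2) q) Γ a b ∈ U₀ ∧
      RelClause U₀ E R q Γ a b := by
  rw [quad_mem_iff hT]
  simp

theorem imp_mem_iff {S R E : ZFSet.{u}}
    (hT : T₃ ⊆ U₀ ∧ ∀ u ∈ U₀, u ∈ T₃ ↔ ValClause U₀ U S R E (· ∈ T₃) u) {q Γ a b : ZFSet.{u}} :
    quad (ZFSet.pair (num 3) q) Γ a b ∈ T₃ ↔ quad (ZFSet.pair (num 3) q) Γ a b ∈ U₀ ∧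
      ImpClause U₀ (· ∈ T₃) q Γ a b := by
  rw [quad_mem_iff hT]
  simp

theorem all_mem_iff {S R E : ZFSet.{u}}
    (hT : T₃ ⊆ U₀ ∧ ∀ u ∈ U₀, u ∈ T₃ ↔ ValClause U₀ U S R E (· ∈ T₃) u) {q Γ a b : ZFSet.{u}} :
    quad (ZFSet.pair (num 4) q) Γ a b ∈ T₃ ↔ quad (ZFSet.pair (num 4) q) Γ a b ∈ U₀ ∧
      AllClause U S (· ∈ T₃) q Γ a b := by
  rw [quad_mem_iff hT]
  simp

theorem hartig_mem_iff {S R E : ZFSet.{u}}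
    (hT : T₃ ⊆ U₀ ∧ ∀ u ∈ U₀, u ∈ T₃ ↔ ValClause U₀ U S R E (· ∈ T₃) u) {q Γ a b : ZFSet.{u}} :
    quad (ZFSet.pair (num 5) q) Γ a b ∈ T₃ ↔ quad (ZFSet.pair (num 5) q) Γ a b ∈ U₀ ∧
      HartigClause U S (· ∈ T₃) q Γ a b := by
  rw [quad_mem_iff hT]
  simp

theorem exists_pair_of_quad_mem {S R E : ZFSet.{u}}
    (hT : T₃ ⊆ U₀ ∧ ∀ u ∈ U₀, u ∈ T₃ ↔ ValClause U₀ U S R E (· ∈ T₃) u) {p Γ a b : ZFSet.{u}}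
    (h : quad p Γ a b ∈ T₃) : ∃ c q, p = ZFSet.pair c q := by
  obtain ⟨_, _, h1, _, _, h2, _, _, h3, c, q, h4, h⟩ := (hT.2 _ (hT.1 h)).1 h
  exact ⟨c, q, (ZFSet.pair_injective h1).1.trans h4⟩

/-- The set of the elements of a domain which satisfy `P`. -/
noncomputable def codeExtension (e : Elems M) (s : τ.sorts) (P : M.dom s → Prop) : ZFSet.{u} :=
  ZFSet.range fun y : {y : M.dom s // P y} => e.el s y.1

theorem el_mem_codeExtension {s : τ.sorts} {P : M.dom s → Prop} {y : M.dom s} :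
    e.el s y ∈ codeExtension e s P ↔ P y := by
  rw [codeExtension, ZFSet.mem_range]
  constructor
  · rintro ⟨y', h⟩
    exact e.el_inj _ h ▸ y'.2
  · exact fun h => ⟨⟨y, h⟩, rfl⟩

theorem codeExtension_subset {s : τ.sorts} {P : M.dom s → Prop} :
    codeExtension e s P ⊆ ZFSet.range (e.el s) := fun y hy => by
  obtain ⟨y, rfl⟩ := ZFSet.mem_range.1 hy
  exact ZFSet.mem_range.2 ⟨_, rfl⟩

theorem eq_codeExtension {s : τ.sorts} {P : M.dom s → Prop} {X : ZFSet.{u}}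
    (h1 : X ⊆ ZFSet.range (e.el s)) (h2 : ∀ y, e.el s y ∈ X ↔ P y) : X = codeExtension e s P := by
  ext d
  constructor
  · intro h
    obtain ⟨y, rfl⟩ := ZFSet.mem_range.1 (h1 h)
    rwa [el_mem_codeExtension, ← h2]
  · intro h
    obtain ⟨y, rfl⟩ := ZFSet.mem_range.1 (codeExtension_subset h)
    rwa [el_mem_codeExtension, ← h2] at h

theorem card_codeExtension {s : τ.sorts} {P : M.dom s → Prop} :
    (codeExtension e s P).card = #{y : M.dom s // P y} :=
  card_eq_of_family (f := fun y : {y : M.dom s // P y} => e.el s y.1)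
    (fun _ _ h => Subtype.ext (e.el_inj _ h)) fun y => by
      rw [codeExtension, ZFSet.mem_range]

theorem range_subset_codeExtension {s : τ.sorts} {P : M.dom s → Prop} :
    ZFSet.range (e.el s) ⊆ codeExtension e s P ↔ ∀ y, P y := by
  constructor
  · exact fun h y => el_mem_codeExtension.1 (h (ZFSet.mem_range.2 ⟨y, rfl⟩))
  · intro h d hd
    obtain ⟨y, rfl⟩ := ZFSet.mem_range.1 hd
    exact el_mem_codeExtension.2 (h y)

theorem isExtension_iff {s : τ.sorts} {P : M.dom s → Prop} {X nm p Γ a : ZFSet.{u}}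
    (h : ∀ y b, quad p (ZFSet.pair nm Γ) (ZFSet.pair (e.el s y) a) b ∈ T₃ ↔ IsTruth b (P y)) :
    IsExtension (· ∈ T₃) X (ZFSet.range (e.el s)) nm p Γ a ↔ X = codeExtension e s P := by
  constructor
  · rintro ⟨h1, h2⟩
    refine eq_codeExtension h1 fun y => ?_
    rcases h2 _ (ZFSet.mem_range.2 ⟨y, rfl⟩) with ⟨h3, h4⟩ | ⟨h3, h4⟩
    · exact iff_of_true h3 (isTruth_one.1 ((h _ _).1 h4))
    · exact iff_of_false h3 (isTruth_zero.1 ((h _ _).1 h4))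
  · rintro rfl
    refine ⟨codeExtension_subset, fun d hd => ?_⟩
    obtain ⟨y, rfl⟩ := ZFSet.mem_range.1 hd
    simp only [el_mem_codeExtension, h, isTruth_one, isTruth_zero, and_self]
    exact em _

theorem IsRich.codeExtension_mem (hR : IsRich U₀ U T₃) {s : τ.sorts} {P : M.dom s → Prop}
    {nm p Γ a : ZFSet.{u}} (hp : p ∈ U₀) (hΓ : Γ ∈ U₀) (ha : a ∈ U₀) (hnm : nm ∈ U₀)
    (hD : ZFSet.range (e.el s) ∈ U₀)
    (h : ∀ y b, quad p (ZFSet.pair nm Γ) (ZFSet.pair (e.el s y) a) b ∈ T₃ ↔ IsTruth b (P y)) :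
    codeExtension e s P ∈ U := by
  obtain ⟨X, hX, hX1, hX2⟩ := hR.1 p hp Γ hΓ a ha nm hnm _ hD
  rwa [← eq_codeExtension hX1 fun y => ?_]
  rw [hX2 _ (ZFSet.mem_range.2 ⟨y, rfl⟩), h, isTruth_one]

theorem codeFormula_mem_iff (hU : IsUniverse U₀ x) (hS : codeSorts ν M e ∈ U₀)
    (hR : IsRich U₀ U T₃)
    (hT₂ : T₂ ⊆ U₀ ∧ ∀ u ∈ U₀, u ∈ T₂ ↔ TermClause (codeFns ν M e) (· ∈ T₂) u)
    (hT₃ : T₃ ⊆ U₀ ∧ ∀ u ∈ U₀, u ∈ T₃ ↔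
      ValClause U₀ U (codeSorts ν M e) (codeRels ν M e) T₂ (· ∈ T₃) u)
    {Γ : List τ.sorts} (φ : Formula τ Γ) (hφ : codeFormula ν φ ∈ U₀) (a : Tup M.dom Γ)
    (b : ZFSet.{u}) :
    quad (codeFormula ν φ) (codeList (Γ.map ν.sort)) (codeTup e.el Γ a) b ∈ T₃ ↔
      IsTruth b (φ.Realize M a) := by
  have hb : ∀ {b : ZFSet.{u}} {P : Prop}, IsTruth b P → b ∈ U₀ := fun h => by
    rcases h.eq_num with rfl | rfl
    exacts [hU.2.2.2.1, hU.2.2.2.2]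
  have key : ∀ {Γ : List τ.sorts} {p b : ZFSet.{u}} {a : Tup M.dom Γ} {P : Prop}, p ∈ U₀ →
      IsTruth b P → quad p (codeList (Γ.map ν.sort)) (codeTup e.el Γ a) b ∈ U₀ := fun hp h => by
    simp only [hU.pair_mem, hp, hU.codeList_mem hS, hU.codeTup_mem hS, hb h, and_self]
  induction φ generalizing b with
  | falsum =>
    rw [codeFormula] at hφ ⊢
    rw [falsum_mem_iff hT₃, Formula.Realize]
    constructor
    · rintro ⟨_, _, rfl⟩
      exact isTruth_zero.2 id
    · intro h
      refine ⟨key hφ h, rfl, ?_⟩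
      simpa [IsTruth] using h
  | @eq Γ s t₁ t₂ =>
    rw [codeFormula] at hφ ⊢
    obtain ⟨-, ht⟩ := hU.pair_mem.1 hφ
    obtain ⟨ht₁, ht₂⟩ := hU.pair_mem.1 ht
    have h1 := codeTerm_mem_iff hU hS hT₂ a t₁ ht₁
    have h2 := codeTerm_mem_iff hU hS hT₂ a t₂ ht₂
    have h3 : e.el s (t₁.eval M a) = e.el s (t₂.eval M a) ↔ t₁.eval M a = t₂.eval M a :=
      (e.el_inj s).eq_iff
    rw [eq_mem_iff hT₃, Formula.Realize, ← isTruth_congr h3]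
    constructor
    · rintro ⟨_, t₁, t₂, h4, s', _, d₁, _, d₂, _, h5, h6, h7⟩
      obtain ⟨rfl, rfl⟩ := ZFSet.pair_injective h4
      obtain ⟨rfl, rfl⟩ := (h1 _ _).1 h5
      obtain ⟨-, rfl⟩ := (h2 _ _).1 h6
      exact h7
    · intro h
      exact ⟨key hφ h, _, _, rfl, _, hU.nm_mem hS s, _, hU.el_mem hS s _, _,
        hU.el_mem hS s _, (h1 _ _).2 ⟨rfl, rfl⟩, (h2 _ _).2 ⟨rfl, rfl⟩, h⟩
  | @rel Γ Δ r ts =>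
    rw [codeFormula] at hφ ⊢
    obtain ⟨-, ht⟩ := hU.pair_mem.1 hφ
    have h1 := codeTerms_mem_iff hU hS hT₂ a ts (hU.pair_mem.1 ht).2
    have h3 := codeTup_mem_codeRelGraph (e := e) r (ts.eval M a)
    rw [rel_mem_iff hT₃, Formula.Realize, ← isTruth_congr h3]
    constructor
    · rintro ⟨_, r', ts', h4, n, Δ', h5, I, hI, t, _, h6, h7⟩
      obtain ⟨rfl, rfl⟩ := ZFSet.pair_injective h4
      obtain rfl := (pair_mem_codeRels r).1 hI
      obtain ⟨rfl, rfl⟩ := (h1 _ _).1 h6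
      exact h7
    · intro h
      exact ⟨key hφ h, _, _, rfl, _, _, rfl, _, (pair_mem_codeRels r).2 rfl, _,
        hU.codeTup_mem hS _ _, (h1 _ _).2 ⟨rfl, rfl⟩, h⟩
  | imp φ ψ ih1 ih2 =>
    rw [codeFormula] at hφ ⊢
    obtain ⟨-, ht⟩ := hU.pair_mem.1 hφ
    replace ih1 := fun b => ih1 (hU.pair_mem.1 ht).1 a b
    replace ih2 := fun b => ih2 (hU.pair_mem.1 ht).2 a b
    rw [imp_mem_iff hT₃, Formula.Realize]
    constructor
    · rintro ⟨_, p₁, p₂, h4, b₁, _, b₂, _, h5, h6, h7⟩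
      obtain ⟨rfl, rfl⟩ := ZFSet.pair_injective h4
      rwa [((ih1 _).1 h5).eq_one_iff, ((ih2 _).1 h6).eq_one_iff] at h7
    · intro h
      obtain ⟨b₁, -, h1⟩ := exists_isTruth.{u} (φ.Realize M a)
      obtain ⟨b₂, -, h2⟩ := exists_isTruth.{u} (ψ.Realize M a)
      refine ⟨key hφ h, _, _, rfl, b₁, hb h1, b₂, hb h2, (ih1 _).2 h1, (ih2 _).2 h2, ?_⟩
      rwa [h1.eq_one_iff, h2.eq_one_iff]
  | @all Γ s φ ih =>
    rw [codeFormula] at hφ ⊢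
    obtain ⟨-, ht⟩ := hU.pair_mem.1 hφ
    obtain ⟨hs, hp⟩ := hU.pair_mem.1 ht
    replace ih : ∀ y b, quad (codeFormula ν φ) (ZFSet.pair (ν.sort s) (codeList (Γ.map ν.sort)))
        (ZFSet.pair (e.el s y) (codeTup e.el Γ a)) b ∈ T₃ ↔
          IsTruth b (φ.Realize M ((y, a) : M.dom s × Tup M.dom _)) :=
      fun y b => ih hp (y, a) b
    rw [all_mem_iff hT₃, Formula.Realize, ← isTruth_congr (range_subset_codeExtension (e := e)
      (P := fun y => φ.Realize M ((y, a) : M.dom s × Tup M.dom _)))]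
    constructor
    · rintro ⟨_, s', p', h1, D, hD, X, hX, h2, h3⟩
      obtain ⟨rfl, rfl⟩ := ZFSet.pair_injective h1
      obtain rfl := (nm_pair_mem_codeDomains ν.sort_inj).1 hD
      obtain rfl := (isExtension_iff ih).1 h2
      exact h3
    · intro h
      exact ⟨key hφ h, _, _, rfl, _, (nm_pair_mem_codeDomains ν.sort_inj).2 rfl, _,
        hR.codeExtension_mem hp (hU.codeList_mem hS _) (hU.codeTup_mem hS _ a) hs
          (hU.domain_mem hS s) ih, (isExtension_iff ih).2 rfl, h⟩
  | @hartig Γ s t φ ψ ih1 ih2 =>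
    rw [codeFormula] at hφ ⊢
    obtain ⟨-, ht⟩ := hU.pair_mem.1 hφ
    obtain ⟨ht1, ht2⟩ := hU.pair_mem.1 ht
    obtain ⟨hs, hp⟩ := hU.pair_mem.1 ht1
    obtain ⟨hs', hp'⟩ := hU.pair_mem.1 ht2
    replace ih1 : ∀ y b, quad (codeFormula ν φ) (ZFSet.pair (ν.sort s) (codeList (Γ.map ν.sort)))
        (ZFSet.pair (e.el s y) (codeTup e.el Γ a)) b ∈ T₃ ↔
          IsTruth b (φ.Realize M ((y, a) : M.dom s × Tup M.dom _)) :=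
      fun y b => ih1 hp (y, a) b
    replace ih2 : ∀ y b, quad (codeFormula ν ψ) (ZFSet.pair (ν.sort t) (codeList (Γ.map ν.sort)))
        (ZFSet.pair (e.el t y) (codeTup e.el Γ a)) b ∈ T₃ ↔
          IsTruth b (ψ.Realize M ((y, a) : M.dom t × Tup M.dom _)) :=
      fun y b => ih2 hp' (y, a) b
    rw [hartig_mem_iff hT₃, Formula.Realize]
    rw [← card_codeExtension (e := e) (P := fun y => φ.Realize M ((y, a) : M.dom s × Tup M.dom _)),
      ← card_codeExtension (e := e) (P := fun y => ψ.Realize M ((y, a) : M.dom t × Tup M.dom _))]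
    have hc : ∀ {κ μ h k X Y : ZFSet.{u}}, Cd κ → Cd μ → SetBij h X κ → SetBij k Y μ →
        (κ = μ ↔ X.card = Y.card) := fun hκ hμ hh hk => by
      rw [hh.card_eq, hk.card_eq]
      exact ⟨congrArg _, hκ.eq_of_card_eq hμ⟩
    constructor
    · rintro ⟨_, _, _, h1, s', p', rfl, s'', p'', rfl, D, hD, D', hD', X, hX, Y, hY, h2, h3, κ, hκ,
        μ, hμ, h, hh, k, hk, h4, h5, h6, h7, h8⟩
      obtain ⟨h9, h10⟩ := ZFSet.pair_injective h1
      obtain ⟨rfl, rfl⟩ := ZFSet.pair_injective h9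
      obtain ⟨rfl, rfl⟩ := ZFSet.pair_injective h10
      obtain rfl := (nm_pair_mem_codeDomains ν.sort_inj).1 hD
      obtain rfl := (nm_pair_mem_codeDomains ν.sort_inj).1 hD'
      obtain rfl := (isExtension_iff ih1).1 h2
      obtain rfl := (isExtension_iff ih2).1 h3
      exact (isTruth_congr (hc h4 h5 h6 h7)).1 h8
    · intro hv
      have hX := hR.codeExtension_mem hp (hU.codeList_mem hS _) (hU.codeTup_mem hS _ a) hs
          (hU.domain_mem hS s) ih1
      have hY := hR.codeExtension_mem hp' (hU.codeList_mem hS _) (hU.codeTup_mem hS _ a) hs'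
          (hU.domain_mem hS t) ih2
      obtain ⟨κ, hκ, h1, h, hh, h2⟩ := hR.2 _ hX _ (hU.domain_mem hS s) codeExtension_subset
      obtain ⟨μ, hμ, h3, k, hk, h4⟩ := hR.2 _ hY _ (hU.domain_mem hS t) codeExtension_subset
      exact ⟨key hφ hv, _, _, rfl, _, _, rfl, _, _, rfl, _,
        (nm_pair_mem_codeDomains ν.sort_inj).2 rfl, _,
        (nm_pair_mem_codeDomains ν.sort_inj).2 rfl, _, hX, _, hY, (isExtension_iff ih1).2 rfl,
        (isExtension_iff ih2).2 rfl, κ, hκ, μ, hμ, h, hh, k, hk, h1, h3, h2, h4,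
        (isTruth_congr (hc h1 h3 h2 h4)).2 hv⟩

theorem exists_formula_of_mem (hU : IsUniverse U₀ x) (hS : codeSorts ν M e ∈ U₀)
    (hT₂ : T₂ ⊆ U₀ ∧ ∀ u ∈ U₀, u ∈ T₂ ↔ TermClause (codeFns ν M e) (· ∈ T₂) u)
    (hT₃ : T₃ ⊆ U₀ ∧ ∀ u ∈ U₀, u ∈ T₃ ↔
      ValClause U₀ U (codeSorts ν M e) (codeRels ν M e) T₂ (· ∈ T₃) u) (p : ZFSet.{u}) :
    ∀ (Γ : List τ.sorts) (a : Tup M.dom Γ) (b : ZFSet.{u}),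
      quad p (codeList (Γ.map ν.sort)) (codeTup e.el Γ a) b ∈ T₃ →
      ∃ φ : Formula τ Γ, p = codeFormula ν φ := by
  induction p using WellFounded.induction (InvImage.wf ZFSet.rank Ordinal.lt_wf) with
  | h p ih =>
    intro Γ a b h
    have hext : ∀ {X nm D p' : ZFSet.{u}}, p'.rank < p.rank → ZFSet.pair nm D ∈ codeSorts ν M e →
        IsExtension (· ∈ T₃) X D nm p' (codeList (Γ.map ν.sort)) (codeTup e.el Γ a) →
        ∃ (s : τ.sorts) (φ : Formula τ (s :: Γ)), nm = ν.sort s ∧ p' = codeFormula ν φ := by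
      intro X nm D p' hp' hD h
      obtain ⟨s, rfl, rfl⟩ := pair_mem_codeDomains.1 hD
      obtain ⟨y⟩ := M.dom_nonempty s
      have : ∃ b, quad p' (ZFSet.pair (ν.sort s) (codeList (Γ.map ν.sort)))
          (ZFSet.pair (e.el s y) (codeTup e.el Γ a)) b ∈ T₃ := by
        rcases h.2 _ (ZFSet.mem_range.2 ⟨y, rfl⟩) with ⟨_, h⟩ | ⟨_, h⟩ <;> exact ⟨_, h⟩
      obtain ⟨b, hb⟩ := this
      obtain ⟨φ, hφ⟩ := ih p' hp' (s :: Γ) (y, a) b hb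
      exact ⟨s, φ, rfl, hφ⟩
    have hp : p ∈ U₀ := (hU.pair_mem.1 (hT₃.1 h)).1
    obtain ⟨c, q, rfl⟩ := exists_pair_of_quad_mem hT₃ h
    have hq : q ∈ U₀ := (hU.pair_mem.1 hp).2
    obtain ⟨rfl, rfl, _⟩ | ⟨rfl, h'⟩ | ⟨rfl, h'⟩ | ⟨rfl, h'⟩ | ⟨rfl, h'⟩ | ⟨rfl, h'⟩ :=
      ((quad_mem_iff hT₃).1 h).2
    · exact ⟨.falsum, by rw [codeFormula]⟩
    · obtain ⟨k₁, k₂, rfl, s', _, d₁, _, d₂, _, h5, h6, -⟩ := h'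
      obtain ⟨hk₁, hk₂⟩ := hU.pair_mem.1 hq
      obtain ⟨s₁, t₁, rfl⟩ := (exists_term_of_mem hU hS hT₂ a k₁).1 _ _ h5
      obtain ⟨s₂, t₂, rfl⟩ := (exists_term_of_mem hU hS hT₂ a k₂).1 _ _ h6
      have h7 := ((codeTerm_mem_iff hU hS hT₂ a t₁ hk₁ _ _).1 h5).1
      have h8 := ((codeTerm_mem_iff hU hS hT₂ a t₂ hk₂ _ _).1 h6).1
      obtain rfl := ν.sort_inj (h7.symm.trans h8)
      exact ⟨.eq t₁ t₂, by rw [codeFormula]⟩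
    · obtain ⟨r', ts', rfl, n, Δ', rfl, I, hI, t, _, h6, -⟩ := h'
      obtain ⟨Δ, r, hr⟩ := exists_rel_of_pair_mem hI
      obtain ⟨rfl, rfl⟩ := ZFSet.pair_injective hr
      obtain ⟨Δ₁, ts, rfl⟩ := (exists_term_of_mem hU hS hT₂ a ts').2 _ _ h6
      have h7 := ((codeTerms_mem_iff hU hS hT₂ a ts (hU.pair_mem.1 hq).2 _ _).1 h6).1
      obtain rfl := Naming.codeList_inj h7
      exact ⟨.rel r ts, by rw [codeFormula]; rfl⟩
    · obtain ⟨p₁, p₂, rfl, b₁, _, b₂, _, h5, h6, -⟩ := h'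
      obtain ⟨φ, rfl⟩ := ih p₁ ((rank_lt_pair_left _ _).trans (rank_lt_pair_right _ _)) Γ a _ h5
      obtain ⟨ψ, rfl⟩ := ih p₂ ((rank_lt_pair_right _ _).trans (rank_lt_pair_right _ _)) Γ a _ h6
      exact ⟨.imp φ ψ, by rw [codeFormula]⟩
    · obtain ⟨s', p', rfl, D, hD, X, hX, h2, -⟩ := h'
      obtain ⟨s, φ, rfl, rfl⟩ :=
        hext ((rank_lt_pair_right _ _).trans (rank_lt_pair_right _ _)) hD h2
      exact ⟨.all s φ, by rw [codeFormula]⟩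
    · obtain ⟨_, _, rfl, s', p', rfl, s'', p'', rfl, D, hD, D', hD', X, hX, Y, hY, h2, h3, -⟩ := h'
      obtain ⟨s, φ, rfl, rfl⟩ := hext ((rank_lt_pair_right _ _).trans ((rank_lt_pair_left _ _).trans
        (rank_lt_pair_right _ _))) hD h2
      obtain ⟨t, ψ, rfl, rfl⟩ := hext ((rank_lt_pair_right _ _).trans
        ((rank_lt_pair_right _ _).trans (rank_lt_pair_right _ _))) hD' h3
      exact ⟨.hartig s t φ ψ, by rw [codeFormula]⟩


/-! ## Recognising structures -/

theorem Tup.nonempty {S : Type u} {D : S → Type u} (h : ∀ s, Nonempty (D s)) (Δ : List S) :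
    Nonempty (Tup D Δ) := by
  induction Δ with
  | nil => exact ⟨PUnit.unit⟩
  | cons s Δ ih => exact ⟨((h s).some, ih.some)⟩

theorem setFunctional_range {ι : Type u} {a b : ι → ZFSet.{u}} (h : ∀ i j, a i = a j → b i = b j) :
    SetFunctional (ZFSet.range fun i => ZFSet.pair (a i) (b i)) := by
  intro m hm
  obtain ⟨i, rfl⟩ := ZFSet.mem_range.1 hm
  refine ⟨_, _, rfl, fun m' hm' => ?_⟩
  obtain ⟨j, rfl⟩ := ZFSet.mem_range.1 hm'
  exact ⟨_, _, rfl, h i j⟩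

theorem SetFunctional.eq {z a b b' : ZFSet.{u}} (h : SetFunctional z) (h1 : ZFSet.pair a b ∈ z)
    (h2 : ZFSet.pair a b' ∈ z) : b = b' := by
  obtain ⟨a₁, b₁, h3, h4⟩ := h _ h1
  obtain ⟨a₂, b₂, h5, h6⟩ := h4 _ h2
  obtain ⟨rfl, rfl⟩ := ZFSet.pair_injective h3
  obtain ⟨rfl, rfl⟩ := ZFSet.pair_injective h5
  exact h6 rfl

variable {τ : Voc.{u}} {ν : Naming τ} {M : Struct τ} {e : Elems M}
  {U₀ U S R G T₁ T₂ T₃ x p : ZFSet.{u}}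

theorem isStruct_codeStruct (hU : IsUniverse U₀ x) (hS : codeSorts ν M e ∈ U₀)
    (hT : T₁ ⊆ U₀ ∧ ∀ u ∈ U₀, u ∈ T₁ ↔ TupClause (codeSorts ν M e) (· ∈ T₁) u) :
    IsStruct U₀ (codeSorts ν M e) (codeRels ν M e) (codeFns ν M e) T₁ := by
  have h1 := tup_mem_iff hU ν.sort_inj hS hT
  have h2 : ∀ Δ : List τ.sorts, ∃ t ∈ U₀, ZFSet.pair (codeList (Δ.map ν.sort)) t ∈ T₁ := fun Δ => by
    obtain ⟨t⟩ := Tup.nonempty M.dom_nonempty Δ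
    exact ⟨_, hU.codeTup_mem hS Δ t, (h1 Δ _).2 ⟨t, rfl⟩⟩
  refine ⟨⟨setFunctional_range fun s s' h => ?_, fun m hm => ?_⟩,
    ⟨setFunctional_range fun r r' h => ?_, fun m hm => ?_⟩,
    ⟨setFunctional_range fun f f' h => ?_, fun m hm => ?_⟩⟩
  · rw [ν.sort_inj h]
  · obtain ⟨s, rfl⟩ := ZFSet.mem_range.1 hm
    obtain ⟨y⟩ := M.dom_nonempty s
    refine ⟨_, _, rfl, fun h => ?_⟩
    exact ZFSet.notMem_empty (e.el s y) (h ▸ ZFSet.mem_range.2 ⟨y, rfl⟩)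
  · refine (pair_mem_codeRels (ν := ν) (e := e) r'.2).1 ?_
    rw [← h, pair_mem_codeRels]
  · obtain ⟨⟨Δ, r⟩, rfl⟩ := ZFSet.mem_range.1 hm
    refine ⟨_, _, rfl, _, _, rfl, h2 _, fun t ht => (h1 _ _).2 ?_⟩
    obtain ⟨t, rfl⟩ := ZFSet.mem_range.1 ht
    exact ⟨t.1, rfl⟩
  · refine (pair_mem_codeFns (ν := ν) (e := e) f'.2).1 ?_
    rw [← h, pair_mem_codeFns]
  · obtain ⟨⟨⟨Δ, s⟩, f⟩, rfl⟩ := ZFSet.mem_range.1 hm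
    refine ⟨_, _, rfl, _, _, rfl, _, _, rfl, h2 _, _,
      (nm_pair_mem_codeDomains ν.sort_inj).2 rfl, setFunctional_range fun t t' h => ?_,
      fun w hw => ?_, fun t _ ht => ?_⟩
    · rw [codeTup_injective e.el_inj _ h]
    · obtain ⟨t, rfl⟩ := ZFSet.mem_range.1 hw
      exact ⟨_, _, rfl, (h1 _ _).2 ⟨t, rfl⟩, ZFSet.mem_range.2 ⟨_, rfl⟩⟩
    · obtain ⟨t, rfl⟩ := (h1 _ _).1 ht
      exact ⟨_, ZFSet.mem_range.2 ⟨t, rfl⟩, ZFSet.mem_range.2 ⟨_, rfl⟩⟩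

theorem IsStruct.exists_codeStruct (hU : IsUniverse U₀ x) (hS : S ∈ U₀)
    (hT : T₁ ⊆ U₀ ∧ ∀ u ∈ U₀, u ∈ T₁ ↔ TupClause S (· ∈ T₁) u) (h : IsStruct U₀ S R G T₁) :
    ∃ (τ : Voc.{u}) (ν : Naming τ) (M : Struct τ) (e : Elems M),
      S = codeSorts ν M e ∧ R = codeRels ν M e ∧ G = codeFns ν M e := by
  obtain ⟨⟨hS1, hS2⟩, ⟨hR1, hR2⟩, hG1, hG2⟩ := h
  obtain ⟨ι, f, hf, hfS, -⟩ := exists_family S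
  have hS3 : ∀ i, ∃ s D, f i = ZFSet.pair s D ∧ D ≠ ∅ := fun i => hS2 _ ((hfS _).2 ⟨i, rfl⟩)
  choose nm D hfi hD using hS3
  have hnm : Function.Injective nm := fun i j hij => by
    refine hf ?_
    have h1 : ZFSet.pair (nm i) (D i) ∈ S := hfi i ▸ (hfS _).2 ⟨i, rfl⟩
    have h2 : ZFSet.pair (nm j) (D j) ∈ S := hfi j ▸ (hfS _).2 ⟨j, rfl⟩
    rw [← hij] at h2
    rw [hfi, hfi, ← hij, hS1.eq h1 h2]
  have hDf := fun i => exists_family (D i)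
  choose dom el hel hDel _ using hDf
  have hDr : ∀ i, D i = ZFSet.range (el i) := fun i => by
    ext y
    rw [hDel, ZFSet.mem_range]
  obtain rfl : S = codeDomains nm el := by
    ext y
    rw [hfS, codeDomains, ZFSet.mem_range]
    simp only [hfi, hDr]
  have htup := tup_mem_iff hU hnm hS hT
  obtain ⟨ιR, r, hr, hrR, -⟩ := exists_family R
  have hR3 : ∀ i, ∃ (n : ZFSet.{u}) (Δ : List ι) (I : ZFSet.{u}),
      r i = ZFSet.pair (ZFSet.pair n (codeList (Δ.map nm))) I ∧
      ∀ t ∈ I, ∃ t', t = codeTup el Δ t' := fun i => by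
    obtain ⟨_, I, h1, n, Δ, rfl, ⟨t, _, ht⟩, h2⟩ := hR2 _ ((hrR _).2 ⟨i, rfl⟩)
    obtain ⟨Δ, rfl⟩ := exists_list_of_tup_mem hT ht
    exact ⟨n, Δ, I, h1, fun t ht => (htup _ _).1 (h2 t ht)⟩
  choose rn rΔ rI hri hrI using hR3
  obtain ⟨ιG, g, hg, hgG, -⟩ := exists_family G
  have hG3 : ∀ i, ∃ (n : ZFSet.{u}) (Δ : List ι) (s : ι) (I : ZFSet.{u}),
      g i = ZFSet.pair (ZFSet.pair n (ZFSet.pair (codeList (Δ.map nm)) (nm s))) I ∧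
      SetFunctional I ∧ (∀ w ∈ I, ∃ t d, w = ZFSet.pair (codeTup el Δ t) (el s d)) ∧
      ∀ t, ∃ d, ZFSet.pair (codeTup el Δ t) (el s d) ∈ I := fun i => by
    obtain ⟨_, I, h1, n, _, rfl, Δ, s, rfl, ⟨t, _, ht⟩, D', hD', h2, h3, h4⟩ :=
      hG2 _ ((hgG _).2 ⟨i, rfl⟩)
    obtain ⟨Δ, rfl⟩ := exists_list_of_tup_mem hT ht
    obtain ⟨s, rfl, rfl⟩ := pair_mem_codeDomains.1 hD'
    refine ⟨n, Δ, s, I, h1, h2, fun w hw => ?_, fun t => ?_⟩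
    · obtain ⟨t, d, rfl, h5, h6⟩ := h3 w hw
      obtain ⟨t, rfl⟩ := (htup _ _).1 h5
      obtain ⟨d, rfl⟩ := ZFSet.mem_range.1 h6
      exact ⟨t, d, rfl⟩
    · obtain ⟨d, h5, h6⟩ := h4 _ (hU.codeTup_mem hS Δ t) ((htup _ _).2 ⟨t, rfl⟩)
      obtain ⟨d, rfl⟩ := ZFSet.mem_range.1 h6
      exact ⟨d, h5⟩
  choose gn gΔ gs gI hgi hgf hgI hgt using hG3
  have hval : ∀ (Δ : List ι) (s : ι) (i : {i : ιG // gΔ i = Δ ∧ gs i = s}) (t : Tup dom Δ),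
      ∃ d, ZFSet.pair (codeTup el Δ t) (el s d) ∈ gI i.1 := by
    rintro _ _ ⟨i, rfl, rfl⟩ t
    exact hgt i t
  choose val hval using hval
  have hrn : ∀ i j, rn i = rn j → rΔ i = rΔ j → i = j := fun i j h h' => by
    have h1 : r i ∈ R := (hrR _).2 ⟨_, rfl⟩
    have h2 : r j ∈ R := (hrR _).2 ⟨_, rfl⟩
    rw [hri, h, h'] at h1
    rw [hri] at h2
    exact hr (by rw [hri, hri, h, h', hR1.eq h1 h2])
  have hgn : ∀ i j, gn i = gn j → gΔ i = gΔ j → gs i = gs j → i = j := fun i j h h' h'' => by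
    have h1 : g i ∈ G := (hgG _).2 ⟨_, rfl⟩
    have h2 : g j ∈ G := (hgG _).2 ⟨_, rfl⟩
    rw [hgi, h, h', h''] at h1
    rw [hgi] at h2
    exact hg (by rw [hgi, hgi, h, h', h'', hG1.eq h1 h2])
  let τ : Voc.{u} := ⟨ι, fun Δ => {i : ιR // rΔ i = Δ}, fun Δ s => {i : ιG // gΔ i = Δ ∧ gs i = s}⟩
  let ν : Naming τ :=
    { sort := nm
      rel := fun i => rn i.1
      fn := fun i => gn i.1
      sort_inj := hnm
      rel_inj := fun Δ i j hij => Subtype.ext (hrn _ _ hij (i.2.trans j.2.symm))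
      fn_inj := fun Δ s i j hij => Subtype.ext
        (hgn _ _ hij (i.2.1.trans j.2.1.symm) (i.2.2.trans j.2.2.symm)) }
  let M : Struct τ :=
    { dom := dom
      dom_nonempty := fun i => by
        obtain ⟨y, hy⟩ : ∃ y, y ∈ D i := by
          by_contra h
          exact hD i ((ZFSet.eq_empty _).2 fun y hy => h ⟨y, hy⟩)
        obtain ⟨d, -⟩ := (hDel i y).1 hy
        exact ⟨d⟩
      rel := fun {Δ} i t => codeTup el Δ t ∈ rI i.1
      fn := fun {Δ s} i t => val Δ s i t }
  refine ⟨τ, ν, M, ⟨el, hel⟩, rfl, ?_, ?_⟩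
  · ext y
    rw [hrR, codeRels, ZFSet.mem_range]
    have key : ∀ (Δ : List ι) (i : {i : ιR // rΔ i = Δ}),
        r i.1 = ZFSet.pair (ν.codeRel (Δ := Δ) i) (codeRelGraph M ⟨el, hel⟩ (Δ := Δ) i) := by
      rintro _ ⟨i, rfl⟩
      rw [hri]
      refine congrArg _ ?_
      ext t
      rw [codeRelGraph, ZFSet.mem_range]
      constructor
      · intro ht
        obtain ⟨t', rfl⟩ := hrI i t ht
        exact ⟨⟨t', ht⟩, rfl⟩
      · rintro ⟨t', rfl⟩
        exact t'.2
    constructor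
    · rintro ⟨i, rfl⟩
      exact ⟨⟨rΔ i, ⟨i, rfl⟩⟩, (key _ ⟨i, rfl⟩).symm⟩
    · rintro ⟨i, rfl⟩
      exact ⟨i.2.1, key _ i.2⟩
  · ext y
    rw [hgG, codeFns, ZFSet.mem_range]
    have key : ∀ (Δ : List ι) (s : ι) (i : {i : ιG // gΔ i = Δ ∧ gs i = s}),
        g i.1 = ZFSet.pair (ν.codeFn (Δ := Δ) (s := s) i)
          (codeFnGraph M ⟨el, hel⟩ (Δ := Δ) (s := s) i) := by
      rintro _ _ ⟨i, rfl, rfl⟩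
      rw [hgi]
      refine congrArg _ ?_
      ext w
      rw [codeFnGraph, ZFSet.mem_range]
      constructor
      · intro hw
        obtain ⟨t, d, rfl⟩ := hgI i w hw
        exact ⟨t, congrArg _ ((hgf i).eq (hval _ _ ⟨i, rfl, rfl⟩ t) hw)⟩
      · rintro ⟨t, rfl⟩
        exact hval _ _ ⟨i, rfl, rfl⟩ t
    constructor
    · rintro ⟨i, rfl⟩
      exact ⟨⟨(gΔ i, gs i), ⟨i, rfl, rfl⟩⟩, (key _ _ ⟨i, rfl, rfl⟩).symm⟩
    · rintro ⟨i, rfl⟩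
      exact ⟨i.2.1, key _ _ i.2⟩

theorem mem_satRel_iff (hx : x = ZFSet.pair (ZFSet.pair S (ZFSet.pair R G)) p)
    (hU : IsUniverse U₀ x) (hF : IsFixed U₀ U S R G T₁ T₂ T₃) (hR : IsRich U₀ U T₃) :
    x ∈ satRel LI ↔ IsStruct U₀ S R G T₁ ∧ quad p ∅ ∅ (num 1) ∈ T₃ := by
  have hx' := hU.2.2.1
  rw [hx, hU.pair_mem, hU.pair_mem] at hx'
  constructor
  · rintro ⟨τ, ν, M, e, φ, -, h1, h2⟩
    rw [hx, codeStruct_eq] at h2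
    obtain ⟨h3, rfl⟩ := ZFSet.pair_injective h2
    obtain ⟨rfl, h4⟩ := ZFSet.pair_injective h3
    obtain ⟨rfl, rfl⟩ := ZFSet.pair_injective h4
    refine ⟨isStruct_codeStruct hU hx'.1.1 hF.1, ?_⟩
    exact (codeFormula_mem_iff hU hx'.1.1 hR hF.2.1 hF.2.2 φ hx'.2 PUnit.unit (num 1)).2
      (isTruth_one.2 h1)
  · rintro ⟨h1, h2⟩
    obtain ⟨τ, ν, M, e, rfl, rfl, rfl⟩ := h1.exists_codeStruct hU hx'.1.1 hF.1
    obtain ⟨φ, rfl⟩ := exists_formula_of_mem hU hx'.1.1 hF.2.1 hF.2.2 p [] PUnit.unit (num 1) h2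
    refine ⟨τ, ν, M, e, φ, trivial, ?_, hx⟩
    exact isTruth_one.1 ((codeFormula_mem_iff hU hx'.1.1 hR hF.2.1 hF.2.2 φ hx'.2
      PUnit.unit (num 1)).1 h2)


/-! ## The satisfaction relation is `Δ₁` -/

section
variable {T T' : ZFSet.{u} → Prop}

theorem exists_fixed (U₀ : ZFSet.{u}) (C : (ZFSet.{u} → Prop) → ZFSet.{u} → Prop)
    (hC : ∀ T T' : ZFSet.{u} → Prop, (∀ u, T u → T' u) → ∀ u, C T u → C T' u) :
    ∃ T : ZFSet.{u}, T ⊆ U₀ ∧ ∀ u ∈ U₀, u ∈ T ↔ C (· ∈ T) u := by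
  let f : (ZFSet.{u} → Prop) →o (ZFSet.{u} → Prop) :=
    ⟨fun L u => u ∈ U₀ ∧ C L u, fun L L' h u hu => ⟨hu.1, hC L L' h u hu.2⟩⟩
  have hL : ∀ u, f.lfp u ↔ u ∈ U₀ ∧ C f.lfp u := fun u => iff_of_eq (congrFun f.map_lfp u).symm
  have hT : (· ∈ ZFSet.sep f.lfp U₀) = f.lfp := by
    funext u
    rw [ZFSet.mem_sep, eq_iff_iff]
    exact and_iff_right_of_imp fun h => ((hL u).1 h).1
  refine ⟨ZFSet.sep f.lfp U₀, ZFSet.sep_subset, fun u hu => ?_⟩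
  rw [hT]
  exact (iff_of_eq (congrFun hT u)).trans ((hL u).trans (and_iff_right hu))

theorem TupClause.mono {S u : ZFSet.{u}} (h : ∀ u, T u → T' u) (H : TupClause S T u) :
    TupClause S T' u := by
  obtain ⟨l, t, h1, h2 | ⟨s, l', h3, d, t', h4, h5, h6⟩⟩ := H
  · exact ⟨l, t, h1, Or.inl h2⟩
  · exact ⟨l, t, h1, Or.inr ⟨s, l', h3, d, t', h4, h5, h _ h6⟩⟩

theorem VarClause.mono {r Γ a s d : ZFSet.{u}} (h : ∀ u, T u → T' u) (H : VarClause T r Γ a s d) :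
    VarClause T' r Γ a s d := by
  obtain ⟨s', Γ', h1, d', a', h2, h3 | ⟨m, hm, h4, h5⟩⟩ := H
  · exact ⟨s', Γ', h1, d', a', h2, Or.inl h3⟩
  · exact ⟨s', Γ', h1, d', a', h2, Or.inr ⟨m, hm, h4, h _ h5⟩⟩

theorem AppClause.mono {G r Γ a s d : ZFSet.{u}} (h : ∀ u, T u → T' u)
    (H : AppClause G T r Γ a s d) : AppClause G T' r Γ a s d := by
  obtain ⟨f, ts, h1, n, q, h2, Δ, s', h3, h4, g, h5, m, h6, t, d', h7, h8, h9⟩ := H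
  exact ⟨f, ts, h1, n, q, h2, Δ, s', h3, h4, g, h5, m, h6, t, d', h7, h8, h _ h9⟩

theorem TermsClause.mono {k Γ a s d : ZFSet.{u}} (h : ∀ u, T u → T' u)
    (H : TermsClause T k Γ a s d) : TermsClause T' k Γ a s d := by
  obtain H | ⟨t, ts, h1, s₁, Δ, h2, d₁, d₂, h3, h4, h5⟩ := H
  · exact Or.inl H
  · exact Or.inr ⟨t, ts, h1, s₁, Δ, h2, d₁, d₂, h3, h _ h4, h _ h5⟩

theorem TermClause.mono {G u : ZFSet.{u}} (h : ∀ u, T u → T' u) (H : TermClause G T u) :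
    TermClause G T' u := by
  obtain ⟨i, u₁, h1, k, u₂, h2, Γ, u₃, h3, a, u₄, h4, s, d, h5, H⟩ := H
  refine ⟨i, u₁, h1, k, u₂, h2, Γ, u₃, h3, a, u₄, h4, s, d, h5, ?_⟩
  obtain ⟨h6, c, r, h7, ⟨h8, H⟩ | ⟨h8, H⟩⟩ | ⟨h6, H⟩ := H
  · exact Or.inl ⟨h6, c, r, h7, Or.inl ⟨h8, H.mono h⟩⟩
  · exact Or.inl ⟨h6, c, r, h7, Or.inr ⟨h8, H.mono h⟩⟩
  · exact Or.inr ⟨h6, H.mono h⟩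

theorem IsExtension.mono {X D s p Γ a : ZFSet.{u}} (h : ∀ u, T u → T' u)
    (H : IsExtension T X D s p Γ a) : IsExtension T' X D s p Γ a :=
  ⟨H.1, fun d hd => (H.2 d hd).imp (fun h' => ⟨h'.1, h _ h'.2⟩) fun h' => ⟨h'.1, h _ h'.2⟩⟩

theorem ValClause.mono {U₀ U S R E u : ZFSet.{u}} (h : ∀ u, T u → T' u)
    (H : ValClause U₀ U S R E T u) : ValClause U₀ U S R E T' u := by
  obtain ⟨p, u₁, h1, Γ, u₂, h2, a, b, h3, c, q, h4, H⟩ := H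
  refine ⟨p, u₁, h1, Γ, u₂, h2, a, b, h3, c, q, h4, ?_⟩
  refine H.imp_right (Or.imp_right (Or.imp_right (Or.imp ?_ (Or.imp ?_ ?_))))
  · rintro ⟨h5, p₁, p₂, h6, b₁, h7, b₂, h8, h9, h10, h11⟩
    exact ⟨h5, p₁, p₂, h6, b₁, h7, b₂, h8, h _ h9, h _ h10, h11⟩
  · rintro ⟨h5, s, p, h6, D, h7, X, h8, h9, h10⟩
    exact ⟨h5, s, p, h6, D, h7, X, h8, h9.mono h, h10⟩
  · rintro ⟨h5, q₁, q₂, h6, s, p, h7, s', p', h8, D, h9, D', h10, X, h11, Y, h12, h13, h14, h15⟩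
    exact ⟨h5, q₁, q₂, h6, s, p, h7, s', p', h8, D, h9, D', h10, X, h11, Y, h12, h13.mono h,
      h14.mono h, h15⟩

end

theorem exists_setBij {X Y : ZFSet.{u}} (h : X.card = Y.card) :
    ∃ k : ZFSet.{u}, SetBij k X Y ∧ ∀ m ∈ k, ∃ a ∈ X, ∃ b ∈ Y, m = ZFSet.pair a b := by
  obtain ⟨ι, f, hf, hX, hι⟩ := exists_family X
  obtain ⟨ι', g, hg, hY, hι'⟩ := exists_family Y
  obtain ⟨E⟩ := Cardinal.eq.1 ((hι.trans h).trans hι'.symm)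
  have hk : ∀ i j, ZFSet.pair (f i) (g j) ∈ ZFSet.range (fun i => ZFSet.pair (f i) (g (E i))) ↔
      j = E i := fun i j => by
    rw [ZFSet.mem_range]
    constructor
    · rintro ⟨i', h⟩
      obtain ⟨h1, h2⟩ := ZFSet.pair_injective h
      rw [← hf h1, hg h2]
    · rintro rfl
      exact ⟨i, rfl⟩
  refine ⟨ZFSet.range fun i => ZFSet.pair (f i) (g (E i)), ⟨fun a ha => ?_, fun b hb => ?_, ?_⟩,
    fun m hm => ?_⟩
  · obtain ⟨i, rfl⟩ := (hX a).1 ha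
    exact ⟨_, (hY _).2 ⟨E i, rfl⟩, (hk _ _).2 rfl⟩
  · obtain ⟨j, rfl⟩ := (hY b).1 hb
    exact ⟨_, (hX _).2 ⟨E.symm j, rfl⟩, (hk _ _).2 (E.apply_symm_apply j).symm⟩
  · intro a ha b hb h1 a' ha' b' hb' h2
    obtain ⟨i, rfl⟩ := (hX _).1 ha
    obtain ⟨i', rfl⟩ := (hX _).1 ha'
    obtain ⟨j, rfl⟩ := (hY _).1 hb
    obtain ⟨j', rfl⟩ := (hY _).1 hb'
    rw [hf.eq_iff, hg.eq_iff, (hk _ _).1 h1, (hk _ _).1 h2, E.injective.eq_iff]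
  · obtain ⟨i, rfl⟩ := ZFSet.mem_range.1 hm
    exact ⟨_, (hX _).2 ⟨i, rfl⟩, _, (hY _).2 ⟨_, rfl⟩, rfl⟩

theorem cd_ord_toZFSet (c : Cardinal.{u}) : Cd c.ord.toZFSet := by
  refine ⟨ZFSet.isOrdinal_toZFSet _, fun y hy => ?_⟩
  obtain ⟨a, ha, rfl⟩ := Ordinal.mem_toZFSet_iff.1 hy
  rw [Ordinal.card_toZFSet, Ordinal.card_toZFSet, card_ord]
  exact lt_ord.1 ha

theorem exists_universe (x S R G : ZFSet.{u}) :
    ∃ U₀ U T₁ T₂ T₃ : ZFSet.{u}, IsUniverse U₀ x ∧ IsFixed U₀ U S R G T₁ T₂ T₃ ∧ IsRich U₀ U T₃ ∧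
      hRank (ZFSet.pair U₀ (ZFSet.pair U (ZFSet.pair T₁ (ZFSet.pair T₂ T₃)))) ≤ 2 ^ hRank x := by
  have hκ := aleph0_le_hRank x
  obtain ⟨W, hWt, hzW, hWc, hWp⟩ := exists_pair_closure
    (z := insert x (trcl x) ∪ (hRank x).ord.toZFSet) hκ
    ((isTransitive_insert (trcl_isTransitive x) (subset_trcl x)).union
      (ZFSet.isOrdinal_toZFSet _).isTransitive)
    (card_union_le_of hκ (card_insert_le_of hκ (card_trcl_le_hRank x)) (by simp))
  have hxW : x ∈ W := hzW (by simp)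
  have hoW : ∀ o : Ordinal.{u}, o < (hRank x).ord → o.toZFSet ∈ W := fun o ho =>
    hzW (ZFSet.mem_union.2 (Or.inr (Ordinal.toZFSet_mem_toZFSet_iff.2 ho)))
  have hnW : ∀ n : ℕ, num n ∈ W := fun n => by
    rw [num_eq_toZFSet]
    refine hoW _ (lt_ord.2 ?_)
    rw [Ordinal.card_nat]
    exact (natCast_lt_aleph0).trans_le hκ
  obtain ⟨T₁, hT₁⟩ := exists_fixed W (TupClause S) fun _ _ h _ => TupClause.mono h
  obtain ⟨T₂, hT₂⟩ := exists_fixed W (TermClause G) fun _ _ h _ => TermClause.mono h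
  obtain ⟨T₃, hT₃⟩ := exists_fixed W (ValClause W W.powerset S R T₂) fun _ _ h _ => ValClause.mono h
  have hc := (cantor (hRank x)).le
  have hrW : ∀ T, T ⊆ W → hRank T ≤ 2 ^ hRank x := fun T hT =>
    (hRank_le hκ hWt hT hWc).trans hc
  refine ⟨W, W.powerset, T₁, T₂, T₃, ⟨hWt, hWp, hxW, hnW 0, hnW 1⟩, ⟨hT₁, hT₂, hT₃⟩,
    ⟨fun p _ Γ _ a _ s _ D hD => ?_, fun X hX D hD hXD => ?_⟩, ?_⟩
  · refine ⟨ZFSet.sep (fun d => quad p (ZFSet.pair s Γ) (ZFSet.pair d a) (num 1) ∈ T₃) D, ?_,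
      ZFSet.sep_subset, fun d hd => ?_⟩
    · exact ZFSet.mem_powerset.2 fun d hd => hWt _ hD (ZFSet.sep_subset hd)
    · rw [ZFSet.mem_sep, and_iff_right hd]
  · rw [ZFSet.mem_powerset] at hX
    have hκX : X.card.ord.toZFSet ⊆ W := fun y hy => by
      obtain ⟨o, ho, rfl⟩ := Ordinal.mem_toZFSet_iff.1 hy
      exact hoW o (ho.trans_le (ord_le_ord.2 ((ZFSet.card_mono hX).trans hWc)))
    obtain ⟨h, hh, hh'⟩ := exists_setBij (X := X) (Y := X.card.ord.toZFSet) (by simp)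
    refine ⟨_, ZFSet.mem_powerset.2 hκX, cd_ord_toZFSet _, h, ZFSet.mem_powerset.2 fun m hm => ?_, hh⟩
    obtain ⟨a, ha, b, hb, rfl⟩ := hh' m hm
    exact hWp _ (hX ha) _ (hκX hb)
  · refine hRank_pair (hrW _ fun _ h => h) (hRank_pair ?_ (hRank_pair (hrW _ hT₁.1)
      (hRank_pair (hrW _ hT₂.1) (hrW _ hT₃.1))))
    refine hRank_le (hκ.trans hc) hWt.powerset (fun _ h => h) ?_
    rw [ZFSet.card_powerset]
    exact power_le_power_left two_ne_zero hWc

/-- `x` codes a pair of a structure and a formula in some shape, and `y` codes a universe for it in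
which `P` holds. -/
def HasUniverse (P : ZFSet.{u} → ZFSet.{u} → ZFSet.{u} → ZFSet.{u} → ZFSet.{u} → ZFSet.{u} →
    ZFSet.{u} → Prop) (x y : ZFSet.{u}) : Prop :=
  ∃ A p, x = ZFSet.pair A p ∧ ∃ S q, A = ZFSet.pair S q ∧ ∃ R G, q = ZFSet.pair R G ∧
    ∃ U₀ z, y = ZFSet.pair U₀ z ∧ ∃ U z₁, z = ZFSet.pair U z₁ ∧ ∃ T₁ z₂, z₁ = ZFSet.pair T₁ z₂ ∧
      ∃ T₂ T₃, z₂ = ZFSet.pair T₂ T₃ ∧ (IsUniverse U₀ x ∧ IsFixed U₀ U S R G T₁ T₂ T₃ ∧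
        IsRich U₀ U T₃ ∧ P p U₀ S R G T₁ T₃)

/-- `x` is not of the form `((S, (R, G)), p)`. -/
def NotShaped (x : ZFSet.{u}) : Prop :=
  ¬ ∃ A p, x = ZFSet.pair A p ∧ ∃ S q, A = ZFSet.pair S q ∧ ∃ R G, q = ZFSet.pair R G ∧ True

theorem D0.true {n : ℕ} {R : ZFSet.{u} → Prop} : D0 R fun _ : Fin n → ZFSet.{u} => True :=
  (D0.imp .false .false).congr fun _ => by simp

theorem D0.satisfaction : D0 Cd fun v : Fin 2 → ZFSet.{u} =>
    HasUniverse (fun p U₀ S R G T₁ T₃ => IsStruct U₀ S R G T₁ ∧ quad p ∅ ∅ (num 1) ∈ T₃)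
      (v 0) (v 1) := by
  unfold HasUniverse
  apply_rules (maxDepth := 1000) (transparency := .reducible)
    [D0.and, D0.or, D0.not, D0.ball, D0.bex, D0.exPair, D0.exValue, D0.iff, D0.isTruth, D0.subset,
    D0.pred, D0.quad_mem, D0.mem, D0.eq, D0.imp, GD.num, GD.empty, GD.pair,
    GD.var, VD.head, VD.get, SD.tail, SD.id, D0.isUniverse, D0.isFixed, D0.isRich, D0.isStruct]

theorem D0.notSatisfaction : D0 Cd fun v : Fin 2 → ZFSet.{u} =>
    NotShaped (v 0) ∨
    HasUniverse (fun p U₀ S R G T₁ T₃ => ¬ (IsStruct U₀ S R G T₁ ∧ quad p ∅ ∅ (num 1) ∈ T₃))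
      (v 0) (v 1) := by
  unfold HasUniverse NotShaped
  apply_rules (maxDepth := 1000) (transparency := .reducible)
    [D0.and, D0.or, D0.not, D0.ball, D0.bex, D0.exPair, D0.exValue, D0.iff, D0.isTruth, D0.subset,
    D0.pred, D0.quad_mem, D0.mem, D0.eq, D0.imp, GD.num, GD.empty, GD.pair, D0.true,
    GD.var, VD.head, VD.get, SD.tail, SD.id, D0.isUniverse, D0.isFixed, D0.isRich, D0.isStruct]

theorem isDelta1_satRel {F : Cardinal.{u} → Cardinal.{u}} (hF : ∀ κ, ℵ₀ ≤ κ → 2 ^ κ ≤ F κ) :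
    IsDelta1 F Cd (satRel LI.{u}) := by
  have key : ∀ {x S R G p : ZFSet.{u}} {P : ZFSet.{u} → ZFSet.{u} → ZFSet.{u} → ZFSet.{u} →
      ZFSet.{u} → ZFSet.{u} → ZFSet.{u} → Prop},
      x = ZFSet.pair (ZFSet.pair S (ZFSet.pair R G)) p →
      (∀ U₀ U T₁ T₂ T₃, IsUniverse U₀ x → IsFixed U₀ U S R G T₁ T₂ T₃ → IsRich U₀ U T₃ →
        P p U₀ S R G T₁ T₃) →
      ∃ y, hRank y ≤ F (hRank x) ∧ HasUniverse P x y := by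
    intro x S R G p P hx H
    obtain ⟨U₀, U, T₁, T₂, T₃, h1, h2, h3, h4⟩ := exists_universe x S R G
    exact ⟨_, h4.trans (hF _ (aleph0_le_hRank x)), _, _, hx, _, _, rfl, _, _, rfl, _, _, rfl, _, _,
      rfl, _, _, rfl, _, _, rfl, h1, h2, h3, H _ _ _ _ _ h1 h2 h3⟩
  constructor
  · obtain ⟨ψ, hψ⟩ := D0.satisfaction.{u}
    have hbound : ∀ x ∈ satRel LI.{u}, ∃ y, hRank y ≤ F (hRank x) ∧ ψ.Realize Cd ![x, y] := by
      intro x hx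
      simp only [hψ]
      have hx' := hx
      obtain ⟨τ, ν, M, e, φ, -, -, h⟩ := hx
      exact key h fun U₀ U T₁ T₂ T₃ h1 h2 h3 => (mem_satRel_iff h h1 h2 h3).1 hx'
    refine ⟨ψ, fun x => ⟨fun hx => (hbound x hx).imp fun _ h => h.2, ?_⟩, hbound⟩
    rintro ⟨y, h⟩
    obtain ⟨_, p, h0, S, _, rfl, R, G, rfl, U₀, _, _, U, _, rfl, T₁, _, rfl, T₂, T₃, rfl, h1, h2,
      h3, h4⟩ := (hψ _).1 h
    exact (mem_satRel_iff h0 h1 h2 h3).2 h4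
  · obtain ⟨ψ, hψ⟩ := D0.notSatisfaction.{u}
    have hbound : ∀ x ∈ (satRel LI.{u})ᶜ, ∃ y, hRank y ≤ F (hRank x) ∧ ψ.Realize Cd ![x, y] := by
      intro x hx
      simp only [hψ]
      by_cases hs : NotShaped x
      · refine ⟨∅, (hRank_empty (aleph0_le_hRank x)).trans ?_, Or.inl hs⟩
        exact (cantor _).le.trans (hF _ (aleph0_le_hRank x))
      · obtain ⟨_, p, h, S, _, rfl, R, G, rfl, -⟩ := not_not.1 hs
        obtain ⟨y, h1, h2⟩ := key (P := fun p U₀ S R G T₁ T₃ =>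
          ¬ (IsStruct U₀ S R G T₁ ∧ quad p ∅ ∅ (num 1) ∈ T₃)) h
          fun U₀ U T₁ T₂ T₃ h1 h2 h3 h4 => hx ((mem_satRel_iff h h1 h2 h3).2 h4)
        exact ⟨y, h1, Or.inr h2⟩
    refine ⟨ψ, fun x => ⟨fun hx => (hbound x hx).imp fun _ h => h.2, ?_⟩, hbound⟩
    rintro ⟨y, h⟩ hx
    rcases (hψ _).1 h with h | h
    · obtain ⟨τ, ν, M, e, φ, -, -, h'⟩ := hx
      exact h ⟨_, _, h', _, _, rfl, _, _, rfl, trivial⟩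
    · obtain ⟨_, p, h0, S, _, rfl, R, G, rfl, U₀, _, _, U, _, rfl, T₁, _, rfl, T₂, T₃, rfl, h1, h2,
        h3, h4⟩ := h
      exact h4 ((mem_satRel_iff h0 h1 h2 h3).1 hx)


/-! ## Sets inside structures -/

theorem cd_iff {x : ZFSet.{u}} : Cd x ↔ ((∀ y ∈ x, ∀ z ∈ y, z ∈ x) ∧
    ∀ y ∈ x, ∀ z ∈ y, ∀ w ∈ z, w ∈ y) ∧ ∀ y ∈ x, ¬ y.card = x.card := by
  rw [Cd, ZFSet.isOrdinal_iff_forall_mem_isTransitive]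
  refine and_congr_right fun h => forall₂_congr fun y hy => ?_
  exact (ZFSet.card_mono (h.1 y hy)).lt_iff_ne

/-- The natural numbers are `Δ₀`-definable. -/
theorem exists_num_iff {x : ZFSet.{u}} : (∃ n, x = num n) ↔
    (x = ∅ ∨ ∃ m ∈ x, x = insert m m) ∧ ∀ y ∈ x, y = ∅ ∨ ∃ m ∈ y, y = insert m m := by
  constructor
  · have h1 : ∀ n, num.{u} n = ∅ ∨ ∃ m ∈ num n, num n = insert m m := fun n => by
      cases n with
      | zero => exact Or.inl rfl
      | succ n => exact Or.inr ⟨num n, ZFSet.mem_insert _ _, rfl⟩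
    have h2 : ∀ n, ∀ y ∈ num.{u} n, ∃ k, y = num k := fun n => by
      induction n with
      | zero => exact fun y hy => absurd hy (ZFSet.notMem_empty _)
      | succ n ih =>
        intro y hy
        rcases ZFSet.mem_insert_iff.1 hy with rfl | hy
        exacts [⟨n, rfl⟩, ih y hy]
    rintro ⟨n, rfl⟩
    refine ⟨h1 n, fun y hy => ?_⟩
    obtain ⟨k, rfl⟩ := h2 n y hy
    exact h1 k
  · induction x using ZFSet.inductionOn with
    | _ x ih =>
      rintro ⟨rfl | ⟨m, hm, hx⟩, h⟩
      · exact ⟨0, rfl⟩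
      · obtain ⟨n, rfl⟩ := ih m hm ⟨h m hm, fun y hy => h y (hx ▸ ZFSet.mem_insert_of_mem _ hy)⟩
        exact ⟨n + 1, hx⟩

theorem D0.exists_num {n : ℕ} {f : (Fin n → ZFSet.{u}) → ZFSet.{u}} (hf : VD f) :
    D0 Cd fun v => ∃ k, f v = num k := by
  obtain ⟨i, rfl⟩ := hf.eq_get
  simp only [exists_num_iff]
  apply_rules (maxDepth := 1000) (transparency := .reducible)
    [D0.and, D0.or, D0.ball, D0.bex, D0.succ, D0.eq, GD.empty, VD.head, VD.get, SD.tail, SD.id]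

section
variable {σ : Voc.{u}}

theorem TDef.subst {Γ Δ : List σ.sorts} {s : σ.sorts} {f : ∀ M : Struct σ, Tup M.dom Δ → M.dom s}
    (hf : TDef f) {g : ∀ M : Struct σ, Tup M.dom Γ → Tup M.dom Δ} (hg : VDef g) :
    TDef fun M a => f M (g M a) := by
  obtain ⟨t, ht⟩ := hf
  obtain ⟨ρ, hρ⟩ := hg
  exact ⟨t.rename ρ, fun M a => (Term.eval_rename M ρ (g M a) a (hρ M a) t).trans (ht M _)⟩

/-- In the structures of `G`, the map `π` interprets the elements of a sort as sets. -/
structure SetInterp (G : Struct σ → Prop) (V : σ.sorts)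
    (π : ∀ M : Struct σ, M.dom V → ZFSet.{u}) : Prop where
  def_mem : ∀ {Γ : List σ.sorts} {f g : ∀ M : Struct σ, Tup M.dom Γ → M.dom V}, TDef f → TDef g →
    Def G fun M a => π M (f M a) ∈ π M (g M a)
  inj : ∀ M, G M → Function.Injective (π M)
  trans : ∀ M, G M → ∀ b, ∀ z ∈ π M b, ∃ a, π M a = z

variable {G : Struct σ → Prop} {V : σ.sorts} {π : ∀ M : Struct σ, M.dom V → ZFSet.{u}}
  {Γ : List σ.sorts}

theorem SetInterp.def_cd (I : SetInterp G V π) {f : ∀ M : Struct σ, Tup M.dom Γ → M.dom V}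
    (hf : TDef f) : Def G fun M a => Cd (π M (f M a)) := by
  have h1 : ∀ {Δ : List σ.sorts} {g : ∀ M : Struct σ, Tup M.dom Δ → Tup M.dom Γ}, VDef g →
      TDef fun M a => f M (g M a) := fun hg => hf.subst hg
  have h2 : Def G fun M a => ((∀ y, π M y ∈ π M (f M a) → ∀ z, π M z ∈ π M y → π M z ∈ π M (f M a)) ∧
      ∀ y, π M y ∈ π M (f M a) → ∀ z, π M z ∈ π M y → ∀ w, π M w ∈ π M z → π M w ∈ π M y) ∧
      ∀ y, π M y ∈ π M (f M a) → ¬ #{w // π M w ∈ π M y} = #{w // π M w ∈ π M (f M a)} := by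
    apply_rules (maxDepth := 200) (transparency := .reducible) [Def.and, Def.all, Def.imp, Def.not,
      Def.false, Def.hartig, I.def_mem, h1, TDef.hd, VDef.tl, VDef.id]
  refine h2.congr fun M hM a => ?_
  have h3 : ∀ {y : M.dom V} {P : ZFSet.{u} → Prop}, (∀ z ∈ π M y, P z) ↔
      ∀ z, π M z ∈ π M y → P (π M z) := fun {y P} => by
    refine ⟨fun h z hz => h _ hz, fun h z hz => ?_⟩
    obtain ⟨w, rfl⟩ := I.trans M hM _ _ hz
    exact h w hz
  have h4 : ∀ y, (π M y).card = #{w // π M w ∈ π M y} := fun y =>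
    card_eq_of_family (f := fun w : {w // π M w ∈ π M y} => π M w.1)
      (fun _ _ h => Subtype.ext (I.inj M hM h)) fun z => by
        refine ⟨fun hz => ?_, ?_⟩
        · obtain ⟨w, rfl⟩ := I.trans M hM _ _ hz
          exact ⟨⟨w, hz⟩, rfl⟩
        · rintro ⟨w, rfl⟩
          exact w.2
  simp only [cd_iff, h3, h4]

theorem SetInterp.def_realize (I : SetInterp G V π) {n : ℕ} (φ : Delta0 n) :
    ∀ {Γ : List σ.sorts} {f : Fin n → ∀ M : Struct σ, Tup M.dom Γ → M.dom V},
      (∀ i, TDef (f i)) → Def G fun M a => φ.Realize Cd fun i => π M (f i M a) := by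
  induction φ with
  | falsum => exact fun _ => Def.false
  | mem i j => exact fun hf => I.def_mem (hf i) (hf j)
  | eq i j =>
    exact fun hf => (Def.eq (hf i) (hf j)).congr fun M hM a => (I.inj M hM).eq_iff
  | pred i => exact fun hf => I.def_cd (hf i)
  | imp φ ψ ih1 ih2 => exact fun hf => (ih1 hf).imp (ih2 hf)
  | ball i φ ih =>
    intro Γ f hf
    have hf' : ∀ j, TDef (fun (M : Struct σ) (b : Tup M.dom (V :: Γ)) =>
        (Fin.cons (Tup.hd b) (fun j => f j M (Tup.tl b)) : Fin (_ + 1) → M.dom V) j) := fun j => by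
      refine Fin.cases ?_ (fun j => ?_) j
      · exact TDef.hd .id
      · exact (hf j).subst (.tl .id)
    have h := ih (f := fun j M b =>
      (Fin.cons (Tup.hd b) (fun j => f j M (Tup.tl b)) : Fin (_ + 1) → M.dom V) j) hf'
    have h2 : Def G fun M a => ∀ z, π M z ∈ π M (f i M a) →
        φ.Realize Cd (fun j => π M
          ((Fin.cons z (fun j => f j M a) : Fin (_ + 1) → M.dom V) j)) :=
      Def.all ((I.def_mem (.hd .id) ((hf i).subst (.tl .id))).imp h)
    refine h2.congr fun M hM a => ?_
    have h3 : ∀ z, (fun j => π M ((Fin.cons z (fun j => f j M a) : Fin (_ + 1) → M.dom V) j)) =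
        Fin.cons (π M z) fun j => π M (f j M a) := fun z => by
      funext j
      refine Fin.cases rfl (fun j => rfl) j
    simp only [h3]
    refine ⟨fun h z hz => h _ hz, fun h z hz => ?_⟩
    obtain ⟨w, rfl⟩ := I.trans M hM _ _ hz
    exact h w hz

theorem SetInterp.def_delta0 (I : SetInterp G V π) {n : ℕ} {P : (Fin n → ZFSet.{u}) → Prop}
    (hP : D0 Cd P) {f : Fin n → ∀ M : Struct σ, Tup M.dom Γ → M.dom V} (hf : ∀ i, TDef (f i)) :
    Def G fun M a => P fun i => π M (f i M a) := by
  obtain ⟨φ, hφ⟩ := hP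
  exact (I.def_realize φ hf).congr fun M _ a => (hφ _).symm

/-- A set-valued function has a definable graph. -/
def SetDef (G : Struct σ → Prop) (V : σ.sorts) (π : ∀ M : Struct σ, M.dom V → ZFSet.{u})
    (f : ∀ M : Struct σ, Tup M.dom Γ → ZFSet.{u}) : Prop :=
  Def G (Γ := V :: Γ) fun M b => π M (Tup.hd b) = f M (Tup.tl b)

theorem SetDef.subst {f : ∀ M : Struct σ, Tup M.dom Γ → ZFSet.{u}} (hf : SetDef G V π f)
    {Δ : List σ.sorts} {g : ∀ M : Struct σ, Tup M.dom Δ → Tup M.dom Γ} (hg : VDef g) :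
    SetDef G V π fun M a => f M (g M a) := by
  have h : VDef (Γ := V :: Δ) (Δ := V :: Γ) fun (M : Struct σ) b =>
      ((Tup.hd b, g M (Tup.tl b)) : M.dom V × Tup M.dom Γ) := by
    obtain ⟨ρ, hρ⟩ := hg
    refine ⟨fun s v => match v with
      | .zero => .zero
      | .succ v => .succ (ρ _ v), fun M a s v => ?_⟩
    cases v with
    | zero => rfl
    | succ v => exact hρ M _ _ v
  exact Def.subst hf h

theorem SetDef.eq {f : ∀ M : Struct σ, Tup M.dom Γ → ZFSet.{u}} (hf : SetDef G V π f)
    {t : ∀ M : Struct σ, Tup M.dom Γ → M.dom V} (ht : TDef t) :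
    Def G fun M a => π M (t M a) = f M a :=
  (Def.ex (P := fun M a w => w = t M a ∧ π M w = f M a)
    ((Def.eq (.hd .id) (ht.subst (.tl .id))).and hf)).congr fun M _ a => by simp

theorem SetInterp.setDef_term (I : SetInterp G V π) {t : ∀ M : Struct σ, Tup M.dom Γ → M.dom V}
    (ht : TDef t) : SetDef G V π fun M a => π M (t M a) :=
  (Def.eq (.hd .id) (ht.subst (.tl .id))).congr fun M hM _ => (I.inj M hM).eq_iff

theorem SetInterp.setDef_pair (I : SetInterp G V π)
    {f g : ∀ M : Struct σ, Tup M.dom Γ → ZFSet.{u}} (hf : SetDef G V π f) (hg : SetDef G V π g) :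
    SetDef G V π fun M a => ZFSet.pair (f M a) (g M a) := by
  have h1 : Def G (Γ := V :: V :: V :: Γ) fun M b => π M (Tup.hd (Tup.tl (Tup.tl b))) =
      ZFSet.pair (π M (Tup.hd (Tup.tl b))) (π M (Tup.hd b)) :=
    I.def_delta0 (n := 3) (P := fun v => v 0 = ZFSet.pair (v 1) (v 2))
      (D0.eq_pair_var (.get .id 0) (.get .id 1) (.get .id 2))
      (f := ![fun M b => Tup.hd (Tup.tl (Tup.tl b)), fun M b => Tup.hd (Tup.tl b),
        fun M b => Tup.hd b]) (fun i => by
          fin_cases i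
          exacts [TDef.hd (.tl (.tl .id)), TDef.hd (.tl .id), TDef.hd .id])
  have h2 : Def G (Γ := V :: Γ) fun M b => ∃ x, π M x = f M (Tup.tl b) ∧
      ∃ y, π M y = g M (Tup.tl b) ∧ π M (Tup.hd b) = ZFSet.pair (π M x) (π M y) :=
    Def.ex (Def.and (hf.subst (.tl .id)) (Def.ex (Def.and (hg.subst (.tl (.tl .id))) h1)))
  refine h2.congr fun M hM b => ⟨fun h => ?_, ?_⟩
  · have hl := mem_pair_left (f M (Tup.tl b)) (g M (Tup.tl b))
    have hr := mem_pair_right (f M (Tup.tl b)) (g M (Tup.tl b))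
    dsimp only at h
    rw [← h] at hl hr
    obtain ⟨p, hp⟩ := I.trans M hM _ _ hl
    obtain ⟨q, hq⟩ := I.trans M hM _ _ hr
    obtain ⟨x, hx⟩ := I.trans M hM p (f M (Tup.tl b)) (by simp [hp])
    obtain ⟨y, hy⟩ := I.trans M hM q (g M (Tup.tl b)) (by simp [hq])
    exact ⟨x, hx, y, hy, by rw [hx, hy, h]⟩
  · rintro ⟨x, hx, y, hy, h⟩
    rw [h, hx, hy]

theorem SetInterp.setDef_num (I : SetInterp G V π) (n : ℕ) :
    SetDef G V π (Γ := Γ) fun _ _ => num n :=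
  I.def_delta0 (n := 1) (P := fun v => v 0 = num n) (D0.eq (.get .id 0) (.num n))
    (f := fun _ _ b => Tup.hd b) fun _ => .hd .id

theorem SetInterp.setDef_range (I : SetInterp G V π) {J : ∀ M : Struct σ, Tup M.dom Γ → Type u}
    {f : ∀ (M : Struct σ) (a : Tup M.dom Γ), J M a → ZFSet.{u}}
    (h1 : Def G (Γ := V :: Γ) fun M b => ∃ j, π M (Tup.hd b) = f M (Tup.tl b) j)
    (h2 : Def G fun M a => ∀ j, ∃ w, π M w = f M a j) :
    SetDef G V π fun M a => ZFSet.range (f M a) := by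
  have h3 : Def G (Γ := V :: V :: Γ) fun M b =>
      ∃ j, π M (Tup.hd b) = f M (Tup.tl (Tup.tl b)) j := by
    refine Def.subst h1 (g := fun M b => (Tup.hd b, Tup.tl (Tup.tl b))) ?_
    refine ⟨fun s v => match v with
      | .zero => .zero
      | .succ v => .succ (.succ v), fun M a s v => ?_⟩
    cases v <;> rfl
  have h4 : Def G (Γ := V :: Γ) fun M b => (∀ w, π M w ∈ π M (Tup.hd b) ↔
      ∃ j, π M w = f M (Tup.tl b) j) ∧ ∀ j, ∃ w, π M w = f M (Tup.tl b) j :=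
    (Def.all (Def.iff (I.def_mem (.hd .id) (.hd (.tl .id))) h3)).and (h2.subst (.tl .id))
  refine h4.congr fun M hM b => ⟨fun h => ?_, fun ⟨h5, h6⟩ => ?_⟩
  · rw [h]
    simp only [ZFSet.mem_range]
    refine ⟨fun w => exists_congr fun j => eq_comm, fun j => ?_⟩
    exact I.trans M hM (Tup.hd b) _ (h ▸ ZFSet.mem_range.2 ⟨j, rfl⟩)
  · ext z
    rw [ZFSet.mem_range]
    constructor
    · intro hz
      obtain ⟨w, rfl⟩ := I.trans M hM _ _ hz
      exact ((h5 w).1 hz).imp fun _ h => h.symm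
    · rintro ⟨j, rfl⟩
      obtain ⟨w, hw⟩ := h6 j
      rw [← hw, h5]
      exact ⟨j, hw⟩

/-- A tuple of elements is given by terms. -/
def TupDef {ι : Type u} (i : ι → σ.sorts) : (Δ : List ι) →
    (∀ M : Struct σ, Tup M.dom Γ → Tup (fun s => M.dom (i s)) Δ) → Prop
  | [], _ => True
  | _ :: Δ, t => TDef (fun M a => (t M a).1) ∧ TupDef i Δ fun M a => (t M a).2

variable {ι : Type u} {i : ι → σ.sorts}

theorem TupDef.tsDef : ∀ {Δ : List ι} {t : ∀ M : Struct σ, Tup M.dom Γ → Tup (fun s => M.dom (i s)) Δ},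
    TupDef i Δ t → TsDef fun M a => Tup.push i M.dom Δ (t M a)
  | [], _, _ => TsDef.nil
  | _ :: _, _, h => TsDef.cons h.1 (TupDef.tsDef h.2)

/-- Quantification over tuples of elements. -/
theorem Def.exTup {Δ : List ι} : ∀ {Γ : List σ.sorts}
    {Q : ∀ M : Struct σ, Tup (fun s => M.dom (i s)) Δ → Tup M.dom Γ → Prop}
    (_ : ∀ {Γ' : List σ.sorts} {g : ∀ M : Struct σ, Tup M.dom Γ' → Tup M.dom Γ}
      {t : ∀ M : Struct σ, Tup M.dom Γ' → Tup (fun s => M.dom (i s)) Δ}, VDef g → TupDef i Δ t →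
      Def G fun M a => Q M (t M a) (g M a)), Def G fun M a => ∃ t, Q M t a := by
  induction Δ with
  | nil =>
    intro Γ Q h
    refine (h (g := fun _ a => a) (t := fun _ _ => PUnit.unit) .id trivial).congr fun M _ a => ?_
    exact ⟨fun ⟨_, h⟩ => h, fun h => ⟨_, h⟩⟩
  | cons s Δ ih =>
    intro Γ Q h
    have h1 : Def G fun M a => ∃ y : M.dom (i s), ∃ t, Q M (y, t) a :=
      Def.ex (ih (Q := fun M t b => Q M (Tup.hd b, t) (Tup.tl b)) fun {Γ' g t} hg ht =>
        h (g := fun M a => Tup.tl (g M a)) (t := fun M a => (Tup.hd (g M a), t M a)) hg.tl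
          ⟨TDef.hd hg, ht⟩)
    refine h1.congr fun M _ a => ⟨fun ⟨t, h⟩ => ⟨t.1, t.2, h⟩, fun ⟨y, t, h⟩ => ⟨(y, t), h⟩⟩

end

/-! ## Coded structures inside structures -/

section
variable {τ σ : Voc.{u}}

/-- The set coding a structure, given by its components. -/
noncomputable def codeData (ν : Naming τ) {D : τ.sorts → Type u} (el : ∀ s, D s → ZFSet.{u})
    (rel : ∀ {Δ : List τ.sorts}, τ.rels Δ → Tup D Δ → Prop)
    (fn : ∀ {Δ : List τ.sorts} {s : τ.sorts}, τ.funs Δ s → Tup D Δ → D s) : ZFSet.{u} :=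
  ZFSet.pair (ZFSet.range fun s : τ.sorts => ZFSet.pair (ν.sort s) (ZFSet.range (el s)))
    (ZFSet.pair
      (ZFSet.range fun r : Σ Δ, τ.rels Δ =>
        ZFSet.pair (ν.codeRel r.2)
          (ZFSet.range fun t : {t : Tup D r.1 // rel r.2 t} => codeTup el r.1 t.1))
      (ZFSet.range fun f : Σ p : List τ.sorts × τ.sorts, τ.funs p.1 p.2 =>
        ZFSet.pair (ν.codeFn f.2)
          (ZFSet.range fun t : Tup D f.1.1 =>
            ZFSet.pair (codeTup el f.1.1 t) (el f.1.2 (fn f.2 t)))))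

variable {G : Struct σ → Prop} {V : σ.sorts} {π : ∀ M : Struct σ, M.dom V → ZFSet.{u}}
  {Γ : List σ.sorts} {i : Voc.Incl τ σ}

/-- The element of the sort `V` which stands for `y`. -/
def eltVal (elt : ∀ s, σ.funs [i.sort s] V) (M : Struct σ) (s : τ.sorts) (y : M.dom (i.sort s)) :
    M.dom V :=
  M.fn (elt s) ((y, PUnit.unit) : M.dom (i.sort s) × PUnit)

variable (elt : ∀ s, σ.funs [i.sort s] V)

theorem TDef.eltVal {s : τ.sorts} {f : ∀ M : Struct σ, Tup M.dom Γ → M.dom (i.sort s)}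
    (hf : TDef f) : TDef fun M a => BSymb.eltVal elt M s (f M a) :=
  TDef.fn (elt s) (TsDef.cons hf TsDef.nil)

theorem SetInterp.setDef_codeTup (I : SetInterp G V π) : ∀ {Δ : List τ.sorts}
    {t : ∀ M : Struct σ, Tup M.dom Γ → Tup (fun s => M.dom (i.sort s)) Δ}, TupDef i.sort Δ t →
    SetDef G V π fun M a => codeTup (fun s y => π M (eltVal elt M s y)) Δ (t M a)
  | [], _, _ => I.setDef_num 0
  | _ :: _, _, h => I.setDef_pair (I.setDef_term (h.1.eltVal elt)) (I.setDef_codeTup h.2)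

theorem SetInterp.setDef_codeList (I : SetInterp G V π) {l : List ZFSet.{u}}
    (hl : ∀ x ∈ l, ∃ n, x = num n) : SetDef G V π (Γ := Γ) fun _ _ => codeList l := by
  induction l with
  | nil => exact I.setDef_num 0
  | cons x l ih =>
    obtain ⟨n, hn⟩ := hl x (by simp)
    subst hn
    exact I.setDef_pair (I.setDef_num n) (ih fun x hx => hl x (by simp [hx]))

theorem SetInterp.setDef_of_num (I : SetInterp G V π) {x : ZFSet.{u}} (hx : ∃ n, x = num n) :
    SetDef G V π (Γ := Γ) fun _ _ => x := by
  obtain ⟨n, rfl⟩ := hx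
  exact I.setDef_num n

theorem SetInterp.setDef_sortRange (I : SetInterp G V π) (s : τ.sorts) :
    SetDef G V π (Γ := Γ) fun M _ => ZFSet.range fun y => π M (eltVal elt M s y) := by
  refine I.setDef_range (J := fun M _ => M.dom (i.sort s)) (Def.ex ?_) (Def.all (Def.ex ?_))
  · exact (I.setDef_term ((TDef.hd .id).eltVal elt)).eq (.hd (.tl .id))
  · exact (I.setDef_term ((TDef.hd (.tl .id)).eltVal elt)).eq (.hd .id)

theorem SetInterp.setDef_tupRange (I : SetInterp G V π) {Δ : List τ.sorts}
    {P : ∀ M : Struct σ, Tup (fun s => M.dom (i.sort s)) Δ → Prop}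
    {f : ∀ M : Struct σ, Tup (fun s => M.dom (i.sort s)) Δ → ZFSet.{u}}
    (hP : ∀ {Γ : List σ.sorts} {t : ∀ M : Struct σ, Tup M.dom Γ → Tup (fun s => M.dom (i.sort s)) Δ},
      TupDef i.sort Δ t → Def G fun M a => P M (t M a))
    (hf : ∀ {Γ : List σ.sorts} {t : ∀ M : Struct σ, Tup M.dom Γ → Tup (fun s => M.dom (i.sort s)) Δ},
      TupDef i.sort Δ t → SetDef G V π fun M a => f M (t M a)) :
    SetDef G V π (Γ := Γ) fun M _ => ZFSet.range fun t : {t // P M t} => f M t.1 := by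
  refine I.setDef_range (J := fun M _ => {t // P M t}) ?_ ?_
  · refine (Def.exTup (i := i.sort) (Δ := Δ)
      (Q := fun M t b => P M t ∧ π M (Tup.hd b) = f M t) fun hg ht => ?_).congr fun M _ a => ?_
    · exact (hP ht).and ((hf ht).eq (.hd hg))
    · exact ⟨fun ⟨j, h⟩ => ⟨j.1, j.2, h⟩, fun ⟨t, h1, h2⟩ => ⟨⟨t, h1⟩, h2⟩⟩
  · refine (Def.not (Def.exTup (i := i.sort) (Δ := Δ)
      (Q := fun M t _ => P M t ∧ ¬ ∃ w, π M w = f M t) fun hg ht => ?_)).congr fun M _ a => ?_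
    · exact (hP ht).and (Def.not (Def.ex (hf ht)))
    · simp

theorem SetInterp.setDef_finRange (I : SetInterp G V π) {κ : Type u} [Finite κ]
    {f : κ → ∀ M : Struct σ, Tup M.dom Γ → ZFSet.{u}} (hf : ∀ k, SetDef G V π (f k)) :
    SetDef G V π fun M a => ZFSet.range fun k => f k M a := by
  refine I.setDef_range (J := fun _ _ => κ) (Def.exists_finite fun k => ?_)
    (Def.forall_finite fun k => Def.ex (hf k))
  exact hf k

theorem SetInterp.setDef_codeData (I : SetInterp G V π) (hτ : τ.IsFinite) {ν : Naming τ}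
    (hν : ν.IsNatural) : SetDef G V π (Γ := Γ) fun M _ =>
      codeData ν (D := (M.reduct i).dom) (fun s y => π M (eltVal elt M s y))
        (M.reduct i).rel (M.reduct i).fn := by
  obtain ⟨h1, h2, h3⟩ := hτ
  have hl : ∀ {Γ : List σ.sorts} (Δ : List τ.sorts),
      SetDef G V π (Γ := Γ) fun _ _ => codeList (Δ.map ν.sort) := fun Δ =>
    I.setDef_codeList fun x hx => by
      obtain ⟨s, _, rfl⟩ := List.mem_map.1 hx
      exact hν.1 s
  refine I.setDef_pair (I.setDef_finRange fun s =>
    I.setDef_pair (I.setDef_of_num (hν.1 s)) (I.setDef_sortRange elt s)) (I.setDef_pair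
      (I.setDef_finRange fun r => I.setDef_pair (I.setDef_pair (I.setDef_of_num (hν.2.1 _ r.2))
        (hl r.1)) ?_)
      (I.setDef_finRange fun f => I.setDef_pair (I.setDef_pair (I.setDef_of_num (hν.2.2 _ _ f.2))
        (I.setDef_pair (hl f.1.1) (I.setDef_of_num (hν.1 f.1.2)))) ?_))
  · exact I.setDef_tupRange (i := i) (P := fun M t => (M.reduct i).rel r.2 t)
      (f := fun M t => codeTup (fun s y => π M (eltVal elt M s y)) r.1 t)
      (fun ht => Def.rel (i.rel r.2) ht.tsDef) fun ht => I.setDef_codeTup elt ht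
  · have h := I.setDef_tupRange (Γ := Γ) (i := i) (Δ := f.1.1) (P := fun _ _ => True)
      (f := fun M t => ZFSet.pair (codeTup (fun s y => π M (eltVal elt M s y)) f.1.1 t)
        (π M (eltVal elt M f.1.2 ((M.reduct i).fn f.2 t)))) (fun _ => Def.true) fun ht =>
      I.setDef_pair (I.setDef_codeTup elt ht) (I.setDef_term
        (TDef.eltVal elt (TDef.fn (i.fn f.2) ht.tsDef)))
    refine Def.congr h fun M _ b => ?_
    refine iff_of_eq (congrArg _ ?_)
    ext z
    simp only [ZFSet.mem_range]
    exact ⟨fun ⟨t, h⟩ => ⟨⟨t, trivial⟩, h⟩, fun ⟨t, h⟩ => ⟨t.1, h⟩⟩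

end

/-! ## The Mostowski collapse -/

section
variable {V : Type u} {r : V → V → Prop}

open Classical in
/-- The Mostowski collapse of a well-founded relation. -/
noncomputable def collapse (r : V → V → Prop) : V → ZFSet.{u} :=
  if h : WellFounded r then
    h.fix fun v F => ZFSet.range fun w : {w // r w v} => F w.1 w.2
  else fun _ => ∅

theorem mem_collapse (h : WellFounded r) {v : V} {z : ZFSet.{u}} :
    z ∈ collapse r v ↔ ∃ w, r w v ∧ collapse r w = z := by
  have h1 : collapse r v = ZFSet.range fun w : {w // r w v} => collapse r w.1 := by
    simp only [collapse, dif_pos h]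
    rw [h.fix_eq]
  rw [h1, ZFSet.mem_range]
  exact ⟨fun ⟨w, hw⟩ => ⟨w.1, w.2, hw⟩, fun ⟨w, hw, hz⟩ => ⟨⟨w, hw⟩, hz⟩⟩

theorem collapse_injective (h : WellFounded r) (hext : ∀ v w, (∀ z, r z v ↔ r z w) → v = w) :
    Function.Injective (collapse r) := by
  intro v
  induction v using h.induction with
  | _ v ih =>
    intro w hvw
    refine hext v w fun z => ⟨fun hz => ?_, fun hz => ?_⟩
    · obtain ⟨z', hz', he⟩ := (mem_collapse h).1 (hvw ▸ (mem_collapse h).2 ⟨z, hz, rfl⟩)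
      rwa [ih z hz he.symm]
    · obtain ⟨z', hz', he⟩ := (mem_collapse h).1 (hvw.symm ▸ (mem_collapse h).2 ⟨z, hz, rfl⟩)
      rwa [← ih z' hz' he]

theorem collapse_mem_iff (h : WellFounded r) (hext : ∀ v w, (∀ z, r z v ↔ r z w) → v = w)
    {v w : V} : collapse r v ∈ collapse r w ↔ r v w := by
  rw [mem_collapse h]
  exact ⟨fun ⟨z, hz, he⟩ => collapse_injective h hext he ▸ hz, fun hv => ⟨v, hv, rfl⟩⟩

theorem wellFounded_of_iff_mem {f : V → ZFSet.{u}} (hr : ∀ v w, r v w ↔ f v ∈ f w) :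
    WellFounded r :=
  Subrelation.wf (r := InvImage (· ∈ ·) f) (fun {v w} h => (hr v w).1 h)
    (InvImage.wf f ZFSet.mem_wf)

theorem collapse_eq {f : V → ZFSet.{u}} (hr : ∀ v w, r v w ↔ f v ∈ f w)
    (hf : ∀ v, ∀ z ∈ f v, ∃ w, f w = z) : collapse r = f := by
  have h := wellFounded_of_iff_mem hr
  funext v
  induction v using h.induction with
  | _ v ih =>
    ext z
    rw [mem_collapse h]
    constructor
    · rintro ⟨w, hw, rfl⟩
      rw [ih w hw]
      exact (hr w v).1 hw
    · intro hz
      obtain ⟨w, rfl⟩ := hf v z hz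
      exact ⟨w, (hr w v).2 hz, ih w ((hr w v).2 hz)⟩

end

/-! ## The vocabulary for sets over a structure -/

section
variable (τ τ' : Voc.{u}) (sA sB : τ'.sorts)

/-- The sorts of two vocabularies, a sort of sets and a sort for its labelling. -/
inductive SetSort : Type u
  | orig (s : τ.sorts)
  | aux (s : τ'.sorts)
  | V
  | O

/-- The relation symbols of two vocabularies, membership, and the order of the labels. -/
inductive SetRel : List (SetSort τ τ') → Type u
  | orig {Δ : List τ.sorts} (r : τ.rels Δ) : SetRel (Δ.map .orig)
  | aux {Δ : List τ'.sorts} (r : τ'.rels Δ) : SetRel (Δ.map .aux)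
  | mem : SetRel [.V, .V]
  | lt : SetRel [.O, .O]

/-- The function symbols of two vocabularies, the labelling of sets, the embeddings of the sorts of
the first vocabulary into the sets, two maps from sorts of the second vocabulary to the sets, and
two constants for sets. -/
inductive SetFun : List (SetSort τ τ') → SetSort τ τ' → Type u
  | orig {Δ : List τ.sorts} {s : τ.sorts} (f : τ.funs Δ s) : SetFun (Δ.map .orig) (.orig s)
  | aux {Δ : List τ'.sorts} {s : τ'.sorts} (f : τ'.funs Δ s) : SetFun (Δ.map .aux) (.aux s)
  | label : SetFun [.V] .O
  | elt (s : τ.sorts) : SetFun [.orig s] .V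
  | fromA : SetFun [.aux sA] .V
  | fromB : SetFun [.aux sB] .V
  | x : SetFun [] .V
  | y : SetFun [] .V

/-- The vocabulary for sets over a structure. -/
def setVoc : Voc.{u} where
  sorts := SetSort τ τ'
  rels := SetRel τ τ'
  funs := SetFun τ τ' sA sB

variable {τ τ' sA sB}

/-- The symbol of the first vocabulary. -/
def SetRel.origSymb {Δ : List (SetSort τ τ')} : SetRel τ τ' Δ → Option (Σ Δ, τ.rels Δ)
  | .orig r => some ⟨_, r⟩
  | _ => none

/-- The symbol of the second vocabulary. -/
def SetRel.auxSymb {Δ : List (SetSort τ τ')} : SetRel τ τ' Δ → Option (Σ Δ, τ'.rels Δ)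
  | .aux r => some ⟨_, r⟩
  | _ => none

/-- The symbol of the first vocabulary. -/
def SetFun.origSymb {Δ : List (SetSort τ τ')} {s : SetSort τ τ'} :
    SetFun τ τ' sA sB Δ s → Option (Σ p : List τ.sorts × τ.sorts, τ.funs p.1 p.2)
  | .orig f => some ⟨(_, _), f⟩
  | _ => none

/-- The symbol of the second vocabulary. -/
def SetFun.auxSymb {Δ : List (SetSort τ τ')} {s : SetSort τ τ'} :
    SetFun τ τ' sA sB Δ s → Option (Σ p : List τ'.sorts × τ'.sorts, τ'.funs p.1 p.2)
  | .aux f => some ⟨(_, _), f⟩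
  | _ => none

variable (τ τ' sA sB)

/-- The first vocabulary as a part of the vocabulary for sets. -/
def origIncl : Voc.Incl τ (setVoc τ τ' sA sB) where
  sort := .orig
  rel := .orig
  fn := .orig
  sort_inj := fun a b h => by cases h; rfl
  rel_inj := fun Δ r r' h => by
    simpa [SetRel.origSymb] using congrArg SetRel.origSymb h
  fn_inj := fun Δ s f f' h => by
    simpa [SetFun.origSymb] using congrArg SetFun.origSymb h

/-- The second vocabulary as a part of the vocabulary for sets. -/
def auxIncl : Voc.Incl τ' (setVoc τ τ' sA sB) where
  sort := .aux
  rel := .aux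
  fn := .aux
  sort_inj := fun a b h => by cases h; rfl
  rel_inj := fun Δ r r' h => by
    simpa [SetRel.auxSymb] using congrArg SetRel.auxSymb h
  fn_inj := fun Δ s f f' h => by
    simpa [SetFun.auxSymb] using congrArg SetFun.auxSymb h

/-- The vocabulary of labelled relations as a part of the vocabulary for sets. -/
def labelIncl : Voc.Incl orderVoc (setVoc τ τ' sA sB) where
  sort := fun s => match s with
    | WSort.A => .V
    | WSort.B => .O
  rel := fun r => match r with
    | WRel.E => .mem
    | WRel.lt => .lt
  fn := fun c => match c with
    | WFun.f => .label
  sort_inj := fun a b h => by cases a <;> cases b <;> first | rfl | cases h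
  rel_inj := fun Δ r r' _ => by cases r <;> cases r' <;> rfl
  fn_inj := fun Δ s c c' _ => by cases c; cases c'; rfl

variable {τ τ' sA sB} (B : Struct (setVoc τ τ' sA sB))

/-- The domain of the sets. -/
abbrev setDom : Type u := B.dom SetSort.V

/-- Membership. -/
def setMem (v w : setDom B) : Prop :=
  B.rel (Δ := [SetSort.V, SetSort.V]) SetRel.mem (v, w, PUnit.unit)

/-- The sets named by the elements of the sort of sets. -/
noncomputable def setPi : setDom B → ZFSet.{u} := collapse (setMem B)

/-- The map from the elements of the structure to the sets. -/
def setElt (s : τ.sorts) : (setVoc τ τ' sA sB).funs [(origIncl τ τ' sA sB).sort s] SetSort.V :=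
  SetFun.elt s

/-- The structure `B` consists of sets over its part in the first vocabulary, labelled, with an
auxiliary part which bounds their number; its constants satisfy the formula `ψ`, and the first one
codes the structure. -/
structure IsSetModel (ν : Naming τ) (χ : Sentence τ') (ψ : Delta0 2) : Prop where
  aux : (B.reduct (auxIncl τ τ' sA sB)).Sat χ
  label : (CardLabel (orderE (B.reduct (labelIncl τ τ' sA sB)))
    (orderLt (B.reduct (labelIncl τ τ' sA sB))) (orderF (B.reduct (labelIncl τ τ' sA sB))))
  ext : ∀ v w, (∀ z, setMem B z v ↔ setMem B z w) → v = w
  elt_inj : ∀ (s : τ.sorts) (y y' : B.dom ((origIncl τ τ' sA sB).sort s)),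
    eltVal (i := origIncl τ τ' sA sB) setElt B s y = eltVal (i := origIncl τ τ' sA sB) setElt B s y' →
      y = y'
  card : #{_a : B.dom (SetSort.aux sA) // True} = #{v : setDom B // (∃ n, setPi B v = num n) ∨
    ∃ s y, v = eltVal (i := origIncl τ τ' sA sB) setElt B s y}
  cover : ∀ v : setDom B,
    (∃ a : B.dom (SetSort.aux sA), B.fn (Δ := [SetSort.aux sA]) SetFun.fromA (a, PUnit.unit) = v) ∨
    ∃ b : B.dom (SetSort.aux sB), B.fn (Δ := [SetSort.aux sB]) SetFun.fromB (b, PUnit.unit) = v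
  code : setPi B (B.fn (Δ := []) SetFun.x PUnit.unit) =
    codeData ν (D := (B.reduct (origIncl τ τ' sA sB)).dom)
      (fun s y => setPi B (eltVal (i := origIncl τ τ' sA sB) setElt B s y))
      (B.reduct (origIncl τ τ' sA sB)).rel (B.reduct (origIncl τ τ' sA sB)).fn
  realize : ψ.Realize Cd
    ![setPi B (B.fn (Δ := []) SetFun.x PUnit.unit), setPi B (B.fn (Δ := []) SetFun.y PUnit.unit)]

theorem Def.and_of_imp {σ : Voc.{u}} {G : Struct σ → Prop} {Γ : List σ.sorts}
    {P Q : ∀ M : Struct σ, Tup M.dom Γ → Prop} (hP : Def (fun _ => True) P)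
    (h : ∀ M a, P M a → G M) (hQ : Def G Q) : Def (fun _ => True) fun M a => P M a ∧ Q M a := by
  obtain ⟨φ, hφ⟩ := hP
  obtain ⟨ψ, hψ⟩ := hQ
  refine ⟨.imp (.imp φ (.imp ψ .falsum)) .falsum, fun M _ a => ?_⟩
  simp only [Formula.Realize, hφ M trivial]
  by_cases hPM : P M a
  · simp only [hψ M (h M a hPM)]
    tauto
  · tauto

theorem def_setMem {G : Struct (setVoc τ τ' sA sB) → Prop} {Γ : List (setVoc τ τ' sA sB).sorts}
    {f g : ∀ M : Struct (setVoc τ τ' sA sB), Tup M.dom Γ → M.dom SetSort.V}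
    (hf : TDef f) (hg : TDef g) : Def G fun M a => setMem M (f M a) (g M a) :=
  Def.rel (τ := setVoc τ τ' sA sB) (Δ := [SetSort.V, SetSort.V]) SetRel.mem
    (TsDef.cons hf (TsDef.cons hg TsDef.nil))

theorem setInterp : SetInterp
    (fun B : Struct (setVoc τ τ' sA sB) => WellFounded (setMem B) ∧
      ∀ v w, (∀ z, setMem B z v ↔ setMem B z w) → v = w) SetSort.V setPi where
  def_mem := fun hf hg => (def_setMem hf hg).congr fun B hB a => collapse_mem_iff hB.1 hB.2
  inj := fun B hB => collapse_injective hB.1 hB.2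
  trans := fun B hB b z hz => by
    obtain ⟨w, _, hw⟩ := (mem_collapse hB.1).1 hz
    exact ⟨w, hw⟩

theorem exists_setModel_sentence (hτ : τ.IsFinite) {ν : Naming τ} (hν : ν.IsNatural)
    (χ : Sentence τ') (ψ : Delta0 2) : ∃ φ : Sentence (setVoc τ τ' sA sB),
      ∀ B, B.Sat φ ↔ IsSetModel B ν χ ψ := by
  obtain ⟨lab, hlab, -⟩ := exists_wellFounded_sentence.{u}
  have I := setInterp (τ := τ) (τ' := τ') (sA := sA) (sB := sB)
  have := hτ.1
  have hx : ∀ {Γ : List (SetSort τ τ')}, TDef (τ := setVoc τ τ' sA sB) (Γ := Γ) fun B _ =>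
      B.fn (Δ := []) SetFun.x PUnit.unit := TDef.fn (Δ := []) _ TsDef.nil
  have hy : ∀ {Γ : List (SetSort τ τ')}, TDef (τ := setVoc τ τ' sA sB) (Γ := Γ) fun B _ =>
      B.fn (Δ := []) SetFun.y PUnit.unit := TDef.fn (Δ := []) _ TsDef.nil
  have h1 : Def (τ := setVoc τ τ' sA sB) (Γ := []) (fun _ => True) fun B _ =>
      (CardLabel (orderE (B.reduct (labelIncl τ τ' sA sB)))
      (orderLt (B.reduct (labelIncl τ τ' sA sB))) (orderF (B.reduct (labelIncl τ τ' sA sB)))) :=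
    ⟨lab.lift (labelIncl τ τ' sA sB), fun B _ a =>
      (Struct.sat_lift (labelIncl τ τ' sA sB) B lab).trans (hlab _)⟩
  have h2 : Def (τ := setVoc τ τ' sA sB) (Γ := []) (fun _ => True) fun B _ =>
      ∀ v w : setDom B, (∀ z, setMem B z v ↔ setMem B z w) → v = w :=
    Def.all (Def.all (Def.imp (Def.all (Def.iff (def_setMem (.hd .id) (.hd (.tl (.tl .id))))
      (def_setMem (.hd .id) (.hd (.tl .id))))) (Def.eq (.hd (.tl .id)) (.hd .id))))
  have h3 : Def (τ := setVoc τ τ' sA sB) (Γ := []) (fun B => WellFounded (setMem B) ∧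
      ∀ v w, (∀ z, setMem B z v ↔ setMem B z w) → v = w) fun B _ =>
      (B.reduct (auxIncl τ τ' sA sB)).Sat χ :=
    ⟨χ.lift (auxIncl τ τ' sA sB), fun B _ a => Struct.sat_lift (auxIncl τ τ' sA sB) B χ⟩
  have h4 : Def (τ := setVoc τ τ' sA sB) (Γ := []) (fun B => WellFounded (setMem B) ∧
      ∀ v w, (∀ z, setMem B z v ↔ setMem B z w) → v = w) fun B _ =>
      ∀ (s : τ.sorts) (y y' : B.dom ((origIncl τ τ' sA sB).sort s)),
        eltVal (i := origIncl τ τ' sA sB) setElt B s y =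
        eltVal (i := origIncl τ τ' sA sB) setElt B s y' → y = y' :=
    Def.forall_finite fun s => Def.all (Def.all (Def.imp (Def.eq (.eltVal _ (.hd (.tl .id)))
      (.eltVal _ (.hd .id))) (Def.eq (.hd (.tl .id)) (.hd .id))))
  have h5 : Def (τ := setVoc τ τ' sA sB) (Γ := []) (fun B => WellFounded (setMem B) ∧
      ∀ v w, (∀ z, setMem B z v ↔ setMem B z w) → v = w) fun B _ =>
      #{_a : B.dom (SetSort.aux sA) // True} = #{v : setDom B // (∃ n, setPi B v = num n) ∨
        ∃ s y, v = eltVal (i := origIncl τ τ' sA sB) setElt B s y} := by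
    refine Def.hartig Def.true (Def.or ?_ (Def.exists_finite fun s => Def.ex
      (Def.eq (.hd (.tl .id)) (.eltVal _ (.hd .id)))))
    exact I.def_delta0 (n := 1) (P := fun v => ∃ k, v 0 = num k) (D0.exists_num (.get .id 0))
      (f := fun _ M b => Tup.hd b) fun _ => .hd .id
  have h6 : Def (τ := setVoc τ τ' sA sB) (Γ := []) (fun B => WellFounded (setMem B) ∧
      ∀ v w, (∀ z, setMem B z v ↔ setMem B z w) → v = w) fun B _ => ∀ v : setDom B,
      (∃ a : B.dom (SetSort.aux sA), B.fn (Δ := [SetSort.aux sA]) SetFun.fromA (a, PUnit.unit) = v) ∨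
      ∃ b : B.dom (SetSort.aux sB), B.fn (Δ := [SetSort.aux sB]) SetFun.fromB (b, PUnit.unit) = v :=
    Def.all (Def.or (Def.ex (Def.eq (.fn (τ := setVoc τ τ' sA sB)
      (Δ := [SetSort.aux sA]) (s := SetSort.V) SetFun.fromA (.cons (.hd .id) .nil))
      (.hd (.tl .id)))) (Def.ex (Def.eq (.fn (τ := setVoc τ τ' sA sB)
      (Δ := [SetSort.aux sB]) (s := SetSort.V) SetFun.fromB (.cons (.hd .id) .nil))
      (.hd (.tl .id)))))
  have h7 := (I.setDef_codeData (Γ := []) (i := origIncl τ τ' sA sB) setElt hτ hν).eq hx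
  have h8 : Def (τ := setVoc τ τ' sA sB) (Γ := []) (fun B => WellFounded (setMem B) ∧
      ∀ v w, (∀ z, setMem B z v ↔ setMem B z w) → v = w) fun B _ => ψ.Realize Cd
        ![setPi B (B.fn (Δ := []) SetFun.x PUnit.unit),
          setPi B (B.fn (Δ := []) SetFun.y PUnit.unit)] :=
    (I.def_realize ψ (Γ := []) (f := ![fun B _ => B.fn (Δ := []) SetFun.x PUnit.unit,
      fun B _ => B.fn (Δ := []) SetFun.y PUnit.unit]) fun j => by
        fin_cases j
        exacts [hx, hy]).congr fun B _ a => iff_of_eq (congrArg (ψ.Realize Cd) (funext fun j => by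
          fin_cases j <;> rfl))
  obtain ⟨φ, hφ⟩ := Def.and_of_imp (h1.and h2) (fun B a h => ⟨CardLabel.wellFounded h.1, h.2⟩)
    (h3.and (h4.and (h5.and (h6.and (h7.and h8)))))
  refine ⟨φ, fun B => (hφ B trivial PUnit.unit).trans ?_⟩
  exact ⟨fun ⟨⟨h1, h2⟩, h3, h4, h5, h6, h7, h8⟩ => ⟨h3, h1, h2, h4, h5, h6, h7, h8⟩,
    fun h => ⟨⟨h.label, h.ext⟩, h.aux, h.elt_inj, h.card, h.cover, h.code, h.realize⟩⟩

end

/-! ## Structures with the same code are isomorphic -/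

theorem codeTup_map {S : Type u} {D D' : S → Type u} {e : ∀ s, D s → ZFSet.{u}}
    {e' : ∀ s, D' s → ZFSet.{u}} {g : ∀ s, D s → D' s} (h : ∀ s x, e' s (g s x) = e s x) :
    ∀ (Δ : List S) (t : Tup D Δ), codeTup e' Δ (Tup.map g Δ t) = codeTup e Δ t
  | [], _ => rfl
  | _ :: Δ, t => by
    simp only [codeTup, Tup.map]
    rw [h, codeTup_map h Δ t.2]

theorem nonempty_iso_of_codeStruct_eq {τ : Voc.{u}} {ν : Naming τ} {M M' : Struct τ} {e : Elems M}
    {e' : Elems M'} (h : codeStruct ν M e = codeStruct ν M' e') : Nonempty (Struct.Iso M M') := by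
  rw [codeStruct_eq, codeStruct_eq, ZFSet.pair_inj, ZFSet.pair_inj] at h
  obtain ⟨h1, h2, h3⟩ := h
  have hs : ∀ s, ZFSet.range (e.el s) = ZFSet.range (e'.el s) := fun s =>
    (nm_pair_mem_codeDomains (nm := ν.sort) (el := e'.el) ν.sort_inj).1
      ((congrArg (ZFSet.pair (ν.sort s) (ZFSet.range (e.el s)) ∈ ·) h1).mp
        ((nm_pair_mem_codeDomains (nm := ν.sort) (el := e.el) ν.sort_inj).2 rfl))
  have hr : ∀ {Δ} (r : τ.rels Δ), codeRelGraph M e r = codeRelGraph M' e' r := fun r =>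
    (pair_mem_codeRels r).1 (h2 ▸ (pair_mem_codeRels r).2 rfl)
  have hf : ∀ {Δ s} (f : τ.funs Δ s), codeFnGraph M e f = codeFnGraph M' e' f := fun f =>
    (pair_mem_codeFns f).1 (h3 ▸ (pair_mem_codeFns f).2 rfl)
  have hg : ∀ s x, ∃ y, e'.el s y = e.el s x := fun s x =>
    ZFSet.mem_range.1 (hs s ▸ ZFSet.mem_range.2 ⟨x, rfl⟩)
  choose g hg using hg
  have hbij : ∀ s, Function.Bijective (g s) := fun s => by
    refine ⟨fun x y hxy => e.el_inj s ?_, fun y => ?_⟩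
    · rw [← hg, ← hg, hxy]
    · obtain ⟨x, hx⟩ : ∃ x, e.el s x = e'.el s y :=
        ZFSet.mem_range.1 ((hs s).symm ▸ ZFSet.mem_range.2 ⟨y, rfl⟩)
      exact ⟨x, e'.el_inj s ((hg s x).trans hx)⟩
  refine ⟨⟨fun s => Equiv.ofBijective (g s) (hbij s), fun {Δ} r t => ?_, fun {Δ s} f t => ?_⟩⟩
  · rw [← codeTup_mem_codeRelGraph (e := e), hr, ← codeTup_map hg Δ t]
    exact codeTup_mem_codeRelGraph (e := e') r _
  · have h4 : ZFSet.pair (codeTup e.el Δ t) (e.el s (M.fn f t)) ∈ codeFnGraph M' e' f :=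
      hf f ▸ ZFSet.mem_range.2 ⟨t, rfl⟩
    obtain ⟨t', h5⟩ := ZFSet.mem_range.1 h4
    obtain ⟨h6, h7⟩ := ZFSet.pair_inj.1 h5
    rw [← codeTup_map hg Δ t] at h6
    obtain rfl := codeTup_injective e'.el_inj Δ h6
    exact e'.el_inj s ((hg s _).trans h7.symm)

theorem codeStruct_mem_classCode {τ : Voc.{u}} {ν : Naming τ} {K : Set (Struct τ)}
    (hK : IsoClosed K) (M : Struct τ) (e : Elems M) : codeStruct ν M e ∈ classCode ν K ↔ M ∈ K := by
  refine ⟨?_, fun h => ⟨M, h, e, rfl⟩⟩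
  rintro ⟨M', hM', e', h⟩
  exact hK M' M hM' (nonempty_iso_of_codeStruct_eq h.symm)

/-! ## Structures with a set model -/

theorem IsSetModel.wellFounded {τ τ' : Voc.{u}} {sA sB : τ'.sorts}
    {B : Struct (setVoc τ τ' sA sB)} {ν : Naming τ} {χ : Sentence τ'} {ψ : Delta0 2}
    (h : IsSetModel B ν χ ψ) : WellFounded (setMem B) := h.label.wellFounded

theorem IsSetModel.exists_realize {τ τ' : Voc.{u}} {sA sB : τ'.sorts}
    {B : Struct (setVoc τ τ' sA sB)} {ν : Naming τ} {χ : Sentence τ'} {ψ : Delta0 2}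
    (h : IsSetModel B ν χ ψ) : ∃ (e : Elems (B.reduct (origIncl τ τ' sA sB))) (y : ZFSet.{u}),
      ψ.Realize Cd ![codeStruct ν (B.reduct (origIncl τ τ' sA sB)) e, y] := by
  have hinj : Function.Injective (setPi B) := collapse_injective h.wellFounded h.ext
  refine ⟨⟨fun s y => setPi B (eltVal (i := origIncl τ τ' sA sB) setElt B s y), fun s y y' hy =>
    h.elt_inj s y y' (hinj hy)⟩, setPi B (B.fn (Δ := []) SetFun.y PUnit.unit), ?_⟩
  have h1 := h.realize
  rw [h.code] at h1
  exact h1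

/-! ### Bounds for the cardinality of a set model -/

theorem relRank_le {A : Type u} {E : A → A → Prop} (h : WellFounded E) :
    relRank h ≤ (Order.succ #A).ord := by
  refine Ordinal.iSup_le fun a => Order.succ_le_of_lt (lt_ord.2 (Order.lt_succ_iff.2 ?_))
  have h1 : Set.Iio (h.apply a).rank ⊆ Set.range fun b => (h.apply b).rank := fun o ho => by
    obtain ⟨b, _, hb⟩ := (h.apply a).mem_range_rank_of_le (le_of_lt ho)
    exact ⟨b, hb⟩
  have h2 := (mk_le_mk_of_subset h1).trans ((lift_id'.{u, u + 1} _).symm.trans_le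
    (mk_range_le_lift (f := fun b => (h.apply b).rank)))
  rwa [mk_Iio_ordinal, lift_le] at h2

theorem twoVoc_bound {τ' : Voc.{u}} {i : Voc.Incl twoVoc.{u} τ'} {χ : Sentence τ'}
    {K : Set (Struct twoVoc.{u})} (h : IsBoundedProjection i χ K) (D : TwoSort.{u} → Type u) :
    ∃ c : Cardinal.{u}, ∀ N : Struct τ', N.Sat χ →
      (∀ s, Nonempty (N.dom (i.sort s) ≃ D s)) → N.card ≤ c := by
  classical
  by_cases hD : ∀ s, Nonempty (D s)
  swap
  · refine ⟨0, fun N _ hN => absurd (fun s => ?_) hD⟩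
    obtain ⟨g⟩ := hN s
    exact (N.dom_nonempty _).map g
  obtain ⟨c, hc⟩ := h.2 ⟨D, hD, fun r => r.elim, fun f => f.elim⟩
  refine ⟨c, fun N hN hND => ?_⟩
  let D' : τ'.sorts → Type u := fun s' => if h : ∃ s, i.sort s = s' then D h.choose else N.dom s'
  have hD' : ∀ s, D' (i.sort s) = D s := fun s => by
    have h1 : ∃ s₁, i.sort s₁ = i.sort s := ⟨s, rfl⟩
    simp only [D', dif_pos h1]
    rw [i.sort_inj h1.choose_spec]
  have hg : ∀ s', Nonempty (N.dom s' ≃ D' s') := fun s' => by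
    by_cases h1 : ∃ s, i.sort s = s'
    · obtain ⟨s, rfl⟩ := h1
      rw [hD']
      exact hND s
    · simp only [D', dif_neg h1]
      exact ⟨Equiv.refl _⟩
  let g : ∀ s', N.dom s' ≃ D' s' := fun s' => (hg s').some
  have h2 := hc (N.transport g) (((N.transportIso g).sat χ).2 hN) (twoVoc_ext (funext hD'))
  exact (mk_congr (Equiv.sigmaCongrRight g)).trans_le h2

theorem twoVoc_bound_of_le {τ' : Voc.{u}} {i : Voc.Incl twoVoc.{u} τ'} {χ : Sentence τ'}
    {K : Set (Struct twoVoc.{u})} (h : IsBoundedProjection i χ K) (a b : Cardinal.{u}) :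
    ∃ c : Cardinal.{u}, ∀ N : Struct τ', N.Sat χ →
      #(N.dom (i.sort TwoSort.A)) ≤ a → #(N.dom (i.sort TwoSort.B)) ≤ b → N.card ≤ c := by
  choose c hc using twoVoc_bound h
  let D : Set a.out × Set b.out → TwoSort.{u} → Type u := fun p s => match s with
    | TwoSort.A => p.1
    | TwoSort.B => p.2
  refine ⟨⨆ p, c (D p), fun N hN ha hb => ?_⟩
  rw [← a.mk_out, le_mk_iff_exists_set] at ha
  rw [← b.mk_out, le_mk_iff_exists_set] at hb
  obtain ⟨p, hp⟩ := ha
  obtain ⟨q, hq⟩ := hb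
  refine (hc (D (p, q)) N hN fun s => ?_).trans
    (le_ciSup (f := fun p => c (D p)) bddAbove_of_small (p, q))
  cases s with
  | A => exact Cardinal.eq.1 hp.symm
  | B => exact Cardinal.eq.1 hq.symm

section
variable {τ τ' : Voc.{u}} {sA sB : τ'.sorts} {B : Struct (setVoc τ τ' sA sB)} {ν : Naming τ}
  {χ : Sentence τ'} {ψ : Delta0 2}

theorem IsSetModel.card_auxA_le (h : IsSetModel B ν χ ψ) :
    #(B.dom (SetSort.aux sA)) ≤ ℵ₀ + (B.reduct (origIncl τ τ' sA sB)).card := by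
  have hinj : Function.Injective (setPi B) := collapse_injective h.wellFounded h.ext
  rw [← mk_congr (Equiv.subtypeUnivEquiv (p := fun _ : B.dom (SetSort.aux sA) => True)
    fun _ => trivial), h.card]
  refine (mk_union_le {v | ∃ n, setPi B v = num n}
    {v | ∃ s y, v = eltVal (i := origIncl τ τ' sA sB) setElt B s y}).trans (add_le_add ?_ ?_)
  · refine (mk_le_of_injective (β := ULift.{u} ℕ) (f := fun v => ⟨v.2.choose⟩)
      fun v w hvw => ?_).trans (by simp)
    refine Subtype.ext (hinj ?_)
    rw [v.2.choose_spec, w.2.choose_spec]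
    exact congrArg num (congrArg ULift.down hvw)
  · refine (mk_le_mk_of_subset ?_).trans (mk_range_le (f := fun p :
      Σ s, (B.reduct (origIncl τ τ' sA sB)).dom s =>
        eltVal (i := origIncl τ τ' sA sB) setElt B p.1 p.2))
    rintro _ ⟨s, y, rfl⟩
    exact ⟨⟨s, y⟩, rfl⟩

theorem IsSetModel.card_setDom_le (h : IsSetModel B ν χ ψ) :
    #(setDom B) ≤ #(B.dom (SetSort.aux sA)) + #(B.dom (SetSort.aux sB)) := by
  rw [add_def]
  refine mk_le_of_surjective (f := Sum.elim
    (fun a => B.fn (Δ := [SetSort.aux sA]) SetFun.fromA (a, PUnit.unit))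
    (fun b => B.fn (Δ := [SetSort.aux sB]) SetFun.fromB (b, PUnit.unit))) fun v => ?_
  rcases h.cover v with ⟨a, ha⟩ | ⟨b, hb⟩
  exacts [⟨.inl a, ha⟩, ⟨.inr b, hb⟩]

theorem IsSetModel.card_label_le (h : IsSetModel B ν χ ψ) :
    #(B.dom SetSort.O) ≤ ℵ_ (Order.succ #(setDom B)).ord :=
  (h.label.card_le h.wellFounded).trans (aleph_le_aleph.2 (relRank_le _))

theorem card_setVoc_le (B : Struct (setVoc τ τ' sA sB)) :
    B.card ≤ (B.reduct (origIncl τ τ' sA sB)).card + ((B.reduct (auxIncl τ τ' sA sB)).card +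
      (#(setDom B) + #(B.dom SetSort.O))) := by
  simp only [Struct.card, add_def]
  refine mk_le_of_injective (f := fun x => match x with
    | ⟨SetSort.orig s, a⟩ => Sum.inl ⟨s, a⟩
    | ⟨SetSort.aux s, a⟩ => Sum.inr (Sum.inl ⟨s, a⟩)
    | ⟨SetSort.V, a⟩ => Sum.inr (Sum.inr (Sum.inl a))
    | ⟨SetSort.O, a⟩ => Sum.inr (Sum.inr (Sum.inr a))) ?_
  rintro ⟨_ | _ | _ | _, x⟩ ⟨_ | _ | _ | _, y⟩ hxy <;> cases hxy <;> rfl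

end

theorem exists_setModel_bound {F : Cardinal.{u} → Cardinal.{u}} (hF : Monotone F) {τ τ' : Voc.{u}}
    {i : Voc.Incl twoVoc.{u} τ'} {χ : Sentence τ'} (hχ : IsBoundedProjection i χ
      {M : Struct twoVoc.{u} | #(M.dom TwoSort.B) ≤ F #(M.dom TwoSort.A)}) (ν : Naming τ)
    (ψ : Delta0 2) (M : Struct τ) : ∃ c : Cardinal.{u},
      ∀ B : Struct (setVoc τ τ' (i.sort TwoSort.A) (i.sort TwoSort.B)), IsSetModel B ν χ ψ →
        B.reduct (origIncl τ τ' (i.sort TwoSort.A) (i.sort TwoSort.B)) = M → B.card ≤ c := by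
  obtain ⟨c, hc⟩ := twoVoc_bound_of_le hχ (ℵ₀ + M.card) (F (ℵ₀ + M.card))
  let v := ℵ₀ + M.card + F (ℵ₀ + M.card)
  refine ⟨M.card + (c + (v + ℵ_ (Order.succ v).ord)), ?_⟩
  rintro B hB rfl
  have hA := hB.card_auxA_le
  have hBA : #(B.dom (SetSort.aux (i.sort TwoSort.B))) ≤
      F #(B.dom (SetSort.aux (i.sort TwoSort.A))) := (hχ.1 _).2 ⟨_, hB.aux, rfl⟩
  have hV : #(setDom B) ≤ v := hB.card_setDom_le.trans (add_le_add hA (hBA.trans (hF hA)))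
  refine (card_setVoc_le B).trans (add_le_add le_rfl (add_le_add
    (hc _ hB.aux hA (hBA.trans (hF hA))) (add_le_add hV (hB.card_label_le.trans ?_))))
  exact aleph_le_aleph.2 (ord_le_ord.2 (Order.succ_le_succ hV))


/-! ## The set model over a structure -/

/-- The same tuple, with its sorts named before renaming along `i`. -/
def Tup.pull {S S' : Type u} (i : S → S') (D : S' → Type u) :
    (Δ : List S) → Tup D (Δ.map i) → Tup (fun s => D (i s)) Δ
  | [], _ => PUnit.unit
  | _ :: Δ, t => (t.1, Tup.pull i D Δ t.2)

theorem Tup.pull_push {S S' : Type u} (i : S → S') (D : S' → Type u) :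
    ∀ (Δ : List S) (t : Tup (fun s => D (i s)) Δ), Tup.pull i D Δ (Tup.push i D Δ t) = t
  | [], _ => rfl
  | _ :: Δ, t => Prod.ext rfl (Tup.pull_push i D Δ t.2)

section
variable {τ τ' : Voc.{u}} {sA sB : τ'.sorts} (M : Struct τ) (N : Struct τ') {V O : Type u}

/-- The domains of the set model. -/
def setStructDom (V O : Type u) : SetSort τ τ' → Type u
  | .orig s => M.dom s
  | .aux s => N.dom s
  | .V => V
  | .O => O

/-- The set model over `M`, with auxiliary part `N`. -/
def setStruct (hV : Nonempty V) (hO : Nonempty O) (mem : V → V → Prop) (lt : O → O → Prop)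
    (label : V → O) (elt : ∀ s, M.dom s → V) (fromA : N.dom sA → V) (fromB : N.dom sB → V)
    (x y : V) : Struct (setVoc τ τ' sA sB) where
  dom := setStructDom M N V O
  dom_nonempty := fun s => match s with
    | .orig s => M.dom_nonempty s
    | .aux s => N.dom_nonempty s
    | .V => hV
    | .O => hO
  rel := fun r => match r with
    | @SetRel.orig _ _ Δ r => fun t =>
      M.rel r (Tup.pull SetSort.orig (setStructDom M N V O) Δ t)
    | @SetRel.aux _ _ Δ r => fun t =>
      N.rel r (Tup.pull SetSort.aux (setStructDom M N V O) Δ t)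
    | .mem => fun t => mem t.1 t.2.1
    | .lt => fun t => lt t.1 t.2.1
  fn := fun c => match c with
    | @SetFun.orig _ _ _ _ Δ _ f => fun t =>
      M.fn f (Tup.pull SetSort.orig (setStructDom M N V O) Δ t)
    | @SetFun.aux _ _ _ _ Δ _ f => fun t =>
      N.fn f (Tup.pull SetSort.aux (setStructDom M N V O) Δ t)
    | .label => fun t => label t.1
    | .elt s => fun t => elt s t.1
    | .fromA => fun t => fromA t.1
    | .fromB => fun t => fromB t.1
    | .x => fun _ => x
    | .y => fun _ => y

variable {M N} {hV : Nonempty V} {hO : Nonempty O} {mem : V → V → Prop} {lt : O → O → Prop}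
  {label : V → O} {elt : ∀ s, M.dom s → V} {fromA : N.dom sA → V} {fromB : N.dom sB → V} {x y : V}

theorem setStruct_orig : (setStruct M N hV hO mem lt label elt fromA fromB x y).reduct
    (origIncl τ τ' sA sB) = M := by
  obtain ⟨dom, hd, rel, fn⟩ := M
  unfold Struct.reduct
  congr 1
  · funext Δ r t
    exact congrArg (rel r) (Tup.pull_push _ _ Δ t)
  · funext Δ s f t
    exact congrArg (fn f) (Tup.pull_push _ _ Δ t)

theorem setStruct_aux : (setStruct M N hV hO mem lt label elt fromA fromB x y).reduct
    (auxIncl τ τ' sA sB) = N := by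
  obtain ⟨dom, hd, rel, fn⟩ := N
  unfold Struct.reduct
  congr 1
  · funext Δ r t
    exact congrArg (rel r) (Tup.pull_push _ _ Δ t)
  · funext Δ s f t
    exact congrArg (fn f) (Tup.pull_push _ _ Δ t)

theorem codeData_congr {ν : Naming τ} {D : τ.sorts → Type u} {el el' : ∀ s, D s → ZFSet.{u}}
    {rel rel' : ∀ {Δ : List τ.sorts}, τ.rels Δ → Tup D Δ → Prop}
    {fn fn' : ∀ {Δ : List τ.sorts} {s : τ.sorts}, τ.funs Δ s → Tup D Δ → D s}
    (h1 : ∀ s y, el s y = el' s y) (h2 : ∀ {Δ} (r : τ.rels Δ) t, rel r t = rel' r t)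
    (h3 : ∀ {Δ s} (f : τ.funs Δ s) t, fn f t = fn' f t) :
    codeData ν el rel fn = codeData ν el' rel' fn' := by
  obtain rfl : el = el' := funext fun s => funext (h1 s)
  obtain rfl : @rel = @rel' := funext fun Δ => funext fun r => funext fun t => h2 r t
  obtain rfl : @fn = @fn' := funext fun Δ => funext fun s => funext fun f => funext fun t => h3 f t
  rfl

theorem isSetModel_setStruct {ν : Naming τ} {χ : Sentence τ'} {ψ : Delta0 2}
    {f : V → ZFSet.{u}} (hf : Function.Injective f) (hft : ∀ v, ∀ z ∈ f v, ∃ w, f w = z)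
    (hmem : ∀ v w, mem v w ↔ f v ∈ f w) (e : Elems M) (helt : ∀ s y, f (elt s y) = e.el s y)
    (hx : f x = codeStruct ν M e) (hy : ψ.Realize Cd ![f x, f y]) (hN : N.Sat χ)
    (hlabel : CardLabel mem lt label)
    (hcard : #(N.dom sA) = #{v // (∃ n, f v = num n) ∨ ∃ s y, v = elt s y})
    (hcover : ∀ v, (∃ a, fromA a = v) ∨ ∃ b, fromB b = v) :
    IsSetModel (setStruct M N hV hO mem lt label elt fromA fromB x y) ν χ ψ := by
  have hpi : setPi (setStruct M N hV hO mem lt label elt fromA fromB x y) = f :=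
    collapse_eq hmem hft
  refine ⟨setStruct_aux.symm ▸ hN, hlabel, fun v w h => hf (ZFSet.ext fun z => ?_),
    fun s y y' h => e.el_inj s ?_, ?_, hcover, ?_, ?_⟩
  · constructor
    · intro hz
      obtain ⟨w', rfl⟩ := hft v z hz
      exact (hmem _ _).1 ((h w').1 ((hmem _ _).2 hz))
    · intro hz
      obtain ⟨w', rfl⟩ := hft w z hz
      exact (hmem _ _).1 ((h w').2 ((hmem _ _).2 hz))
  · exact (helt s y).symm.trans ((congrArg f h).trans (helt s y'))
  · rw [hpi]
    exact (mk_congr (Equiv.subtypeUnivEquiv (p := fun _ : N.dom sA => True)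
      fun _ => trivial)).trans hcard
  · rw [hpi]
    refine hx.trans ?_
    refine codeData_congr (D := M.dom) (fun s y => (helt s y).symm) (fun {Δ} r t => ?_)
      fun {Δ s} c t => ?_
    · exact congrArg (M.rel r) (Tup.pull_push SetSort.orig (setStructDom M N V O) Δ t).symm
    · exact congrArg (M.fn c) (Tup.pull_push SetSort.orig (setStructDom M N V O) Δ t).symm
  · rw [hpi]
    exact hy

end

/-! ### Codes of small rank -/

theorem exists_small_family (D : Type u) : ∃ g : D → ZFSet.{u}, Function.Injective g ∧
    ∀ κ : Cardinal.{u}, ℵ₀ ≤ κ → #D ≤ κ → ∀ d, hRank (g d) ≤ κ := by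
  refine ⟨fun d => (Ordinal.typein WellOrderingRel d).toZFSet, fun d d' h =>
    Ordinal.typein_injective _ (Ordinal.toZFSet_injective h), fun κ hκ hD d =>
    hRank_toZFSet hκ ?_⟩
  exact (Ordinal.card_typein (r := WellOrderingRel) d).symm.trans_le ((mk_subtype_le _).trans hD)

theorem mk_tup_le {S : Type u} {D : S → Type u} {κ : Cardinal.{u}} (hκ : ℵ₀ ≤ κ)
    (h : ∀ s, #(D s) ≤ κ) (Δ : List S) : #(Tup D Δ) ≤ κ := by
  induction Δ with
  | nil => exact (mk_punit.trans_le one_le_aleph0).trans hκ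
  | cons s Δ ih =>
    refine (mk_prod (D s) (Tup D Δ)).trans_le ?_
    rw [lift_id, lift_id]
    exact mul_le_of_le hκ (h s) ih

theorem hRank_codeStruct {τ : Voc.{u}} {ν : Naming τ} (hτ : τ.IsFinite) (hν : ν.IsNatural)
    {M : Struct τ} {e : Elems M} {κ : Cardinal.{u}} (hκ : ℵ₀ ≤ κ) (hM : ∀ s, #(M.dom s) ≤ κ)
    (he : ∀ s y, hRank (e.el s y) ≤ κ) : hRank (codeStruct ν M e) ≤ κ := by
  obtain ⟨hs, hr, hf⟩ := hτ
  have num_le : ∀ {x : ZFSet.{u}}, (∃ n, x = num n) → hRank x ≤ κ := by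
    rintro _ ⟨n, rfl⟩
    exact hRank_num hκ
  have hl : ∀ Δ : List τ.sorts, hRank (codeList (Δ.map ν.sort)) ≤ κ := fun Δ =>
    hRank_codeList hκ fun x hx => by
      obtain ⟨s, -, rfl⟩ := List.mem_map.1 hx
      exact num_le (hν.1 s)
  refine hRank_pair (hRank_range hκ (mk_le_aleph0.trans hκ) fun s => hRank_pair (num_le (hν.1 s))
    (hRank_range hκ (hM s) (he s))) (hRank_pair (hRank_range hκ (mk_le_aleph0.trans hκ) fun r =>
      hRank_pair (hRank_pair (num_le (hν.2.1 _ _)) (hl _)) (hRank_range hκ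
        ((mk_subtype_le _).trans (mk_tup_le hκ hM _)) fun t => hRank_codeTup hκ he _ _))
      (hRank_range hκ (mk_le_aleph0.trans hκ) fun f =>
        hRank_pair (hRank_pair (num_le (hν.2.2 _ _ _)) (hRank_pair (hl _) (num_le (hν.1 _))))
          (hRank_range hκ (mk_tup_le hκ hM _) fun t => hRank_pair (hRank_codeTup hκ he _ _)
            (he _ _))))

theorem el_mem_of_codeStruct_mem {τ : Voc.{u}} {ν : Naming τ} {M : Struct τ} {e : Elems M}
    {U : ZFSet.{u}} (hU : U.IsTransitive) (h : codeStruct ν M e ∈ U) (s : τ.sorts) (y : M.dom s) :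
    e.el s y ∈ U :=
  hU _ (snd_mem_of_pair_mem hU (hU _ (fst_mem_of_pair_mem hU h) (ZFSet.mem_range.2 ⟨s, rfl⟩)))
    (ZFSet.mem_range.2 ⟨y, rfl⟩)

/-- Two sets and all natural numbers lie in a small transitive set. -/
theorem exists_transitive_set (x y : ZFSet.{u}) : ∃ W : ZFSet.{u}, W.IsTransitive ∧ x ∈ W ∧ y ∈ W ∧
    (∀ n, num n ∈ W) ∧ W.card ≤ hRank x + hRank y := by
  have hκ : ℵ₀ ≤ hRank x + hRank y := (aleph0_le_hRank x).trans (self_le_add_right _ _)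
  refine ⟨insert x (trcl x) ∪ (insert y (trcl y) ∪ Ordinal.omega0.toZFSet), ?_, by simp, by simp,
    fun n => ?_, ?_⟩
  · exact (isTransitive_insert (trcl_isTransitive x) (subset_trcl x)).union
      ((isTransitive_insert (trcl_isTransitive y) (subset_trcl y)).union
        (ZFSet.isOrdinal_toZFSet _).isTransitive)
  · simp only [ZFSet.mem_union]
    refine .inr (.inr ?_)
    rw [num_eq_toZFSet, Ordinal.toZFSet_mem_toZFSet_iff]
    exact Ordinal.natCast_lt_omega0 n
  · refine card_union_le_of hκ (card_insert_le_of hκ ((card_trcl_le_hRank x).trans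
      (self_le_add_right _ _))) (card_union_le_of hκ (card_insert_le_of hκ
        ((card_trcl_le_hRank y).trans (self_le_add_left _ _))) ?_)
    simpa using hκ

/-! ## Bounded definability in set theory and bounded projections -/

theorem exists_isSetModel {F : Cardinal.{u} → Cardinal.{u}} (hF : Monotone F) {τ τ' : Voc.{u}}
    {i : Voc.Incl twoVoc.{u} τ'} {χ : Sentence τ'} (hχ : IsBoundedProjection i χ
      {M : Struct twoVoc.{u} | #(M.dom TwoSort.B) ≤ F #(M.dom TwoSort.A)}) {ν : Naming τ}
    (hτ : τ.IsFinite) (hν : ν.IsNatural) {ψ : Delta0 2} {M : Struct τ}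
    (h : ∀ e : Elems M, ∃ y, hRank y ≤ F (hRank (codeStruct ν M e)) ∧
      ψ.Realize Cd ![codeStruct ν M e, y]) :
    ∃ B : Struct (setVoc τ τ' (i.sort TwoSort.A) (i.sort TwoSort.B)), IsSetModel B ν χ ψ ∧
      B.reduct (origIncl τ τ' (i.sort TwoSort.A) (i.sort TwoSort.B)) = M := by
  choose g hg hgr using fun s => exists_small_family (M.dom s)
  let e : Elems M := ⟨g, hg⟩
  obtain ⟨y, hyr, hy⟩ := h e
  obtain ⟨W, hW, hxW, hyW, hnW, hWc⟩ := exists_transitive_set (codeStruct ν M e) y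
  obtain ⟨V, f, hf, hfW, hV⟩ := exists_family W
  have hft : ∀ v, ∀ z ∈ f v, ∃ w, f w = z := fun v z hz =>
    (hfW z).1 (hW _ ((hfW _).2 ⟨v, rfl⟩) hz)
  obtain ⟨x', hx'⟩ := (hfW _).1 hxW
  obtain ⟨y', hy'⟩ := (hfW _).1 hyW
  choose elt helt using fun s d => (hfW _).1 (el_mem_of_codeStruct_mem hW hxW s d)
  choose nat hnat using fun n => (hfW _).1 (hnW n)
  let A := {v // (∃ n, f v = num n) ∨ ∃ s d, v = elt s d}
  have hA : ℵ₀ ≤ #A := by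
    rw [aleph0_le_mk_iff]
    refine Infinite.of_injective (fun n : ℕ => (⟨nat n, .inl ⟨n, hnat n⟩⟩ : A)) fun m n hmn => ?_
    have h1 := congrArg f (congrArg Subtype.val hmn)
    simp only [hnat] at h1
    exact num_injective h1
  have hMA : ∀ s, #(M.dom s) ≤ #A := fun s => by
    refine mk_le_of_injective (f := fun d => (⟨elt s d, .inr ⟨s, d, rfl⟩⟩ : A)) fun d d' hd => ?_
    have h1 := congrArg f (congrArg Subtype.val hd)
    simp only [helt] at h1
    exact e.el_inj s h1
  have hxA : hRank (codeStruct ν M e) ≤ #A :=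
    hRank_codeStruct hτ hν hA hMA fun s d => hgr s _ hA (hMA s) d
  have hne : Nonempty A := mk_ne_zero_iff.1 (aleph0_pos.trans_le hA).ne'
  have hne' : Nonempty (hRank y).out := mk_ne_zero_iff.1 (by
    rw [mk_out]; exact (aleph0_pos.trans_le (aleph0_le_hRank y)).ne')
  let P : Struct twoVoc.{u} :=
    { dom := fun s => match s with
        | TwoSort.A => A
        | TwoSort.B => (hRank y).out
      dom_nonempty := fun s => match s with
        | TwoSort.A => hne
        | TwoSort.B => hne'
      rel := fun r => r.elim
      fn := fun c => c.elim }
  obtain ⟨N, hN, hNP⟩ := (hχ.1 P).1 (by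
    change #(hRank y).out ≤ F #A
    rw [mk_out]
    exact hyr.trans (hF hxA))
  have hNA : #(N.dom (i.sort TwoSort.A)) = #A := congrArg (fun Q => #(Q.dom TwoSort.A)) hNP
  have hNB : #(N.dom (i.sort TwoSort.B)) = hRank y :=
    (congrArg (fun Q => #(Q.dom TwoSort.B)) hNP).trans (mk_out _)
  have hVAB : #V ≤ #(N.dom (i.sort TwoSort.A) ⊕ N.dom (i.sort TwoSort.B)) := by
    rw [← add_def, hNA, hNB, hV]
    exact hWc.trans (add_le_add hxA le_rfl)
  obtain ⟨k⟩ := hVAB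
  have : Nonempty V := ⟨x'⟩
  have hk := Function.invFun_surjective k.injective
  obtain ⟨O, lt, label, hO, hlabel⟩ := exists_cardLabel
    (wellFounded_of_iff_mem (r := fun v w => f v ∈ f w) fun _ _ => Iff.rfl)
  refine ⟨setStruct M N ⟨x'⟩ hO (fun v w => f v ∈ f w) lt label elt
    (fun a => Function.invFun k (.inl a)) (fun b => Function.invFun k (.inr b)) x' y',
    isSetModel_setStruct hf hft (fun _ _ => Iff.rfl) e helt hx' ?_ hN hlabel hNA fun v => ?_,
    setStruct_orig⟩
  · rw [hx', hy']
    exact hy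
  · obtain ⟨a | b, hv⟩ := hk v
    exacts [.inl ⟨a, hv⟩, .inr ⟨b, hv⟩]

theorem sigmaB_of_isSigma1 {F : Cardinal.{u} → Cardinal.{u}} (hF : DefinablyBounding F)
    {τ : Voc.{u}} {ν : Naming τ} (hτ : τ.IsFinite) (hν : ν.IsNatural) {K : Set (Struct τ)}
    {X : Set ZFSet.{u}} (hX : IsSigma1 F Cd X)
    (hK : ∀ (M : Struct τ) (e : Elems M), codeStruct ν M e ∈ X ↔ M ∈ K) : SigmaB LI K := by
  obtain ⟨hmono, τ', i, χ, -, hχ⟩ := hF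
  obtain ⟨ψ, hψ, hbound⟩ := hX
  obtain ⟨φ, hφ⟩ := exists_setModel_sentence (sA := i.sort TwoSort.A) (sB := i.sort TwoSort.B)
    hτ hν χ ψ
  refine ⟨setVoc τ τ' (i.sort TwoSort.A) (i.sort TwoSort.B), origIncl _ _ _ _, φ, trivial,
    fun M => ⟨fun hM => ?_, ?_⟩, fun M => ?_⟩
  · obtain ⟨B, hB, hBM⟩ := exists_isSetModel hmono hχ hτ hν fun e =>
      hbound _ ((hK M e).2 hM)
    exact ⟨B, (hφ B).2 hB, hBM⟩
  · rintro ⟨B, hB, rfl⟩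
    obtain ⟨e, y, hy⟩ := ((hφ B).1 hB).exists_realize
    exact (hK _ e).1 ((hψ _).2 ⟨y, hy⟩)
  · obtain ⟨c, hc⟩ := exists_setModel_bound hmono hχ ν ψ M
    exact ⟨c, fun B hB => hc B ((hφ B).1 hB)⟩

theorem deltaB_of_isDelta1 {F : Cardinal.{u} → Cardinal.{u}} (hF : DefinablyBounding F)
    {τ : Voc.{u}} {ν : Naming τ} (hτ : τ.IsFinite) (hν : ν.IsNatural) {K : Set (Struct τ)}
    (hK : IsoClosed K) (h : IsDelta1 F Cd (classCode ν K)) : DeltaB LI K :=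
  ⟨sigmaB_of_isSigma1 hF hτ hν h.1 (codeStruct_mem_classCode hK),
    sigmaB_of_isSigma1 hF hτ hν h.2 fun M e => not_congr (codeStruct_mem_classCode hK M e)⟩

end BSymb

theorem proposition5p2 :
    BSymb.BoundedlySymbiotic.{u} BSymb.LI BSymb.Cd ∧
    (BSymb.DefinablyBounding (fun κ : Cardinal.{u} => 2 ^ (2 : Cardinal.{u}) ^ κ) ∧
      BSymb.IsDelta1 (fun κ : Cardinal.{u} => 2 ^ (2 : Cardinal.{u}) ^ κ) BSymb.Cd
        (BSymb.satRel BSymb.LI)) ∧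
    (BSymb.SigmaB BSymb.LI
        {M : BSymb.Struct BSymb.graphVoc.{u} | WellFounded (BSymb.graphE M)} ∧
      ∃ φ : BSymb.Sentence BSymb.orderVoc.{u}, φ ∈ BSymb.LI BSymb.orderVoc ∧
        BSymb.IsBoundedProjection BSymb.graphIncl φ
          {M : BSymb.Struct BSymb.graphVoc.{u} | WellFounded (BSymb.graphE M)} ∧
        ∀ M : BSymb.Struct BSymb.orderVoc.{u}, M.Sat φ →
          IsStrictTotalOrder (M.dom BSymb.WSort.B) (BSymb.orderLt M) ∧
          BSymb.CardinalLike (BSymb.orderLt M) ∧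
          (∀ a a', BSymb.orderE M a a' →
            BSymb.orderLt M (BSymb.orderF M a) (BSymb.orderF M a')) ∧
          (∀ a, Cardinal.aleph0 ≤ BSymb.predCard (BSymb.orderLt M) (BSymb.orderF M a) ∧
            BSymb.ElemCardinalLike (BSymb.orderLt M) (BSymb.orderF M a)) ∧
          ∀ h : WellFounded (BSymb.orderE M),
            Cardinal.mk (M.dom BSymb.WSort.B) ≤ Cardinal.aleph (BSymb.relRank h)) := by
  have hδ := BSymb.isDelta1_satRel.{u} (F := fun κ => 2 ^ (2 : Cardinal.{u}) ^ κ)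
    fun κ _ => Cardinal.power_le_power_left two_ne_zero (Cardinal.cantor κ).le
  obtain ⟨φ, hφ, hproj⟩ := BSymb.exists_wellFounded_sentence.{u}
  refine ⟨⟨⟨_, BSymb.definablyBounding_two_power, hδ⟩, fun F hF τ ν hτ hν K hK hKF =>
      BSymb.deltaB_of_isDelta1 hF hτ hν hK hKF⟩, ⟨BSymb.definablyBounding_two_power, hδ⟩,
    ⟨_, BSymb.graphIncl, φ, trivial, hproj⟩, φ, trivial, hproj, fun M hM => ?_⟩
  have h := (hφ M).1 hM
  exact ⟨h.isStrictTotalOrder, h.cardinalLike, h.mono,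
    fun a => ⟨h.aleph0_le a, h.elemCardinalLike a⟩, fun hwf => h.card_le hwf⟩
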